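/- **Setting.** Let $(\mathsf{CSS}_\kappa)_{\kappa\in\mathbb N}$ be a family of self-dual $[[m,1]]$ CSS codes, $m=m(\kappa)\le\operatorname{poly}(\kappa)$, such that $\mathsf{CSS}_\kappa$ has distance at least $2\kappa+1$ and is equipped with a syndrome decoder that corrects $\kappa$ errors. That is, there is a binary code $C\supseteq C^\perp$ of length $m$ with $\dim C=\dim C^\perp+1$, the words of $C^\perp$ give both the $\mathsf X$ and the $\mathsf Z$ stabilisers, the encoding is $|b\rangle\mapsto |C^\perp|^{-1/2}\sum_{u\in C^\perp}|u+b^m\rangle$, and decoding corrects $\mathsf X$ and $\mathsf Z$ errors separately, as a function of their syndromes. **Circuits.** The circuit class consists of the circuits of $\mathsf{CNOT}$ gates, Pauli gates $\mathsf X,\mathsf Z$ (possibly controlled by a classical function of earlier measurement outcomes), and single-qubit measurements in the computational or the Hadamard basis. No gate acts on a wire that has been measured, although outcomes may be used as classical controls. A circuit $c$ also names its output wires; all other wires are traced out at the end. $\Phi_c$ is the resulting channel. **The scheme $\mathsf{TC}$.** * *Keys for $n$ qubits:* $sk=(\pi,x[1],z[1],\dots,x[n],z[n])$ with $\pi\in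 S_{3m}$ and $x[i],z[i]\in\{0,1\}^{3m}$ uniformly random. There is no evaluation key. * *Encryption of qubit $i$:* encode with $\mathsf{CSS}_\kappa$, append $m$ traps $|0\rangle$ and $m$ traps $|+\rangle$, permute the $3m$ qubits by $\pi$, and apply $\mathsf X^{x[i]}\mathsf Z^{z[i]}$. * *Evaluation:* nothing for Paulis, a transversal $\mathsf{CNOT}$ for $\mathsf{CNOT}$, and for a measurement a measurement of all $3m$ qubits in the corresponding basis. * *Verified decryption for a circuit $c$,* gate by gate: a Pauli $\mathsf X_i$ (respectively $\mathsf Z_i$) that is performed adds $\pi(1^m0^{2m})$ to $x[i]$ (respectively $z[i]$). A $\mathsf{CNOT}$ with control $i$ and target $j$ replaces $(x[i],z[i]),(x[j],z[j])$ by $(x[i],z[i]\oplus z[j]),(x[i]\oplus x[j],z[j])$. For a computational (respectively Hadamard) measurement of qubit $i$, the outcome string $w$ of its block is replaced by $w'=\pi^{-1}(x[i]\oplus w)$ (respectively $\pi^{-1}(z[i]\oplus w)$); reject unless its second (respectively third) $m$ bits are all $0$, and otherwise decode its first $m$ bits classically to the measurement outcome. At the end, for every unmeasured qubit, undo the one-time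 pad and $\pi$, reject unless all $m$ traps $|0\rangle$ and all $m$ traps $|+\rangle$ are found intact, and decode. On acceptance return the output wires of $c$; on rejection return a fixed state $\Omega$ together with the flag $\mathsf{rej}$. **The two-round game** against $\mathcal A=(\mathcal A_0,\mathcal A_1,\mathcal A_2,\mathcal A_3)$. Let $n_1,n_2$ be the numbers of qubits of $X_1,X_2$, draw $sk$ for $n=n_1+n_2$ qubits, and draw a uniformly random bit $r$. 1. $\mathcal A_0$ outputs registers $X_1R$. If $r=0$, $X_1$ is encrypted; if $r=1$, $X_1$ is moved to a private register and $|0^{n_1}\rangle$ is encrypted instead. 2. $\mathcal A_1$ receives this ciphertext and $R$, and outputs $X_2R'$. Likewise $X_2$ (if $r=0$) or $|0^{n_2}\rangle$ (if $r=1$, with $X_2$ moved to the private register) is encrypted, using the remaining one-time-pad keys and the same $\pi$. 3. $\mathcal A_2$ receives this ciphertext and $R'$, and outputs a ciphertext register for all $n$ qubits, a circuit $c$ of the above class on $n$ wires, a (here empty) log, and $R''$. Verified decryption is applied to the ciphertext with claimed circuit $c$. If $r=1$, $\Phi_c$ is applied to the private register $X_1X_2$, and the result is replaced by $\Omega$ if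 verified decryption rejects. 4. $\mathcal A_3$ receives $R''$, $c$, the accept/reject flag, and the output $X'$ of verified decryption (if $r=0$) or the content of the private register (if $r=1$), and outputs a bit $r'$. The adversary wins if $r'=r$. **Theorem.** $\mathsf{TC}$ satisfies $\kappa$-IND-VER-2: for every family of adversaries $\mathcal A$ (arbitrary quantum operations with finite-dimensional registers, with no bound on their running time; in particular, for every quantum polynomial-time adversary) there is a negligible function $\operatorname{negl}$ such that for all $\kappa$ $$\Pr[\mathcal A\text{ wins}]\le \tfrac12+\operatorname{negl}(\kappa).$$ -/

import Mathlib

open Matrix Finset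
open scoped ComplexOrder

noncomputable section

namespace TrapCode

/-! ## Finite-dimensional quantum operations

A register is given by the finite set of its computational basis labels; a (possibly unnormalised)
state of the register `A` is a matrix indexed by `A`.  Qubits have labels in `Bit`. -/

abbrev Bit := ZMod 2

/-- Superoperators: linear maps from operators on `A` to operators on `B`. -/
abbrev SuperOp (A B : Type) := Matrix A A ℂ →ₗ[ℂ] Matrix B B ℂ

/-- `ρ ↦ K ρ Kᴴ`. -/
def conj {A B : Type} [Fintype A] (K : Matrix B A ℂ) : SuperOp A B where
  toFun ρ := K * ρ * Kᴴ
  map_add' ρ σ := by rw [Matrix.mul_add, Matrix.add_mul]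
  map_smul' c ρ := by rw [Matrix.mul_smul, Matrix.smul_mul]; rfl

/-- `Φ ⊗ id_E`. -/
def SuperOp.amp {A B : Type} (Φ : SuperOp A B) (E : Type) : SuperOp (A × E) (B × E) where
  toFun ρ := Matrix.of fun p q => Φ (Matrix.of fun a a' => ρ (a, p.2) (a', q.2)) p.1 q.1
  map_add' ρ σ := by
    ext p q
    exact congrFun (congrFun (map_add Φ (Matrix.of fun a a' => ρ (a, p.2) (a', q.2))
      (Matrix.of fun a a' => σ (a, p.2) (a', q.2))) p.1) q.1
  map_smul' c ρ := by
    ext p q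
    exact congrFun (congrFun (map_smul Φ c (Matrix.of fun a a' => ρ (a, p.2) (a', q.2))) p.1) q.1

/-- `⨂ᵢ Φᵢ`. -/
def SuperOp.tensor {ι A B : Type} [Fintype ι] [DecidableEq ι] [Fintype A] [DecidableEq A]
    (Φ : ι → SuperOp A B) : SuperOp (ι → A) (ι → B) where
  toFun ρ := Matrix.of fun u u' =>
    ∑ v, ∑ v', (∏ i, Φ i (Matrix.single (v i) (v' i) 1) (u i) (u' i)) * ρ v v'
  map_add' ρ σ := by
    ext u u'
    simp [mul_add, Finset.sum_add_distrib]
  map_smul' c ρ := by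
    ext u u'
    simp [Finset.mul_sum, mul_left_comm]

/-- `ρ ↦ tr(ρ) σ`: discard a register and prepare the fixed state `σ`. -/
def discardPrepare {A B : Type} [Fintype A] (σ : Matrix B B ℂ) : SuperOp A B :=
  (Matrix.traceLinearMap A ℂ ℂ).smulRight σ

/-- A quantum instrument in Kraus form: a general quantum operation from `A` to `B` that also
announces a classical outcome in `L` (each Kraus branch `j` announces `outcome j`). -/
structure Instrument (A B L : Type) [Fintype A] [DecidableEq A] [Fintype B] where
  size : ℕ
  op : Fin size → Matrix B A ℂ
  outcome : Fin size → L
  complete : ∑ j, (op j)ᴴ * op j = 1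

/-- A quantum channel (completely positive trace preserving map), in Kraus form. -/
abbrev Channel (A B : Type) [Fintype A] [DecidableEq A] [Fintype B] := Instrument A B Unit

/-- The completely positive trace preserving map of an instrument whose outcome is ignored. -/
def Instrument.map {A B L : Type} [Fintype A] [DecidableEq A] [Fintype B]
    (I : Instrument A B L) : SuperOp A B :=
  ∑ j, conj (I.op j)

/-- The pure state `|0…0⟩⟨0…0|` on the qubits `ι`. -/
def zeroState (ι : Type) [DecidableEq (ι → Bit)] : Matrix (ι → Bit) (ι → Bit) ℂ :=
  Matrix.single 0 0 1

/-- `(-1)^b`. -/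
def sign (b : Bit) : ℂ := if b = 0 then 1 else -1

/-- The operator `K` on the `i`-th of `n` registers, tensored with the identity. -/
def onWire {n : ℕ} {A : Type} [DecidableEq A] (i : Fin n) (K : Matrix A A ℂ) :
    Matrix (Fin n → A) (Fin n → A) ℂ :=
  Matrix.of fun u v => if ∀ k, k ≠ i → u k = v k then K (u i) (v i) else 0

/-- `CNOT` with control `i` and target `j`.  For registers `A` that consist of several qubits
(with `+` the bitwise sum) this is the transversal `CNOT`. -/
def cnotU {n : ℕ} {A : Type} [Add A] [DecidableEq A] (i j : Fin n) :
    Matrix (Fin n → A) (Fin n → A) ℂ :=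
  Matrix.of fun u v => if u = Function.update v j (v j + v i) then 1 else 0

/-- `X^x` on the qubits `ι`. -/
def pauliX {ι : Type} [Fintype ι] (x : ι → Bit) : Matrix (ι → Bit) (ι → Bit) ℂ :=
  Matrix.of fun u v => if u = v + x then 1 else 0

/-- `Z^z` on the qubits `ι`. -/
def pauliZ {ι : Type} [Fintype ι] [DecidableEq ι] (z : ι → Bit) :
    Matrix (ι → Bit) (ι → Bit) ℂ :=
  Matrix.diagonal fun v => sign (z ⬝ᵥ v)

/-- The Hadamard gate on every one of the qubits `ι`. -/
def hadamardAll (ι : Type) [Fintype ι] : Matrix (ι → Bit) (ι → Bit) ℂ :=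
  Matrix.of fun u v => ((Real.sqrt 2 : ℂ)⁻¹) ^ Fintype.card ι * sign (u ⬝ᵥ v)

/-- `permute_π` on bit strings: the entry at position `p` moves to position `π p`. -/
def permuteWord {ι : Type} (π : Equiv.Perm ι) (v : ι → Bit) : ι → Bit := v ∘ π.symm

/-- `permute_π` on qubits. -/
def permuteU {ι : Type} [Fintype ι] (π : Equiv.Perm ι) : Matrix (ι → Bit) (ι → Bit) ℂ :=
  Matrix.of fun u v => if u = permuteWord π v then 1 else 0

/-! ## The circuit class: `CNOT`, (classically controlled) Paulis, measurements -/

inductive MeasBasis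
  | comp
  | hada
  deriving DecidableEq

/-- Gates on `n` wires.  A Pauli gate carries its classical control, a Boolean function of the
record of measurement outcomes (wires that are not yet measured are recorded as `0`); the constant
function `true` gives the uncontrolled gate. -/
inductive Gate (n : ℕ)
  | X (ctrl : (Fin n → Bit) → Bool) (i : Fin n)
  | Z (ctrl : (Fin n → Bit) → Bool) (i : Fin n)
  | cnot (i j : Fin n)
  | meas (b : MeasBasis) (i : Fin n)

/-- No gate acts on a wire that is already measured (`M` is the set of those wires), and the two
wires of a `CNOT` are distinct. -/
def WellFormed {n : ℕ} : Finset (Fin n) → List (Gate n) → Prop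
  | _, [] => True
  | M, .X _ i :: gs => i ∉ M ∧ WellFormed M gs
  | M, .Z _ i :: gs => i ∉ M ∧ WellFormed M gs
  | M, .cnot i j :: gs => i ≠ j ∧ i ∉ M ∧ j ∉ M ∧ WellFormed M gs
  | M, .meas _ i :: gs => i ∉ M ∧ WellFormed (insert i M) gs

/-- A circuit on `n` wires: its gates and its output wires. -/
structure Circuit (n : ℕ) where
  gates : List (Gate n)
  out : Finset (Fin n)
  wellFormed : WellFormed ∅ gates

/-- The output register of a circuit. -/
abbrev Circuit.Out {n : ℕ} (c : Circuit n) : Type := {i // i ∈ c.out} → Bit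

def bitX : Matrix Bit Bit ℂ := Matrix.of fun u v => if u = v + 1 then 1 else 0

def bitZ : Matrix Bit Bit ℂ := Matrix.diagonal sign

def bitH : Matrix Bit Bit ℂ := Matrix.of fun u v => (Real.sqrt 2 : ℂ)⁻¹ * sign (u * v)

/-- Measuring a qubit with outcome `r`, which is left on the wire as `|r⟩`: a measurement in the
Hadamard basis is a Hadamard gate followed by a computational-basis measurement. -/
def measOp : MeasBasis → Bit → Matrix Bit Bit ℂ
  | .comp, r => Matrix.single r r 1
  | .hada, r => Matrix.single r r 1 * bitH

/-- The channel of a list of gates, when the record of previous measurement outcomes is `a`. -/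
def runGates {n : ℕ} : List (Gate n) → (Fin n → Bit) → SuperOp (Fin n → Bit) (Fin n → Bit)
  | [], _ => LinearMap.id
  | .X f i :: gs, a => runGates gs a ∘ₗ conj (if f a then onWire i bitX else 1)
  | .Z f i :: gs, a => runGates gs a ∘ₗ conj (if f a then onWire i bitZ else 1)
  | .cnot i j :: gs, a => runGates gs a ∘ₗ conj (cnotU i j)
  | .meas b i :: gs, a =>
      ∑ r : Bit, runGates gs (Function.update a i r) ∘ₗ conj (onWire i (measOp b r))

/-- Trace out all wires outside `S`. -/
def keepWires {n : ℕ} (S : Finset (Fin n)) :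
    SuperOp (Fin n → Bit) ({i // i ∈ S} → Bit) :=
  ∑ t : {i // i ∉ S} → Bit, conj (Matrix.of fun (u : {i // i ∈ S} → Bit) (v : Fin n → Bit) =>
    if (∀ i, v i.1 = u i) ∧ (∀ i, v i.1 = t i) then 1 else 0)

/-- The channel `Φ_c` of a circuit. -/
def Circuit.channel {n : ℕ} (c : Circuit n) : SuperOp (Fin n → Bit) c.Out :=
  keepWires c.out ∘ₗ runGates c.gates 0

/-- The fixed state `Ω` on the output register. -/
def Circuit.Omega {n : ℕ} (c : Circuit n) : Matrix c.Out c.Out ℂ := zeroState {i // i ∈ c.out}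

/-! ## Schemes and the two-round indistinguishability game -/

/-- The four algorithms of a (symmetric-key) scheme for verifiable homomorphic encryption for the
above circuit class, with ciphertexts that hold one register `Block κ` per plaintext qubit.  Keys are
generated for a given number `n` of plaintext qubits.  `enc sk w` encrypts `l` qubits, the `i`-th of
which is used as the plaintext qubit number `w i`, so that the `n` qubits may be encrypted in
several rounds.  In `verDec`, the argument `true` (`false`) selects the branch in which the
procedure accepts (rejects). -/
structure Scheme where
  Block : ℕ → Type
  [blockFintype : ∀ κ, Fintype (Block κ)]
  [blockDecEq : ∀ κ, DecidableEq (Block κ)]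
  Evk : ℕ → ℕ → Type
  [evkFintype : ∀ κ n, Fintype (Evk κ n)]
  [evkDecEq : ∀ κ n, DecidableEq (Evk κ n)]
  Log : ℕ → ℕ → Type
  Key : ℕ → ℕ → Type
  [keyFintype : ∀ κ n, Fintype (Key κ n)]
  keyGen : ∀ κ n, PMF (Key κ n)
  evk : ∀ {κ n}, Key κ n → Matrix (Evk κ n) (Evk κ n) ℂ
  enc : ∀ {κ n}, Key κ n → ∀ {l : ℕ}, (Fin l → Fin n) →
    SuperOp (Fin l → Bit) (Fin l → Block κ)
  eval : ∀ {κ n}, Circuit n →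
    SuperOp ((Fin n → Block κ) × Evk κ n) ((Fin n → Block κ) × Log κ n)
  verDec : ∀ {κ n}, Key κ n → ∀ c : Circuit n, Log κ n → Bool →
    SuperOp (Fin n → Block κ) c.Out

attribute [instance] Scheme.blockFintype Scheme.blockDecEq Scheme.evkFintype Scheme.evkDecEq
  Scheme.keyFintype

/-- An adversary `(A₀, A₁, A₂, A₃)` against the scheme `S` at security parameter `κ`: arbitrary
quantum operations, with arbitrary finite-dimensional side registers.  `A₂` announces the circuit and
the log, and `A₃`, who knows the circuit and the accept/reject flag, makes the two-outcome
measurement with effects `1 - A₃ c flag` (guess `0`) and `A₃ c flag` (guess `1`). -/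
structure Adversary (S : Scheme) (κ : ℕ) where
  n₁ : ℕ
  n₂ : ℕ
  d₀ : ℕ
  d₁ : ℕ
  d₂ : ℕ
  A₀ : Channel (S.Evk κ (n₁ + n₂)) ((Fin n₁ → Bit) × Fin d₀)
  A₁ : Channel ((Fin n₁ → S.Block κ) × Fin d₀) ((Fin n₂ → Bit) × Fin d₁)
  A₂ : Instrument ((Fin n₂ → S.Block κ) × Fin d₁) ((Fin (n₁ + n₂) → S.Block κ) × Fin d₂)
    (Circuit (n₁ + n₂) × S.Log κ (n₁ + n₂))
  A₃ : ∀ c : Circuit (n₁ + n₂), Bool → Matrix (c.Out × Fin d₂) (c.Out × Fin d₂) ℂ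
  A₃_nonneg : ∀ c flag, (A₃ c flag).PosSemidef
  A₃_le_one : ∀ c flag, (1 - A₃ c flag).PosSemidef

namespace Adversary

variable {S : Scheme} {κ : ℕ} (A : Adversary S κ)

/-- The total number of plaintext qubits. -/
abbrev n : ℕ := A.n₁ + A.n₂

/-- The circuit announced in branch `j` of `A₂`. -/
abbrev circ (j : Fin A.A₂.size) : Circuit A.n := (A.A₂.outcome j).1

/-- The log announced in branch `j` of `A₂`. -/
abbrev log (j : Fin A.A₂.size) : S.Log κ A.n := (A.A₂.outcome j).2

/-- Encryption in the first and in the second round. -/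
abbrev enc₁ (sk : S.Key κ A.n) := S.enc sk (Fin.castAdd A.n₂ : Fin A.n₁ → Fin A.n)
abbrev enc₂ (sk : S.Key κ A.n) := S.enc sk (Fin.natAdd A.n₁ : Fin A.n₂ → Fin A.n)

/-- The output `X₁ R` of `A₀`. -/
def start (sk : S.Key κ A.n) :
    Matrix ((Fin A.n₁ → Bit) × Fin A.d₀) ((Fin A.n₁ → Bit) × Fin A.d₀) ℂ :=
  A.A₀.map (S.evk sk)

/-- `r = 0`: the plaintexts of both rounds are encrypted, and `A₃` receives the output of `VerDec`.
This is the (unnormalised) state of `X' R''` for branch `j` of `A₂` and the given flag. -/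
def real (sk : S.Key κ A.n) (j : Fin A.A₂.size) (flag : Bool) :
    Matrix ((A.circ j).Out × Fin A.d₂) ((A.circ j).Out × Fin A.d₂) ℂ :=
  let ρ₁ := (A.enc₁ sk).amp (Fin A.d₀) (A.start sk)
  let ρ₂ := A.A₁.map ρ₁
  let ρ₃ := (A.enc₂ sk).amp (Fin A.d₁) ρ₂
  let ρ₄ := conj (A.A₂.op j) ρ₃
  (S.verDec sk (A.circ j) (A.log j) flag).amp (Fin A.d₂) ρ₄

/-- `r = 1`, after the first encryption: `|0^{n₁}⟩` is encrypted, and `X₁` is swapped out to a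
private register (last component). -/
def ideal₁ (sk : S.Key κ A.n) :
    Matrix (((Fin A.n₁ → S.Block κ) × Fin A.d₀) × (Fin A.n₁ → Bit))
      (((Fin A.n₁ → S.Block κ) × Fin A.d₀) × (Fin A.n₁ → Bit)) ℂ :=
  Matrix.of fun p q =>
    A.enc₁ sk (zeroState (Fin A.n₁)) p.1.1 q.1.1 * A.start sk (p.2, p.1.2) (q.2, q.1.2)

/-- `r = 1`, after the second encryption: `|0^{n₂}⟩` is encrypted, and `X₂` is swapped out too, so
that the private register holds the `n₁ + n₂` qubits `X₁ X₂`. -/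
def ideal₂ (sk : S.Key κ A.n) :
    Matrix (((Fin A.n₂ → S.Block κ) × Fin A.d₁) × (Fin A.n → Bit))
      (((Fin A.n₂ → S.Block κ) × Fin A.d₁) × (Fin A.n → Bit)) ℂ :=
  let ρ := A.A₁.map.amp (Fin A.n₁ → Bit) (A.ideal₁ sk)
  Matrix.of fun p q =>
    A.enc₂ sk (zeroState (Fin A.n₂)) p.1.1 q.1.1 *
      ρ ((p.2 ∘ Fin.natAdd A.n₁, p.1.2), p.2 ∘ Fin.castAdd A.n₂)
        ((q.2 ∘ Fin.natAdd A.n₁, q.1.2), q.2 ∘ Fin.castAdd A.n₂)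

/-- `r = 1`: the output of `VerDec` is discarded except for its flag, the circuit is applied to the
private register, which is erased if `VerDec` rejects, and is then handed to `A₃`. -/
def ideal (sk : S.Key κ A.n) (j : Fin A.A₂.size) (flag : Bool) :
    Matrix ((A.circ j).Out × Fin A.d₂) ((A.circ j).Out × Fin A.d₂) ℂ :=
  let ρ := (conj (A.A₂.op j)).amp (Fin A.n → Bit) (A.ideal₂ sk)
  let σ : Matrix ((Fin A.n → Bit) × Fin A.d₂) ((Fin A.n → Bit) × Fin A.d₂) ℂ :=
    Matrix.of fun p q => (S.verDec sk (A.circ j) (A.log j) flag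
      (Matrix.of fun b b' => ρ ((b, p.2), p.1) ((b', q.2), q.1))).trace
  (if flag then (A.circ j).channel else discardPrepare (A.circ j).Omega).amp (Fin A.d₂) σ

/-- The probability that the guess `r'` of `A₃` equals the uniformly random bit `r`. -/
def winProb : ℝ :=
  ∑ sk, (S.keyGen κ A.n sk).toReal * ∑ j, ∑ flag,
    ((1 / 2) * (((1 - A.A₃ (A.circ j) flag) * A.real sk j flag).trace).re +
      (1 / 2) * ((A.A₃ (A.circ j) flag * A.ideal sk j flag).trace).re)

end Adversary

/-- `κ`-IND-VER-2, against adversaries without any bound on their running time. -/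
def Scheme.IndVer2 (S : Scheme) : Prop :=
  ∀ A : ∀ κ, Adversary S κ, ∃ negl : ℕ → ℝ,
    Asymptotics.SuperpolynomialDecay Filter.atTop (fun κ : ℕ => (κ : ℝ)) negl ∧
    ∀ κ, (A κ).winProb ≤ 1 / 2 + negl κ

/-! ## Self-dual CSS codes -/

/-- The dual of a binary linear code. -/
def dualCode {m : ℕ} (C : Submodule Bit (Fin m → Bit)) : Submodule Bit (Fin m → Bit) where
  carrier := {u | ∀ v ∈ C, u ⬝ᵥ v = 0}
  add_mem' hu hv w hw := by rw [add_dotProduct, hu w hw, hv w hw, add_zero]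
  zero_mem' w _ := zero_dotProduct w
  smul_mem' c u hu w hw := by rw [smul_dotProduct, hu w hw, smul_zero]

/-- A self-dual CSS code that encodes one qubit in `m` qubits and corrects `t` errors: both the `X`
stabilisers and the `Z` stabilisers are given by the words of `dualCode C`, where `dualCode C ≤ C`.
It comes with a recovery function, which maps an error (of type `X` or `Z`) to an error with the same
syndrome, and only depends on the syndrome, i.e. on the coset of `C`. -/
structure SelfDualCSS (m t : ℕ) where
  C : Submodule Bit (Fin m → Bit)
  dual_le : dualCode C ≤ C
  finrank_eq : Module.finrank Bit C = Module.finrank Bit (dualCode C) + 1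
  distance : ∀ v ∈ C, v ∉ dualCode C → 2 * t + 1 ≤ hammingNorm v
  recover : (Fin m → Bit) → (Fin m → Bit)
  recover_congr : ∀ e e', e - e' ∈ C → recover e = recover e'
  sub_recover_mem : ∀ e, e - recover e ∈ C
  corrects : ∀ e, hammingNorm e ≤ t → e - recover e ∈ dualCode C

namespace SelfDualCSS

variable {m t : ℕ} (Q : SelfDualCSS m t)

open Classical in
/-- The encoding isometry `|b⟩ ↦ |C^⊥|^{-1/2} ∑_{u ∈ C^⊥} |u + b⋯b⟩`; logical Paulis and Hadamards
are transversal. -/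
def encode : Matrix (Fin m → Bit) Bit ℂ :=
  Matrix.of fun u b =>
    if u - (fun _ => b) ∈ dualCode Q.C then ((Real.sqrt (Nat.card (dualCode Q.C)) : ℝ) : ℂ)⁻¹ else 0

/-- The decoding operator for the recovery operation `X^e Z^f`. -/
def decode (e f : Fin m → Bit) : Matrix Bit (Fin m → Bit) ℂ :=
  Q.encodeᴴ * (pauliX e * pauliZ f)ᴴ

open Classical in
/-- The classical decoding of the measurement outcomes of the `m` qubits. -/
def classicalDecode (w : Fin m → Bit) : Bit :=
  if w - Q.recover w ∈ dualCode Q.C then 0 else 1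

end SelfDualCSS

/-! ## The trap code scheme -/

/-- The `3m` positions of a ciphertext block: data, computational traps, Hadamard traps. -/
abbrev Pos (m : ℕ) := Fin 3 × Fin m

/-- The basis labels of a ciphertext block of `3m` qubits. -/
abbrev BlockLabel (m : ℕ) := Pos m → Bit

/-- The `k`-th third of a string of `3m` bits. -/
def third {m : ℕ} (k : Fin 3) (v : BlockLabel m) : Fin m → Bit := fun i => v (k, i)

/-- The isometry which appends `m` traps `|0⟩` and `m` traps `|+⟩` to `m` data qubits.  Its adjoint
projects on the correct traps and removes them. -/
def addTraps (m : ℕ) : Matrix (BlockLabel m) (Fin m → Bit) ℂ :=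
  Matrix.of fun v u =>
    if third 0 v = u ∧ third 1 v = 0 then ((Real.sqrt 2 : ℂ)⁻¹) ^ m else 0

/-- The secret keys `(π, x[1], …, x[n], z[1], …, z[n])`. -/
abbrev TCKey (m n : ℕ) :=
  Equiv.Perm (Pos m) × (Fin n → BlockLabel m) × (Fin n → BlockLabel m)

namespace TC

variable {m t n : ℕ} (Q : SelfDualCSS m t)

/-- Encryption of one qubit: encode, add traps, permute, apply the quantum one-time pad. -/
def encQubit (π : Equiv.Perm (Pos m)) (x z : BlockLabel m) : Matrix (BlockLabel m) Bit ℂ :=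
  pauliX x * pauliZ z * permuteU π * addTraps m * Q.encode

def enc (sk : TCKey m n) {l : ℕ} (w : Fin l → Fin n) :
    SuperOp (Fin l → Bit) (Fin l → BlockLabel m) :=
  conj (Matrix.of fun c b => ∏ i, encQubit Q sk.1 (sk.2.1 (w i)) (sk.2.2 (w i)) (c i) (b i))

/-- Evaluation: nothing for Paulis, a transversal `CNOT` for `CNOT`; for a measurement, all qubits of
the block are measured (after a transversal Hadamard for the Hadamard basis). -/
def evalGates : List (Gate n) → SuperOp (Fin n → BlockLabel m) (Fin n → BlockLabel m)
  | [] => LinearMap.id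
  | .X _ _ :: gs => evalGates gs
  | .Z _ _ :: gs => evalGates gs
  | .cnot i j :: gs => evalGates gs ∘ₗ conj (cnotU i j)
  | .meas .comp i :: gs =>
      evalGates gs ∘ₗ ∑ w : BlockLabel m, conj (onWire i (Matrix.single w w 1))
  | .meas .hada i :: gs =>
      evalGates gs ∘ₗ
        ∑ w : BlockLabel m, conj (onWire i (Matrix.single w w 1 * hadamardAll (Pos m)))

/-- The accepting branch of the verified decryption of an unmeasured qubit: undo the one-time pad and
the permutation, check the traps, decode (sum over the error syndromes). -/
def verDecQubit (π : Equiv.Perm (Pos m)) (x z : BlockLabel m) : SuperOp (BlockLabel m) Bit :=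
  ∑ e ∈ Finset.univ.image Q.recover, ∑ f ∈ Finset.univ.image Q.recover,
    conj (Q.decode e f * (addTraps m)ᴴ * permuteU π⁻¹ * (pauliX x * pauliZ z)ᴴ)

/-- The verified decryption of the physical measurement outcomes `w` of a block; `none` is `rej`. -/
def verDecMeasurement (π : Equiv.Perm (Pos m)) (x z w : BlockLabel m) : MeasBasis → Option Bit
  | .comp =>
      let w' := permuteWord π⁻¹ (x + w)
      if third 1 w' = 0 then some (Q.classicalDecode (third 0 w')) else none
  | .hada =>
      let w' := permuteWord π⁻¹ (z + w)
      if third 2 w' = 0 then some (Q.classicalDecode (third 0 w')) else none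

/-- The string `1^m 0^{2m}`. -/
def dataOnes (m : ℕ) : BlockLabel m := fun p => if p.1 = 0 then 1 else 0

/-- The accepting branch of the verified decryption, gate by gate; `x` and `z` are the current keys
of the one-time pad, `M` is the set of the measured wires, and `a` is the record of the plaintext
measurement outcomes.  A measurement reads the block as a classical string. -/
def accept (π : Equiv.Perm (Pos m)) :
    List (Gate n) → (x z : Fin n → BlockLabel m) → Finset (Fin n) → (Fin n → Bit) →
      SuperOp (Fin n → BlockLabel m) (Fin n → Bit)
  | [], x, z, M, a =>
      SuperOp.tensor fun i =>
        if i ∈ M then discardPrepare (Matrix.single (a i) (a i) 1)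
        else verDecQubit Q π (x i) (z i)
  | .X f i :: gs, x, z, M, a =>
      accept π gs
        (if f a then Function.update x i (x i + permuteWord π (dataOnes m)) else x) z M a
  | .Z f i :: gs, x, z, M, a =>
      accept π gs
        x (if f a then Function.update z i (z i + permuteWord π (dataOnes m)) else z) M a
  | .cnot i j :: gs, x, z, M, a =>
      accept π gs (Function.update x j (x i + x j)) (Function.update z i (z i + z j)) M a
  | .meas b i :: gs, x, z, M, a =>
      ∑ w : BlockLabel m,
        match verDecMeasurement Q π (x i) (z i) w b with
        | none => 0
        | some r =>
            accept π gs x z (insert i M) (Function.update a i r) ∘ₗ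
              conj (onWire i (Matrix.single w w 1))

/-- The verified decryption.  All runs that do not accept end in `(Ω, rej)`. -/
def verDec (sk : TCKey m n) (c : Circuit n) : Bool → SuperOp (Fin n → BlockLabel m) c.Out
  | true => keepWires c.out ∘ₗ accept Q sk.1 c.gates sk.2.1 sk.2.2 ∅ 0
  | false =>
      (Matrix.traceLinearMap (Fin n → BlockLabel m) ℂ ℂ -
        Matrix.traceLinearMap (Fin n → Bit) ℂ ℂ ∘ₗ
          accept Q sk.1 c.gates sk.2.1 sk.2.2 ∅ 0).smulRight c.Omega

end TC

/-- A family of self-dual CSS codes of polynomial length that correct `κ` errors. -/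
structure CSSFamily where
  m : ℕ → ℕ
  code : ∀ κ, SelfDualCSS (m κ) κ
  poly : ∃ p : Polynomial ℕ, ∀ κ, m κ ≤ p.eval κ

/-- The scheme `TC`: keys are uniformly random; the evaluation key and the log are empty. -/
def TC (F : CSSFamily) : Scheme where
  Block κ := BlockLabel (F.m κ)
  Evk _ _ := Unit
  Log _ _ := Unit
  Key κ n := TCKey (F.m κ) n
  keyGen κ n := PMF.uniformOfFintype (TCKey (F.m κ) n)
  evk _ := 1
  enc {κ _} sk {_} w := TC.enc (F.code κ) sk w
  eval c := (TC.evalGates c.gates).amp Unit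
  verDec {κ _} sk c _ := TC.verDec (F.code κ) sk c

end TrapCode

end

/-!
The scheme `TC` hides and authenticates at once, and both follow from a single computation: the
secret one-time pad turns every attack into a random mixture of Pauli errors.

Fix Kraus branches of `A₀`, `A₁`, `A₂`.  Since both rounds of ciphertexts are produced by an isometry
and the adversary never touches the key, the final state of the real game depends on the plaintexts
`b` and the side register `r` only through one operator `attack … b r` on all blocks, applied to the
encryption; in the ideal game the same operator is applied to the encryption of zeros while `b` stays
in the private register (`Adversary.real_eq`, `Adversary.ideal_eq`).

The verified decryption of a circuit is, up to a fixed unitary `evalU`, the decryption of the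
evaluated ciphertext (`TC.accept_comp_evalU`), and its dependence on the one-time pad is a Pauli
operator in front of it (`TC.evalAccept_add`).  So `evalUᴴ * attack` is conjugated by a uniformly
random Pauli operator, and the cross terms of its Pauli expansion cancel (`pauli_twirl`).  In both
games this leaves, with the same weight, a sum over Pauli errors `X^x Z^z` on the encryption: in the
real game the error acts on the encrypted plaintexts, in the ideal game on encrypted zeros
(`TC.sum_verDec_realKet`, `TC.sum_verDec_idealKet`).

For one Pauli error, the decryption performs finitely many trap checks, each on a fixed string of
`3m` bits that depends on the error and on the circuit, but not on the secret permutation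
(`TC.checks`).
* If some check fails, both games reject (`TC.evalAccept_comp_encM_eq_zero`).
* If all checks pass, and every checked string has weight at most `t`, the code corrects the error
  and the decryption performs the circuit exactly (`TC.evalAccept_comp_encM`).
In both cases the two games end in the same state, and the guess is no better than a coin flip
(`sum_guessProb_eq`).  What remains is that all checks pass although some checked string has weight
greater than `t`; a uniformly random permutation moves `t + 1` of its ones off the `m` traps among
`3m` positions with probability at most `(2/3)^(t+1)` (`TC.card_passes_le`).

The weights of all Pauli errors add up to one by Parseval's identity (`sum_pauliCoeff`,
`Adversary.sum_attackOp`), so that the advantage is at most `(2/3)^(κ+1) / 2` (`winProb_le`).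
-/

set_option linter.unusedSectionVars false

noncomputable section

namespace TrapCode

/-! ### Superoperators and tensor products of matrices -/

theorem sum_linearMap_comp {κ : Type} {U V W : Type} [AddCommGroup U] [AddCommGroup V]
    [AddCommGroup W] [Module ℂ U] [Module ℂ V] [Module ℂ W] (s : Finset κ) (f : κ → V →ₗ[ℂ] W)
    (g : U →ₗ[ℂ] V) : (∑ k ∈ s, f k) ∘ₗ g = ∑ k ∈ s, f k ∘ₗ g := by
  ext1 u
  simp [LinearMap.sum_apply]

theorem linearMap_comp_sum {κ : Type} {U V W : Type} [AddCommGroup U] [AddCommGroup V]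
    [AddCommGroup W] [Module ℂ U] [Module ℂ V] [Module ℂ W] (s : Finset κ) (f : V →ₗ[ℂ] W)
    (g : κ → U →ₗ[ℂ] V) : f ∘ₗ ∑ k ∈ s, g k = ∑ k ∈ s, f ∘ₗ g k := by
  ext1 u
  simp [LinearMap.sum_apply]

section Conj

variable {A B D : Type} [Fintype A]

theorem conj_apply (K : Matrix B A ℂ) (ρ : Matrix A A ℂ) : conj K ρ = K * ρ * Kᴴ := rfl

theorem conj_comp [Fintype B] (K : Matrix D B ℂ) (L : Matrix B A ℂ) :
    conj K ∘ₗ conj L = conj (K * L) := by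
  ext1 ρ
  simp [conj_apply, Matrix.mul_assoc]

theorem conj_one [DecidableEq A] : conj (1 : Matrix A A ℂ) = LinearMap.id := by
  ext1 ρ
  simp [conj_apply]

theorem conj_zero : conj (0 : Matrix B A ℂ) = 0 := by
  ext1 ρ
  simp [conj_apply]

theorem conj_smul (c : ℂ) (K : Matrix B A ℂ) : conj (c • K) = (c * star c) • conj K := by
  ext1 ρ
  simp [conj_apply, smul_smul, mul_comm]

theorem conj_smul_of_norm (c : ℂ) (hc : c * star c = 1) (K : Matrix B A ℂ) :
    conj (c • K) = conj K := by
  rw [conj_smul, hc, one_smul]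

theorem trace_conj [Fintype B] (K : Matrix B A ℂ) (ρ : Matrix A A ℂ) :
    (conj K ρ).trace = (Kᴴ * K * ρ).trace := by
  rw [conj_apply, Matrix.trace_mul_comm, Matrix.mul_assoc]

/-- The completeness relation of a family of Kraus operators makes it trace preserving. -/
theorem trace_sum_conj [Fintype B] [DecidableEq A] {κ : Type} [Fintype κ] (K : κ → Matrix B A ℂ)
    (hK : ∑ k, (K k)ᴴ * K k = 1) (ρ : Matrix A A ℂ) :
    ((∑ k, conj (K k)) ρ).trace = ρ.trace := by
  rw [LinearMap.sum_apply, Matrix.trace_sum]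
  simp_rw [trace_conj]
  rw [← Matrix.trace_sum, ← Finset.sum_mul, hK, Matrix.one_mul]

theorem discardPrepare_comp_sum_conj [DecidableEq A] {κ : Type} [Fintype κ]
    (σ : Matrix D D ℂ) (K : κ → Matrix A A ℂ) (hK : ∑ k, (K k)ᴴ * K k = 1) :
    discardPrepare σ ∘ₗ ∑ k, conj (K k) = discardPrepare σ := by
  ext1 ρ
  simp only [discardPrepare, LinearMap.comp_apply, LinearMap.smulRight_apply,
    Matrix.traceLinearMap_apply]
  rw [trace_sum_conj K hK]

end Conj

section Tensor

variable {ι : Type} [Fintype ι] [DecidableEq ι] {A B D : Type}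

/-- The tensor product of a family of matrices. -/
def tensM (K : ι → Matrix B A ℂ) : Matrix (ι → B) (ι → A) ℂ :=
  Matrix.of fun u v => ∏ i, K i (u i) (v i)

theorem tensM_apply (K : ι → Matrix B A ℂ) (u : ι → B) (v : ι → A) :
    tensM K u v = ∏ i, K i (u i) (v i) := rfl

theorem tensM_mul [Fintype B] (K : ι → Matrix D B ℂ) (L : ι → Matrix B A ℂ) :
    tensM K * tensM L = tensM fun i => K i * L i := by
  ext u v
  simp only [Matrix.mul_apply, tensM_apply, ← Finset.prod_mul_distrib]
  rw [Finset.prod_univ_sum, Fintype.piFinset_univ]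

theorem tensM_conjTranspose (K : ι → Matrix B A ℂ) : (tensM K)ᴴ = tensM fun i => (K i)ᴴ := by
  ext u v
  simp [tensM_apply, Matrix.conjTranspose_apply]

theorem tensM_one [DecidableEq A] : tensM (fun _ : ι => (1 : Matrix A A ℂ)) = 1 := by
  ext u v
  simp only [tensM_apply, Matrix.one_apply, Finset.prod_ite_zero, Finset.prod_const_one]
  simp [funext_iff]

theorem tensM_smul (c : ι → ℂ) (K : ι → Matrix B A ℂ) :
    tensM (fun i => c i • K i) = (∏ i, c i) • tensM K := by
  ext u v
  simp [tensM_apply, Finset.prod_mul_distrib]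

theorem tensM_single [DecidableEq A] (u v : ι → A) :
    tensM (fun i => Matrix.single (u i) (v i) (1 : ℂ)) = Matrix.single u v 1 := by
  ext u' v'
  simp only [tensM_apply, Matrix.single_apply, Finset.prod_ite_zero, Finset.prod_const_one]
  simp [funext_iff, forall_and]

theorem tensM_eq_zero (K : ι → Matrix B A ℂ) (i : ι) (h : K i = 0) : tensM K = 0 := by
  ext u v
  rw [tensM_apply]
  exact Finset.prod_eq_zero (Finset.mem_univ i) (by simp [h])

variable [Fintype A] [DecidableEq A]

theorem tensor_tensM (Φ : ι → SuperOp A B) (ρ : ι → Matrix A A ℂ) :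
    SuperOp.tensor Φ (tensM ρ) = tensM fun i => Φ i (ρ i) := by
  have key : ∀ i, Φ i (ρ i) = ∑ p : A × A, ρ i p.1 p.2 • Φ i (Matrix.single p.1 p.2 1) := by
    intro i
    conv_lhs => rw [Matrix.matrix_eq_sum_single (ρ i)]
    rw [map_sum, Fintype.sum_prod_type]
    refine Finset.sum_congr rfl fun a _ => ?_
    rw [map_sum]
    refine Finset.sum_congr rfl fun b _ => ?_
    rw [← map_smul, Matrix.smul_single, smul_eq_mul, mul_one]
  ext u u'
  simp only [SuperOp.tensor, LinearMap.coe_mk, AddHom.coe_mk, Matrix.of_apply, tensM_apply]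
  simp_rw [key, Matrix.sum_apply, Matrix.smul_apply, smul_eq_mul]
  rw [Finset.prod_univ_sum, Fintype.piFinset_univ, ← Fintype.sum_prod_type',
    ← (Equiv.arrowProdEquivProdArrow ι (fun _ => A) (fun _ => A)).sum_comp]
  refine Finset.sum_congr rfl fun p _ => ?_
  simp [Equiv.arrowProdEquivProdArrow, Finset.prod_mul_distrib, mul_comm]

/-- Superoperators on a product register are determined by their values on product operators. -/
theorem superOp_ext_tensM {D : Type} {Φ Ψ : SuperOp (ι → A) D}
    (h : ∀ ρ : ι → Matrix A A ℂ, Φ (tensM ρ) = Ψ (tensM ρ)) : Φ = Ψ := by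
  refine Matrix.ext_linearMap ℂ fun u v => ?_
  ext1
  simpa [tensM_single] using h fun i => Matrix.single (u i) (v i) 1

theorem conj_tensM_apply (K : ι → Matrix B A ℂ) (ρ : ι → Matrix A A ℂ) :
    conj (tensM K) (tensM ρ) = tensM fun i => conj (K i) (ρ i) := by
  rw [conj_apply, tensM_mul, tensM_conjTranspose, tensM_mul]
  rfl

theorem tensor_comp_conj [Fintype B] [DecidableEq B] (Φ : ι → SuperOp B D)
    (K : ι → Matrix B A ℂ) :
    SuperOp.tensor Φ ∘ₗ conj (tensM K) = SuperOp.tensor fun i => Φ i ∘ₗ conj (K i) := by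
  refine superOp_ext_tensM fun ρ => ?_
  rw [LinearMap.comp_apply, conj_tensM_apply, tensor_tensM, tensor_tensM]
  rfl

theorem tensor_conj (K : ι → Matrix B A ℂ) :
    SuperOp.tensor (fun i => conj (K i)) = conj (tensM K) := by
  refine superOp_ext_tensM fun ρ => ?_
  rw [conj_tensM_apply, tensor_tensM]

theorem tensor_eq_zero (Φ : ι → SuperOp A B) (i : ι) (h : Φ i = 0) : SuperOp.tensor Φ = 0 := by
  refine superOp_ext_tensM fun ρ => ?_
  rw [tensor_tensM, tensM_eq_zero _ i (by simp [h])]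
  rfl

theorem tensor_sum_conj {κ : ι → Type} [∀ i, Fintype (κ i)] (K : ∀ i, κ i → Matrix B A ℂ) :
    SuperOp.tensor (fun i => ∑ k, conj (K i k)) =
      ∑ k : ∀ i, κ i, conj (tensM fun i => K i (k i)) := by
  classical
  refine superOp_ext_tensM fun ρ => ?_
  rw [tensor_tensM, LinearMap.sum_apply]
  simp_rw [conj_tensM_apply]
  ext u v
  simp only [tensM_apply, LinearMap.sum_apply, Matrix.sum_apply]
  rw [Finset.prod_univ_sum, Fintype.piFinset_univ]

theorem tensor_comp_sum_conj [Fintype B] [DecidableEq B] (Φ : ι → SuperOp B D) {κ : Type}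
    [Fintype κ] (i : ι) (K : κ → Matrix B B ℂ)
    (h : Φ i ∘ₗ ∑ k, conj (K k) = Φ i) :
    SuperOp.tensor Φ ∘ₗ ∑ k, conj (tensM (Function.update (fun _ => 1) i (K k))) =
      SuperOp.tensor Φ := by
  refine superOp_ext_tensM fun ρ => ?_
  have h1 : (∑ k, conj (tensM (Function.update (fun _ => 1) i (K k)))) (tensM ρ) =
      tensM (Function.update ρ i ((∑ k, conj (K k)) (ρ i))) := by
    rw [LinearMap.sum_apply]
    simp_rw [conj_tensM_apply]
    ext u v
    simp only [Matrix.sum_apply, tensM_apply, LinearMap.sum_apply]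
    rw [← Finset.mul_prod_erase _ _ (Finset.mem_univ i)]
    simp only [Function.update_self, Matrix.sum_apply, Finset.sum_mul]
    refine Finset.sum_congr rfl fun k _ => ?_
    rw [← Finset.mul_prod_erase _ _ (Finset.mem_univ i)]
    simp only [Function.update_self]
    congr 1
    refine Finset.prod_congr rfl fun l hl => ?_
    rw [Function.update_of_ne (Finset.ne_of_mem_erase hl),
      Function.update_of_ne (Finset.ne_of_mem_erase hl), conj_one]
    rfl
  rw [LinearMap.comp_apply, h1, tensor_tensM, tensor_tensM]
  congr 1
  funext l
  by_cases hl : l = i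
  · subst hl
    rw [Function.update_self, ← LinearMap.comp_apply, h]
  · rw [Function.update_of_ne hl]

end Tensor

section OnWire

variable {n : ℕ} {A B D : Type} [DecidableEq A]

theorem onWire_eq_tensM (i : Fin n) (K : Matrix A A ℂ) :
    onWire i K = tensM (Function.update (fun _ => 1) i K) := by
  ext u v
  rw [tensM_apply, ← Finset.mul_prod_erase _ _ (Finset.mem_univ i), Function.update_self]
  have h : ∏ k ∈ Finset.univ.erase i,
      (Function.update (fun _ => 1) i K : Fin n → Matrix A A ℂ) k (u k) (v k) =
      if ∀ k, k ≠ i → u k = v k then 1 else 0 := by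
    rw [Finset.prod_congr rfl fun k hk => by
      rw [Function.update_of_ne (Finset.ne_of_mem_erase hk), Matrix.one_apply]]
    rw [Finset.prod_ite_zero, Finset.prod_const_one]
    simp
  rw [h]
  simp [onWire]

variable [Fintype A]

theorem onWire_mul_tensM (i : Fin n) (K : Matrix A A ℂ) (L : Fin n → Matrix A B ℂ) :
    onWire i K * tensM L = tensM (Function.update L i (K * L i)) := by
  rw [onWire_eq_tensM, tensM_mul]
  congr 1
  funext k
  by_cases h : k = i
  · subst h; simp
  · simp [Function.update_of_ne h]

theorem tensM_mul_onWire (i : Fin n) (K : Matrix A A ℂ) (L : Fin n → Matrix B A ℂ) :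
    tensM L * onWire i K = tensM (Function.update L i (L i * K)) := by
  rw [onWire_eq_tensM, tensM_mul]
  congr 1
  funext k
  by_cases h : k = i
  · subst h; simp
  · simp [Function.update_of_ne h]

theorem onWire_mul (i : Fin n) (K L : Matrix A A ℂ) :
    onWire i K * onWire i L = onWire i (K * L) := by
  rw [onWire_eq_tensM i L, onWire_mul_tensM, onWire_eq_tensM]
  simp

theorem onWire_one (i : Fin n) : onWire i (1 : Matrix A A ℂ) = 1 := by
  rw [onWire_eq_tensM]
  have : Function.update (fun _ : Fin n => (1 : Matrix A A ℂ)) i 1 = fun _ => 1 := by simp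
  rw [this, tensM_one]

theorem onWire_conjTranspose (i : Fin n) (K : Matrix A A ℂ) :
    (onWire i K)ᴴ = onWire i Kᴴ := by
  rw [onWire_eq_tensM, onWire_eq_tensM, tensM_conjTranspose]
  congr 1
  funext k
  by_cases h : k = i
  · subst h; simp
  · simp [Function.update_of_ne h]

theorem onWire_comm {i j : Fin n} (h : i ≠ j) (K L : Matrix A A ℂ) :
    onWire i K * onWire j L = onWire j L * onWire i K := by
  rw [onWire_eq_tensM j L, onWire_mul_tensM, tensM_mul_onWire]
  congr 1
  funext k
  by_cases hk : k = i
  · subst hk; simp [Function.update_of_ne h]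
  · simp [Function.update_of_ne hk]

theorem onWire_sum {κ : Type} (s : Finset κ) (i : Fin n) (K : κ → Matrix A A ℂ) :
    onWire i (∑ k ∈ s, K k) = ∑ k ∈ s, onWire i (K k) := by
  ext u v
  simp only [onWire, Matrix.of_apply, Matrix.sum_apply]
  split_ifs <;> simp

theorem onWire_smul (i : Fin n) (c : ℂ) (K : Matrix A A ℂ) :
    onWire i (c • K) = c • onWire i K := by
  ext u v
  simp [onWire]

/-- Kraus families on one wire are complete if they are complete on the register of this wire. -/
theorem onWire_complete {κ : Type} [Fintype κ] (i : Fin n) (K : κ → Matrix A A ℂ)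
    (hK : ∑ k, (K k)ᴴ * K k = 1) : ∑ k, (onWire i (K k))ᴴ * onWire i (K k) = 1 := by
  simp_rw [onWire_conjTranspose, onWire_mul]
  rw [← onWire_sum, hK, onWire_one]

end OnWire

section Cnot

variable {n : ℕ} {A B : Type} [AddCommGroup A] [DecidableEq A] [Module Bit A]
  [AddCommGroup B] [DecidableEq B] [Module Bit B]

/-- The action of `CNOT` on basis labels. -/
def cnotFun (i j : Fin n) (v : Fin n → A) : Fin n → A := Function.update v j (v j + v i)

theorem cnotFun_cnotFun {i j : Fin n} (h : i ≠ j) (v : Fin n → A) :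
    cnotFun i j (cnotFun i j v) = v := by
  funext k
  by_cases hk : k = j
  · subst hk
    simp [cnotFun, Function.update_of_ne h, add_assoc, ZModModule.add_self]
  · simp [cnotFun, Function.update_of_ne hk]

theorem cnotU_mul_apply [Fintype A] {D : Type} {i j : Fin n} (h : i ≠ j)
    (N : Matrix (Fin n → A) D ℂ) (u : Fin n → A) (v : D) :
    ((cnotU i j : Matrix (Fin n → A) (Fin n → A) ℂ) * N) u v = N (cnotFun i j u) v := by
  rw [Matrix.mul_apply, Finset.sum_eq_single (cnotFun i j u)]
  · have : u = Function.update (cnotFun i j u) j (cnotFun i j u j + cnotFun i j u i) :=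
      (cnotFun_cnotFun h u).symm
    simp only [cnotU, Matrix.of_apply]
    rw [if_pos this, one_mul]
  · intro w _ hw
    have : ¬ u = Function.update w j (w j + w i) := by
      rintro rfl
      exact hw (cnotFun_cnotFun h w).symm
    simp only [cnotU, Matrix.of_apply]
    rw [if_neg this, zero_mul]
  · simp

theorem mul_cnotU_apply [Fintype A] {D : Type} {i j : Fin n}
    (N : Matrix D (Fin n → A) ℂ) (u : D) (v : Fin n → A) :
    (N * (cnotU i j : Matrix (Fin n → A) (Fin n → A) ℂ)) u v = N u (cnotFun i j v) := by
  simp [Matrix.mul_apply, cnotU, cnotFun]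

theorem prod_eq_mul_mul {i j : Fin n} (h : i ≠ j) (f : Fin n → ℂ) :
    ∏ k, f k = f i * f j * ∏ k ∈ (Finset.univ.erase i).erase j, f k := by
  rw [← Finset.mul_prod_erase _ f (Finset.mem_univ i),
    ← Finset.mul_prod_erase _ f (Finset.mem_erase.2 ⟨h.symm, Finset.mem_univ j⟩), mul_assoc]

/-- The commutation of a product operator with `CNOT` is a condition on the two wires involved. -/
theorem cnotU_mul_tensM [Fintype A] [Fintype B] {i j : Fin n} (h : i ≠ j)
    (K L : Fin n → Matrix B A ℂ)
    (hrest : ∀ k, k ≠ i → k ≠ j → K k = L k)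
    (hij : ∀ ui uj vi vj, K i ui vi * K j (uj + ui) vj = L i ui vi * L j uj (vj + vi)) :
    (cnotU i j : Matrix (Fin n → B) (Fin n → B) ℂ) * tensM K =
      tensM L * (cnotU i j : Matrix (Fin n → A) (Fin n → A) ℂ) := by
  ext u v
  rw [cnotU_mul_apply h, mul_cnotU_apply, tensM_apply, tensM_apply, prod_eq_mul_mul h,
    prod_eq_mul_mul h]
  congr 1
  · simpa [cnotFun, Function.update_of_ne h] using hij (u i) (u j) (v i) (v j)
  · refine Finset.prod_congr rfl fun k hk => ?_
    simp only [Finset.mem_erase, Finset.mem_univ, and_true] at hk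
    simp [cnotFun, Function.update_of_ne hk.1, hrest k hk.2 hk.1]

theorem cnotU_mul_self [Fintype A] {i j : Fin n} (h : i ≠ j) :
    cnotU i j * (cnotU i j : Matrix (Fin n → A) (Fin n → A) ℂ) = 1 := by
  ext u v
  rw [cnotU_mul_apply h, Matrix.one_apply]
  simp only [cnotU, Matrix.of_apply]
  congr 1
  refine propext ⟨fun e => ?_, fun e => ?_⟩
  · rw [← cnotFun_cnotFun h u, e]
    exact cnotFun_cnotFun h v
  · rw [e]; rfl

theorem cnotU_conjTranspose {i j : Fin n} (h : i ≠ j) :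
    (cnotU i j : Matrix (Fin n → A) (Fin n → A) ℂ)ᴴ = cnotU i j := by
  ext u v
  simp only [cnotU, Matrix.of_apply, Matrix.conjTranspose_apply]
  have : (v = Function.update u j (u j + u i)) ↔ (u = Function.update v j (v j + v i)) := by
    constructor
    · rintro rfl
      exact (cnotFun_cnotFun h u).symm
    · rintro rfl
      exact (cnotFun_cnotFun h v).symm
  simp [this]

theorem cnotU_comm_onWire [Fintype A] {i j k : Fin n} (h : i ≠ j) (hi : k ≠ i) (hj : k ≠ j)
    (K : Matrix A A ℂ) : cnotU i j * onWire k K = onWire k K * cnotU i j := by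
  rw [onWire_eq_tensM]
  refine cnotU_mul_tensM h _ _ (fun _ _ _ => rfl) fun ui uj vi vj => ?_
  rw [Function.update_of_ne hi.symm, Function.update_of_ne hj.symm]
  by_cases e : ui = vi
  · subst e
    have : (uj + ui = vj) ↔ (uj = vj + ui) := by
      constructor
      · rintro rfl; rw [add_assoc, ZModModule.add_self, add_zero]
      · rintro rfl; rw [add_assoc, ZModModule.add_self, add_zero]
    simp [Matrix.one_apply, this]
  · simp [e]

end Cnot

/-! ### Pauli and Hadamard operators -/

theorem sign_zero : sign 0 = 1 := if_pos rfl

theorem sign_one : sign 1 = -1 := if_neg one_ne_zero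

theorem bit_cases (b : Bit) : b = 0 ∨ b = 1 := by
  revert b; decide

theorem sign_add (a b : Bit) : sign (a + b) = sign a * sign b := by
  have h : (1 + 1 : Bit) = 0 := by decide
  rcases bit_cases a with rfl | rfl <;> rcases bit_cases b with rfl | rfl <;>
    simp [sign_zero, sign_one, h]

theorem sign_mul_self (a : Bit) : sign a * sign a = 1 := by
  rcases bit_cases a with rfl | rfl <;> simp [sign_zero, sign_one]

theorem star_sign (a : Bit) : star (sign a) = sign a := by
  rcases bit_cases a with rfl | rfl <;> simp [sign_zero, sign_one]

theorem sign_mul_star (a : Bit) : sign a * star (sign a) = 1 := by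
  rw [star_sign, sign_mul_self]

theorem sign_sum {κ : Type} (s : Finset κ) (f : κ → Bit) :
    sign (∑ k ∈ s, f k) = ∏ k ∈ s, sign (f k) := by
  classical
  induction s using Finset.induction_on with
  | empty => simp [sign_zero]
  | insert a s ha ih => rw [Finset.sum_insert ha, Finset.prod_insert ha, sign_add, ih]

section Pauli

variable {ι : Type} [Fintype ι] [DecidableEq ι]

/-- A sum over a finite group of exponent two vanishes if a shift of the summation variable
changes its sign. -/
theorem sum_eq_zero_of_shift {V : Type} [Fintype V] [AddCommGroup V] (f : V → ℂ) (d : V)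
    (h : ∀ v, f (v + d) = -f v) : ∑ v, f v = 0 := by
  have h1 : ∑ v, f (v + d) = ∑ v, f v := Equiv.sum_comp (Equiv.addRight d) f
  simp_rw [h, Finset.sum_neg_distrib] at h1
  exact self_eq_neg.mp h1.symm

theorem sum_sign_dotProduct (u : ι → Bit) :
    ∑ v, sign (u ⬝ᵥ v) = if u = 0 then (2 : ℂ) ^ Fintype.card ι else 0 := by
  split_ifs with h
  · subst h
    simp [sign_zero, Bit]
  · obtain ⟨i, hi⟩ : ∃ i, u i ≠ 0 := by
      by_contra! hc
      exact h (funext hc)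
    refine sum_eq_zero_of_shift _ (Pi.single i 1) fun v => ?_
    rw [dotProduct_add, sign_add, dotProduct_single, mul_one,
      (bit_cases (u i)).resolve_left hi, sign_one]
    ring

/-- The Pauli operator `X^x Z^z`. -/
def pauli (x z : ι → Bit) : Matrix (ι → Bit) (ι → Bit) ℂ := pauliX x * pauliZ z

theorem pauli_apply (x z u v : ι → Bit) :
    pauli x z u v = if u = v + x then sign (z ⬝ᵥ v) else 0 := by
  simp [pauli, pauliZ, Matrix.mul_diagonal, pauliX]

theorem add_add_self (v x : ι → Bit) : v + x + x = v := by
  rw [add_assoc, ZModModule.add_self, add_zero]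

theorem eq_add_iff (u v x : ι → Bit) : u = v + x ↔ v = u + x := by
  constructor <;> rintro rfl <;> rw [add_add_self]

theorem pauli_mul_apply {D : Type} (x z : ι → Bit) (N : Matrix (ι → Bit) D ℂ) (u : ι → Bit)
    (d : D) : (pauli x z * N) u d = sign (z ⬝ᵥ (u + x)) * N (u + x) d := by
  rw [Matrix.mul_apply, Finset.sum_eq_single (u + x)]
  · rw [pauli_apply, add_add_self, if_pos rfl]
  · intro w _ hw
    rw [pauli_apply, if_neg, zero_mul]
    rwa [eq_add_iff]
  · simp

theorem mul_pauli_apply {D : Type} (x z : ι → Bit) (N : Matrix D (ι → Bit) ℂ) (d : D)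
    (v : ι → Bit) : (N * pauli x z) d v = N d (v + x) * sign (z ⬝ᵥ v) := by
  rw [Matrix.mul_apply, Finset.sum_eq_single (v + x)]
  · rw [pauli_apply, if_pos rfl]
  · intro w _ hw
    rw [pauli_apply, if_neg hw, mul_zero]
  · simp

theorem pauli_mul_pauli (x z x' z' : ι → Bit) :
    pauli x z * pauli x' z' = sign (z ⬝ᵥ x') • pauli (x + x') (z + z') := by
  ext u v
  rw [mul_pauli_apply, pauli_apply, Matrix.smul_apply, pauli_apply, add_assoc, add_comm x' x]
  split_ifs with h
  · rw [dotProduct_add, add_dotProduct, sign_add, sign_add, smul_eq_mul]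
    ring
  · simp

theorem pauli_zero : pauli (0 : ι → Bit) 0 = 1 := by
  ext u v
  simp [pauli_apply, sign_zero, Matrix.one_apply]

theorem pauli_conjTranspose (x z : ι → Bit) :
    (pauli x z)ᴴ = sign (z ⬝ᵥ x) • pauli x z := by
  ext u v
  rw [Matrix.conjTranspose_apply, Matrix.smul_apply, pauli_apply, pauli_apply]
  by_cases h : v = u + x
  · rw [if_pos h, if_pos ((eq_add_iff _ _ _).1 h), star_sign, h, dotProduct_add, sign_add,
      smul_eq_mul, mul_comm, mul_assoc, sign_mul_self, mul_one]
  · rw [if_neg h, if_neg fun e => h ((eq_add_iff _ _ _).1 e)]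
    simp

theorem pauli_unitary (x z : ι → Bit) : (pauli x z)ᴴ * pauli x z = 1 := by
  rw [pauli_conjTranspose, smul_mul_assoc, pauli_mul_pauli, smul_smul, sign_mul_self, one_smul,
    ZModModule.add_self, ZModModule.add_self, pauli_zero]

theorem hadamardAll_apply (u v : ι → Bit) :
    hadamardAll ι u v = ((Real.sqrt 2 : ℂ)⁻¹) ^ Fintype.card ι * sign (u ⬝ᵥ v) := rfl

theorem inv_sqrt_two_mul_self : ((Real.sqrt 2 : ℂ)⁻¹) * (Real.sqrt 2 : ℂ)⁻¹ = 2⁻¹ := by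
  rw [← mul_inv, ← Complex.ofReal_mul, Real.mul_self_sqrt (by norm_num)]
  norm_num

theorem inv_sqrt_two_pow_mul_self (k : ℕ) :
    ((Real.sqrt 2 : ℂ)⁻¹) ^ k * ((Real.sqrt 2 : ℂ)⁻¹) ^ k = (2⁻¹ : ℂ) ^ k := by
  rw [← mul_pow, inv_sqrt_two_mul_self]

theorem star_inv_sqrt_two_pow (k : ℕ) :
    star (((Real.sqrt 2 : ℂ)⁻¹) ^ k) = ((Real.sqrt 2 : ℂ)⁻¹) ^ k := by
  rw [← Complex.ofReal_inv, ← Complex.ofReal_pow]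
  exact Complex.conj_ofReal _

theorem hadamardAll_conjTranspose : (hadamardAll ι)ᴴ = hadamardAll ι := by
  ext u v
  rw [Matrix.conjTranspose_apply, hadamardAll_apply, hadamardAll_apply, star_mul', star_sign,
    star_inv_sqrt_two_pow, dotProduct_comm]

theorem hadamardAll_mul_self : hadamardAll ι * hadamardAll ι = 1 := by
  ext u v
  have h : ∀ w, hadamardAll ι u w * hadamardAll ι w v =
      (2⁻¹ : ℂ) ^ Fintype.card ι * sign ((u + v) ⬝ᵥ w) := by
    intro w
    rw [hadamardAll_apply, hadamardAll_apply, add_dotProduct, sign_add, dotProduct_comm w v,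
      ← inv_sqrt_two_pow_mul_self]
    ring
  rw [Matrix.mul_apply]
  simp_rw [h]
  rw [← Finset.mul_sum, sum_sign_dotProduct, Matrix.one_apply]
  have : u + v = 0 ↔ u = v := by
    rw [add_eq_zero_iff_eq_neg, ZModModule.neg_eq_self]
  simp only [this]
  split_ifs
  · rw [← mul_pow]; norm_num
  · simp

theorem hadamardAll_mul_pauli (x z : ι → Bit) :
    hadamardAll ι * pauli x z = sign (z ⬝ᵥ x) • (pauli z x * hadamardAll ι) := by
  ext u v
  rw [mul_pauli_apply, Matrix.smul_apply, pauli_mul_apply, hadamardAll_apply, hadamardAll_apply]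
  simp only [dotProduct_add, add_dotProduct, sign_add, smul_eq_mul]
  rw [dotProduct_comm u x, dotProduct_comm x z]
  linear_combination (-((Real.sqrt 2 : ℂ)⁻¹) ^ Fintype.card ι * sign (u ⬝ᵥ v) * sign (x ⬝ᵥ u) *
    sign (z ⬝ᵥ v)) * sign_mul_self (z ⬝ᵥ x)

theorem permuteWord_apply (π : Equiv.Perm ι) (v : ι → Bit) (i : ι) :
    permuteWord π v i = v (π.symm i) := rfl

theorem permuteWord_inv_apply (π : Equiv.Perm ι) (v : ι → Bit) (i : ι) :
    permuteWord π⁻¹ v i = v (π i) := rfl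

theorem permuteWord_inv_permuteWord (π : Equiv.Perm ι) (v : ι → Bit) :
    permuteWord π⁻¹ (permuteWord π v) = v := by
  funext i
  rw [permuteWord_inv_apply, permuteWord_apply, Equiv.symm_apply_apply]

theorem permuteWord_permuteWord_inv (π : Equiv.Perm ι) (v : ι → Bit) :
    permuteWord π (permuteWord π⁻¹ v) = v := by
  funext i
  rw [permuteWord_apply, permuteWord_inv_apply, Equiv.apply_symm_apply]

theorem permuteWord_add (π : Equiv.Perm ι) (v w : ι → Bit) :
    permuteWord π (v + w) = permuteWord π v + permuteWord π w := rfl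

theorem dotProduct_permuteWord (π : Equiv.Perm ι) (v w : ι → Bit) :
    permuteWord π v ⬝ᵥ w = v ⬝ᵥ permuteWord π⁻¹ w := by
  simp only [dotProduct]
  rw [← Equiv.sum_comp π]
  simp_rw [permuteWord_inv_apply, permuteWord_apply, Equiv.symm_apply_apply]

theorem permuteU_mul_apply {D : Type} (π : Equiv.Perm ι) (N : Matrix (ι → Bit) D ℂ)
    (u : ι → Bit) (d : D) : (permuteU π * N) u d = N (permuteWord π⁻¹ u) d := by
  rw [Matrix.mul_apply, Finset.sum_eq_single (permuteWord π⁻¹ u)]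
  · simp [permuteU, permuteWord_permuteWord_inv]
  · intro w _ hw
    have : u ≠ permuteWord π w := by
      rintro rfl
      exact hw (permuteWord_inv_permuteWord π w).symm
    simp [permuteU, this]
  · simp

theorem mul_permuteU_apply {D : Type} (π : Equiv.Perm ι) (N : Matrix D (ι → Bit) ℂ)
    (d : D) (v : ι → Bit) : (N * permuteU π) d v = N d (permuteWord π v) := by
  simp [Matrix.mul_apply, permuteU]

theorem permuteU_mul (π τ : Equiv.Perm ι) : permuteU π * permuteU τ = permuteU (π * τ) := by
  ext u v
  rw [mul_permuteU_apply]
  rfl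

theorem permuteU_one : permuteU (1 : Equiv.Perm ι) = 1 := by
  ext u v
  have : permuteWord (1 : Equiv.Perm ι) v = v := rfl
  simp [permuteU, this, Matrix.one_apply]

theorem permuteU_conjTranspose (π : Equiv.Perm ι) : (permuteU π)ᴴ = permuteU π⁻¹ := by
  ext u v
  have : v = permuteWord π u ↔ u = permuteWord π⁻¹ v := by
    constructor
    · rintro rfl; rw [permuteWord_inv_permuteWord]
    · rintro rfl; rw [permuteWord_permuteWord_inv]
  simp [permuteU, Matrix.conjTranspose_apply, this]

theorem pauli_mul_permuteU (π : Equiv.Perm ι) (x z : ι → Bit) :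
    pauli x z * permuteU π = permuteU π * pauli (permuteWord π⁻¹ x) (permuteWord π⁻¹ z) := by
  ext u v
  rw [mul_permuteU_apply, permuteU_mul_apply, pauli_apply, pauli_apply, dotProduct_permuteWord,
    inv_inv]
  congr 1
  refine propext ⟨?_, fun h => ?_⟩
  · rintro rfl
    rw [permuteWord_add, permuteWord_inv_permuteWord]
  · rw [← permuteWord_permuteWord_inv π u, h, permuteWord_add, permuteWord_permuteWord_inv]

theorem hadamardAll_mul_permuteU (π : Equiv.Perm ι) :
    hadamardAll ι * permuteU π = permuteU π * hadamardAll ι := by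
  ext u v
  rw [mul_permuteU_apply, permuteU_mul_apply, hadamardAll_apply, hadamardAll_apply,
    dotProduct_permuteWord, inv_inv]

end Pauli

/-! ### Self-dual CSS codes -/

theorem dualCode_dualCode {m : ℕ} (C : Submodule Bit (Fin m → Bit)) :
    dualCode (dualCode C) = C := by
  let B : LinearMap.BilinForm Bit (Fin m → Bit) := dotProductBilin Bit Bit
  have hB : ∀ u v, B u v = u ⬝ᵥ v := fun _ _ => rfl
  have key : ∀ D : Submodule Bit (Fin m → Bit), dualCode D = B.orthogonal D := by
    intro D
    ext u
    rw [LinearMap.BilinForm.mem_orthogonal_iff]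
    refine forall₂_congr fun v _ => ?_
    rw [dotProduct_comm]
    rfl
  rw [key, key]
  apply LinearMap.BilinForm.orthogonal_orthogonal
  · refine ⟨fun x hx => ?_, fun y hy => ?_⟩
    · funext i
      have := hx (Pi.single i 1)
      rwa [hB, dotProduct_single, mul_one] at this
    · funext i
      have := hy (Pi.single i 1)
      rwa [hB, single_dotProduct, one_mul] at this
  · intro x y h
    rw [hB] at *
    rwa [dotProduct_comm]

theorem finrank_add_finrank_dualCode {m : ℕ} (C : Submodule Bit (Fin m → Bit)) :
    Module.finrank Bit C + Module.finrank Bit (dualCode C) = m := by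
  let B : LinearMap.BilinForm Bit (Fin m → Bit) := dotProductBilin Bit Bit
  have hB : ∀ u v, B u v = u ⬝ᵥ v := fun _ _ => rfl
  have key : dualCode C = B.orthogonal C := by
    ext u
    rw [LinearMap.BilinForm.mem_orthogonal_iff]
    refine forall₂_congr fun v _ => ?_
    rw [dotProduct_comm]
    rfl
  have hnd : B.Nondegenerate := by
    refine ⟨fun x hx => ?_, fun y hy => ?_⟩
    · funext i
      have := hx (Pi.single i 1)
      rwa [hB, dotProduct_single, mul_one] at this
    · funext i
      have := hy (Pi.single i 1)
      rwa [hB, single_dotProduct, one_mul] at this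
  have h1 := LinearMap.BilinForm.finrank_orthogonal hnd C
  have h2 := Submodule.finrank_le C
  rw [Module.finrank_fin_fun] at h1 h2
  rw [key]
  omega

namespace SelfDualCSS

variable {m t : ℕ} (Q : SelfDualCSS m t)

/-- The word `b ⋯ b`. -/
def rep (m : ℕ) (b : Bit) : Fin m → Bit := fun _ => b

/-- The normalisation of the code words, `|C^⊥|^{-1/2}`. -/
def norm : ℂ := ((Real.sqrt (Nat.card (dualCode Q.C)) : ℝ) : ℂ)⁻¹

open Classical in
theorem encode_apply (u : Fin m → Bit) (b : Bit) :
    Q.encode u b = if u + rep m b ∈ dualCode Q.C then Q.norm else 0 := by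
  have : (u - fun _ => b) = u + rep m b := ZModModule.sub_eq_add u _
  simp only [encode, Matrix.of_apply, this, norm]

theorem card_dual_pos : 0 < Nat.card (dualCode Q.C) := Nat.card_pos

theorem norm_mul_norm : Q.norm * Q.norm * (Nat.card (dualCode Q.C) : ℂ) = 1 := by
  have h : ((Nat.card (dualCode Q.C) : ℝ) : ℂ) ≠ 0 := by
    exact_mod_cast Q.card_dual_pos.ne'
  rw [norm, ← mul_inv, ← Complex.ofReal_mul, Real.mul_self_sqrt (Nat.cast_nonneg _)]
  exact inv_mul_cancel₀ h

theorem star_norm : star Q.norm = Q.norm := by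
  rw [norm, ← Complex.ofReal_inv]
  exact Complex.conj_ofReal _

theorem dot_eq_zero {u v : Fin m → Bit} (hu : u ∈ dualCode Q.C) (hv : v ∈ Q.C) : u ⬝ᵥ v = 0 :=
  hu v hv

theorem mem_C_iff {v : Fin m → Bit} : v ∈ Q.C ↔ ∀ u ∈ dualCode Q.C, v ⬝ᵥ u = 0 := by
  conv_lhs => rw [← dualCode_dualCode Q.C]
  rfl

theorem dotProduct_self (u : Fin m → Bit) : u ⬝ᵥ u = u ⬝ᵥ rep m 1 := by
  simp only [dotProduct, rep]
  refine Finset.sum_congr rfl fun i _ => ?_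
  rcases bit_cases (u i) with h | h <;> simp [h]

theorem one_mem : rep m 1 ∈ Q.C := by
  rw [mem_C_iff]
  intro u hu
  rw [dotProduct_comm, ← dotProduct_self]
  exact Q.dot_eq_zero hu (Q.dual_le hu)

theorem rep_zero : rep m 0 = 0 := rfl

theorem rep_add (a b : Bit) : rep m (a + b) = rep m a + rep m b := rfl

theorem rep_mem (b : Bit) : rep m b ∈ Q.C := by
  rcases bit_cases b with rfl | rfl
  · exact Q.C.zero_mem
  · exact Q.one_mem

/-- The length is odd; hence `1⋯1` is not in `C^⊥`. -/
theorem length_eq (Q : SelfDualCSS m t) : m = 2 * Module.finrank Bit (dualCode Q.C) + 1 := by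
  have h := finrank_add_finrank_dualCode Q.C
  have := Q.finrank_eq
  omega

theorem length_pos (Q : SelfDualCSS m t) : 0 < m := by
  have := Q.length_eq
  omega

theorem rep_dot_rep_one (Q : SelfDualCSS m t) (b : Bit) : rep m b ⬝ᵥ rep m 1 = b := by
  have h : ((2 : ℕ) : Bit) = 0 := by decide
  simp only [dotProduct, rep, mul_one, Finset.sum_const, Finset.card_univ, Fintype.card_fin,
    nsmul_eq_mul]
  rw [Q.length_eq]
  push_cast at h ⊢
  rw [h]
  ring

theorem one_notMem : rep m 1 ∉ dualCode Q.C := by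
  intro h
  have := Q.dot_eq_zero h Q.one_mem
  rw [Q.rep_dot_rep_one] at this
  exact one_ne_zero this

theorem rep_mem_dual_iff (b : Bit) : rep m b ∈ dualCode Q.C ↔ b = 0 := by
  rcases bit_cases b with rfl | rfl
  · simp [rep_zero]
  · simp [Q.one_notMem]

/-- The code `C` is the union of the cosets `C^⊥` and `C^⊥ + 1⋯1`. -/
theorem mem_C_iff_exists {v : Fin m → Bit} : v ∈ Q.C ↔ ∃ b, v + rep m b ∈ dualCode Q.C := by
  constructor
  · intro hv
    have hle : dualCode Q.C ⊔ Submodule.span Bit {rep m 1} = Q.C := by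
      refine Submodule.eq_of_le_of_finrank_le (sup_le Q.dual_le ?_) ?_
      · rw [Submodule.span_singleton_le_iff_mem]
        exact Q.one_mem
      · rw [Q.finrank_eq]
        have hlt : dualCode Q.C < dualCode Q.C ⊔ Submodule.span Bit {rep m 1} := by
          refine lt_of_le_of_ne le_sup_left fun h => Q.one_notMem ?_
          rw [h]
          exact Submodule.mem_sup_right (Submodule.mem_span_singleton_self _)
        exact Submodule.finrank_lt_finrank_of_lt hlt
    rw [← hle, Submodule.mem_sup] at hv
    obtain ⟨y, hy, z, hz, rfl⟩ := hv
    obtain ⟨b, rfl⟩ := Submodule.mem_span_singleton.1 hz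
    refine ⟨b, ?_⟩
    have : b • rep m 1 = rep m b := by
      funext i
      simp [rep]
    rwa [this, add_add_self]
  · rintro ⟨b, hb⟩
    have := Q.C.add_mem (Q.dual_le hb) (Q.rep_mem b)
    rwa [add_add_self] at this

theorem add_mem_dual_iff {u d : Fin m → Bit} (hd : d ∈ dualCode Q.C) :
    u + d ∈ dualCode Q.C ↔ u ∈ dualCode Q.C :=
  (dualCode Q.C).add_mem_iff_left hd

/-- `X`-type stabilisers. -/
theorem pauli_mul_encode_left {d : Fin m → Bit} (hd : d ∈ dualCode Q.C) :
    pauli d 0 * Q.encode = Q.encode := by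
  ext u b
  rw [pauli_mul_apply, encode_apply, encode_apply, zero_dotProduct, sign_zero, one_mul,
    add_right_comm]
  classical
  exact if_congr (Q.add_mem_dual_iff hd) rfl rfl

/-- `Z`-type stabilisers. -/
theorem pauli_mul_encode_right {d : Fin m → Bit} (hd : d ∈ dualCode Q.C) :
    pauli 0 d * Q.encode = Q.encode := by
  ext u b
  rw [pauli_mul_apply, add_zero, encode_apply]
  split_ifs with h
  · rw [Q.dot_eq_zero hd (Q.mem_C_iff_exists.2 ⟨b, h⟩), sign_zero, one_mul]
  · rw [mul_zero]

theorem pauli_mul_encode {x z : Fin m → Bit} (hx : x ∈ dualCode Q.C) (hz : z ∈ dualCode Q.C) :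
    pauli x z * Q.encode = Q.encode := by
  have : pauli x z = pauli x 0 * pauli 0 z := by
    rw [pauli_mul_pauli]
    simp [sign_zero]
  rw [this, Matrix.mul_assoc, Q.pauli_mul_encode_right hz, Q.pauli_mul_encode_left hx]

/-- An error with a nontrivial syndrome maps the code space to an orthogonal space. -/
theorem encode_pauli_encode_eq_zero {x z : Fin m → Bit} (h : x ∉ Q.C ∨ z ∉ Q.C) :
    Q.encodeᴴ * (pauli x z * Q.encode) = 0 := by
  -- a stabiliser that anticommutes with the error changes the sign of the matrix
  have key : ∀ S : Matrix (Fin m → Bit) (Fin m → Bit) ℂ, S * Q.encode = Q.encode →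
      Sᴴ * Q.encode = Q.encode → S * pauli x z = -(pauli x z * S) →
      Q.encodeᴴ * (pauli x z * Q.encode) = 0 := by
    intro S h1 h2 h3
    have h4 : Q.encodeᴴ * (pauli x z * Q.encode) = -(Q.encodeᴴ * (pauli x z * Q.encode)) := by
      have h5 : Q.encodeᴴ = Q.encodeᴴ * S := by
        conv_lhs => rw [← h2, Matrix.conjTranspose_mul, Matrix.conjTranspose_conjTranspose]
      conv_lhs => rw [h5, Matrix.mul_assoc, ← Matrix.mul_assoc S, h3, Matrix.neg_mul,
        Matrix.mul_neg, Matrix.mul_assoc, h1]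
    ext i j
    exact self_eq_neg.mp (congrFun (congrFun h4 i) j)
  rcases h with h | h
  · rw [mem_C_iff] at h
    push Not at h
    obtain ⟨d, hd, hxd⟩ := h
    have hxd : x ⬝ᵥ d = 1 := (bit_cases _).resolve_left hxd
    refine key (pauli 0 d) (Q.pauli_mul_encode_right hd) ?_ ?_
    · rw [pauli_conjTranspose, dotProduct_zero, sign_zero, one_smul, Q.pauli_mul_encode_right hd]
    · rw [pauli_mul_pauli, pauli_mul_pauli, dotProduct_comm, hxd, dotProduct_zero, sign_zero,
        sign_one, add_comm x, add_comm z]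
      simp
  · rw [mem_C_iff] at h
    push Not at h
    obtain ⟨d, hd, hzd⟩ := h
    have hzd : z ⬝ᵥ d = 1 := (bit_cases _).resolve_left hzd
    refine key (pauli d 0) (Q.pauli_mul_encode_left hd) ?_ ?_
    · rw [pauli_conjTranspose, zero_dotProduct, sign_zero, one_smul, Q.pauli_mul_encode_left hd]
    · rw [pauli_mul_pauli, pauli_mul_pauli, hzd, zero_dotProduct, sign_zero,
        sign_one, add_comm x, add_comm z]
      simp

open Classical in
theorem card_dual_eq_sum :
    (∑ u : Fin m → Bit, if u ∈ dualCode Q.C then (1 : ℂ) else 0) = Nat.card (dualCode Q.C) := by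
  rw [Finset.sum_boole, Nat.card_eq_fintype_card, Fintype.card_subtype]

open Classical in
theorem sum_dual_shift (f : (Fin m → Bit) → ℂ) (b : Bit) :
    (∑ u : Fin m → Bit, if u + rep m b ∈ dualCode Q.C then f u else 0) =
      ∑ u : Fin m → Bit, if u ∈ dualCode Q.C then f (u + rep m b) else 0 := by
  rw [← Equiv.sum_comp (Equiv.addRight (rep m b))]
  refine Finset.sum_congr rfl fun u _ => ?_
  simp only [Equiv.coe_addRight, add_add_self]

theorem encode_isometry : Q.encodeᴴ * Q.encode = 1 := by
  classical
  ext b b'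
  rw [Matrix.mul_apply, Matrix.one_apply]
  simp only [Matrix.conjTranspose_apply, encode_apply]
  split_ifs with h
  · subst h
    rw [← Q.norm_mul_norm, ← Q.card_dual_eq_sum, Finset.mul_sum]
    have := Q.sum_dual_shift (fun _ => Q.norm * Q.norm) b
    simp only [mul_ite, mul_one, mul_zero]
    rw [← this]
    refine Finset.sum_congr rfl fun u _ => ?_
    split_ifs <;> simp [star_norm]
  · refine Finset.sum_eq_zero fun u _ => ?_
    by_cases h1 : u + rep m b ∈ dualCode Q.C
    · by_cases h2 : u + rep m b' ∈ dualCode Q.C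
      · exfalso
        have h3 := (dualCode Q.C).add_mem h1 h2
        have h4 : u + rep m b + (u + rep m b') = rep m (b + b') := by
          rw [add_add_add_comm, ZModModule.add_self, zero_add, rep_add]
        rw [h4, rep_mem_dual_iff] at h3
        exact h (by rwa [add_eq_zero_iff_eq_neg, ZModModule.neg_eq_self] at h3)
      · simp [h2]
    · simp [h1]

open Classical in
theorem sum_sign_dual (w : Fin m → Bit) :
    (∑ u : Fin m → Bit, if u ∈ dualCode Q.C then sign (w ⬝ᵥ u) else 0) =
      if w ∈ Q.C then (Nat.card (dualCode Q.C) : ℂ) else 0 := by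
  split_ifs with h
  · rw [← Q.card_dual_eq_sum]
    refine Finset.sum_congr rfl fun u _ => ?_
    split_ifs with hu
    · rw [Q.mem_C_iff.1 h u hu, sign_zero]
    · rfl
  · rw [mem_C_iff] at h
    push Not at h
    obtain ⟨d, hd, hwd⟩ := h
    have hwd : w ⬝ᵥ d = 1 := (bit_cases _).resolve_left hwd
    refine sum_eq_zero_of_shift _ d fun u => ?_
    simp only [Q.add_mem_dual_iff hd, dotProduct_add, sign_add, hwd, sign_one]
    split_ifs <;> simp

theorem norm_card_dual :
    ((Real.sqrt 2 : ℂ)⁻¹) ^ m * (Nat.card (dualCode Q.C) : ℂ) = (Real.sqrt 2 : ℂ)⁻¹ := by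
  have h : Nat.card (dualCode Q.C) = 2 ^ Module.finrank Bit (dualCode Q.C) := by
    rw [Module.natCard_eq_pow_finrank (K := Bit), Nat.card_zmod]
  have h' : ((Real.sqrt 2 : ℂ)⁻¹) ^ m =
      ((Real.sqrt 2 : ℂ)⁻¹) ^ (2 * Module.finrank Bit (dualCode Q.C) + 1) :=
    congrArg _ Q.length_eq
  rw [h, h', pow_succ, pow_mul, sq, inv_sqrt_two_mul_self]
  push_cast
  rw [mul_right_comm, ← mul_pow]
  norm_num

/-- The logical Hadamard gate is transversal. -/
theorem hadamardAll_mul_encode : hadamardAll (Fin m) * Q.encode = Q.encode * bitH := by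
  classical
  ext w b
  have h1 : (hadamardAll (Fin m) * Q.encode) w b =
      (Real.sqrt 2 : ℂ)⁻¹ * Q.norm * (if w ∈ Q.C then sign (w ⬝ᵥ rep m b) else 0) := by
    rw [Matrix.mul_apply]
    have : ∀ u, hadamardAll (Fin m) w u * Q.encode u b =
        if u + rep m b ∈ dualCode Q.C then
          ((Real.sqrt 2 : ℂ)⁻¹) ^ m * Q.norm * sign (w ⬝ᵥ u) else 0 := by
      intro u
      rw [encode_apply, hadamardAll_apply, Fintype.card_fin]
      split_ifs
      · ring
      · simp
    simp_rw [this]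
    rw [Q.sum_dual_shift]
    have : ∀ u, (if u ∈ dualCode Q.C then
        ((Real.sqrt 2 : ℂ)⁻¹) ^ m * Q.norm * sign (w ⬝ᵥ (u + rep m b)) else 0) =
        ((Real.sqrt 2 : ℂ)⁻¹) ^ m * Q.norm * sign (w ⬝ᵥ rep m b) *
          (if u ∈ dualCode Q.C then sign (w ⬝ᵥ u) else 0) := by
      intro u
      rw [dotProduct_add, sign_add]
      split_ifs
      · ring
      · simp
    simp_rw [this]
    rw [← Finset.mul_sum, sum_sign_dual]
    split_ifs
    · linear_combination (Q.norm * sign (w ⬝ᵥ rep m b)) * Q.norm_card_dual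
    · simp
  rw [h1, Matrix.mul_apply]
  by_cases hw : w ∈ Q.C
  · obtain ⟨c, hc⟩ := Q.mem_C_iff_exists.1 hw
    rw [if_pos hw, Finset.sum_eq_single c]
    · rw [encode_apply, if_pos hc, bitH, Matrix.of_apply]
      have : w ⬝ᵥ rep m b = c * b := by
        have h2 : w = (w + rep m c) + rep m c := (add_add_self _ _).symm
        have h3 : rep m c ⬝ᵥ rep m b = c * b := by
          rcases bit_cases b with rfl | rfl
          · simp [rep_zero]
          · rw [Q.rep_dot_rep_one, mul_one]
        rw [h2, add_dotProduct, Q.dot_eq_zero hc (Q.rep_mem b), h3, zero_add]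
      rw [this]
      ring
    · intro c' _ hc'
      rw [encode_apply, if_neg, zero_mul]
      intro h
      have h3 := (dualCode Q.C).add_mem hc h
      have h4 : w + rep m c + (w + rep m c') = rep m (c + c') := by
        rw [add_add_add_comm, ZModModule.add_self, zero_add, rep_add]
      rw [h4, rep_mem_dual_iff] at h3
      exact hc' (by rw [add_eq_zero_iff_eq_neg, ZModModule.neg_eq_self] at h3; exact h3.symm)
    · simp
  · rw [if_neg hw, mul_zero]
    refine (Finset.sum_eq_zero fun c _ => ?_).symm
    rw [encode_apply, if_neg, zero_mul]
    exact fun h => hw (Q.mem_C_iff_exists.2 ⟨c, h⟩)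

theorem recover_recover (e : Fin m → Bit) : Q.recover (Q.recover e) = Q.recover e := by
  refine (Q.recover_congr _ _ (Q.sub_recover_mem e)).symm

/-- Different values of the recovery function have different syndromes. -/
theorem eq_recover_of_mem {e a : Fin m → Bit} (he : e ∈ Finset.univ.image Q.recover)
    (h : a + e ∈ Q.C) : e = Q.recover a := by
  obtain ⟨e', -, rfl⟩ := Finset.mem_image.1 he
  rw [← Q.recover_recover e']
  refine (Q.recover_congr _ _ ?_).symm
  rwa [ZModModule.sub_eq_add]

theorem decode_mul_pauli_mul_encode (e f x z : Fin m → Bit) :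
    Q.decode e f * (pauli x z * Q.encode) =
      (sign (f ⬝ᵥ e) * sign (f ⬝ᵥ x)) • (Q.encodeᴴ * (pauli (e + x) (f + z) * Q.encode)) := by
  have h : Q.decode e f = Q.encodeᴴ * (pauli e f)ᴴ := rfl
  rw [h, pauli_conjTranspose, Matrix.mul_assoc, ← Matrix.mul_assoc _ (pauli x z), Matrix.smul_mul,
    pauli_mul_pauli, smul_smul, Matrix.smul_mul, Matrix.mul_smul]

/-- The recovery operations belong to orthogonal syndrome spaces. -/
theorem decode_mul_decode {e f e' f' : Fin m → Bit}
    (he : e ∈ Finset.univ.image Q.recover) (hf : f ∈ Finset.univ.image Q.recover)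
    (he' : e' ∈ Finset.univ.image Q.recover) (hf' : f' ∈ Finset.univ.image Q.recover) :
    Q.decode e f * (Q.decode e' f')ᴴ = if e = e' ∧ f = f' then 1 else 0 := by
  have h : (Q.decode e' f')ᴴ = pauli e' f' * Q.encode := by
    simp [decode, pauli]
  rw [h]
  split_ifs with heq
  · obtain ⟨rfl, rfl⟩ := heq
    have h' : Q.decode e f = Q.encodeᴴ * (pauli e f)ᴴ := rfl
    rw [h', Matrix.mul_assoc, ← Matrix.mul_assoc _ (pauli e f), pauli_unitary, Matrix.one_mul,
      encode_isometry]
  · rw [decode_mul_pauli_mul_encode, encode_pauli_encode_eq_zero, smul_zero]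
    by_contra! hc
    have key : ∀ {a b : Fin m → Bit}, a ∈ Finset.univ.image Q.recover →
        b ∈ Finset.univ.image Q.recover → a + b ∈ Q.C → a = b := by
      intro a b ha hb hab
      rw [Q.eq_recover_of_mem hb hab]
      refine Q.eq_recover_of_mem ha ?_
      rw [ZModModule.add_self]
      exact Q.C.zero_mem
    exact heq ⟨key he he' hc.1, key hf hf' hc.2⟩

/-- Errors of weight at most `t` of either type are corrected. -/
theorem sum_conj_decode {x z : Fin m → Bit} (hx : hammingNorm x ≤ t) (hz : hammingNorm z ≤ t) :
    ∑ e ∈ Finset.univ.image Q.recover, ∑ f ∈ Finset.univ.image Q.recover,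
      conj (Q.decode e f * (pauli x z * Q.encode)) = LinearMap.id := by
  have hmem : ∀ y, Q.recover y ∈ Finset.univ.image Q.recover := fun y =>
    Finset.mem_image_of_mem _ (Finset.mem_univ y)
  have hz0 : ∀ {e f}, e ∈ Finset.univ.image Q.recover → f ∈ Finset.univ.image Q.recover →
      (e ≠ Q.recover x ∨ f ≠ Q.recover z) →
      conj (Q.decode e f * (pauli x z * Q.encode)) = 0 := by
    intro e f he hf h
    rw [decode_mul_pauli_mul_encode, encode_pauli_encode_eq_zero, smul_zero, conj_zero]
    by_contra! hc
    rw [add_comm e, add_comm f] at hc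
    rcases h with h | h
    · exact h (Q.eq_recover_of_mem he hc.1)
    · exact h (Q.eq_recover_of_mem hf hc.2)
  rw [Finset.sum_eq_single (Q.recover x), Finset.sum_eq_single (Q.recover z)]
  · have hx' := Q.corrects x hx
    have hz' := Q.corrects z hz
    rw [ZModModule.sub_eq_add, add_comm] at hx' hz'
    rw [decode_mul_pauli_mul_encode, conj_smul_of_norm, Q.pauli_mul_encode hx' hz',
      encode_isometry, conj_one]
    rw [← sign_add, sign_mul_star]
  · exact fun f hf hne => hz0 (hmem x) hf (Or.inr hne)
  · exact fun h => absurd (hmem z) h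
  · exact fun e he hne => Finset.sum_eq_zero fun f hf => hz0 he hf (Or.inl hne)
  · exact fun h => absurd (hmem x) h

/-- Classical decoding of a code word with at most `t` errors. -/
theorem classicalDecode_eq {e w : Fin m → Bit} (b : Bit) (he : hammingNorm e ≤ t)
    (hw : w + rep m b ∈ dualCode Q.C) : Q.classicalDecode (e + w) = b := by
  have hwC : w ∈ Q.C := Q.mem_C_iff_exists.2 ⟨b, hw⟩
  have h1 : Q.recover (e + w) = Q.recover e := by
    refine Q.recover_congr _ _ ?_
    rwa [add_sub_cancel_left]
  have h2 : e + Q.recover e ∈ dualCode Q.C := by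
    rw [← ZModModule.sub_eq_add]
    exact Q.corrects e he
  have h3 : e + w - Q.recover (e + w) ∈ dualCode Q.C ↔ b = 0 := by
    rw [h1, ZModModule.sub_eq_add, add_right_comm, Submodule.add_mem_iff_right _ h2,
      ← Q.rep_mem_dual_iff b, ← Submodule.add_mem_iff_right _ hw, add_right_comm,
      ZModModule.add_self, zero_add]
  rw [classicalDecode]
  rcases bit_cases b with rfl | rfl
  · rw [if_pos (h3.2 rfl)]
  · rw [if_neg fun h => one_ne_zero (h3.1 h)]

end SelfDualCSS

/-! ### Ciphertext blocks -/

section Block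

variable {m : ℕ}

/-- A block label is given by its three thirds. -/
def blockEquiv (m : ℕ) : BlockLabel m ≃ (Fin m → Bit) × (Fin m → Bit) × (Fin m → Bit) where
  toFun v := (third 0 v, third 1 v, third 2 v)
  invFun p q := (![p.1, p.2.1, p.2.2] : Fin 3 → Fin m → Bit) q.1 q.2
  left_inv v := by
    funext ⟨k, i⟩
    fin_cases k <;> rfl
  right_inv p := rfl

/-- The block label with given thirds. -/
def join (a b c : Fin m → Bit) : BlockLabel m := (blockEquiv m).symm (a, b, c)

theorem third_zero_join (a b c : Fin m → Bit) : third 0 (join a b c) = a := rfl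

theorem third_one_join (a b c : Fin m → Bit) : third 1 (join a b c) = b := rfl

theorem third_two_join (a b c : Fin m → Bit) : third 2 (join a b c) = c := rfl

theorem third_add (k : Fin 3) (v w : BlockLabel m) : third k (v + w) = third k v + third k w := rfl

theorem dotProduct_thirds (v w : BlockLabel m) :
    v ⬝ᵥ w = third 0 v ⬝ᵥ third 0 w + third 1 v ⬝ᵥ third 1 w + third 2 v ⬝ᵥ third 2 w := by
  simp only [dotProduct, Fintype.sum_prod_type, Fin.sum_univ_three]
  rfl

theorem addTraps_apply (v : BlockLabel m) (u : Fin m → Bit) :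
    addTraps m v u = if third 0 v = u ∧ third 1 v = 0 then ((Real.sqrt 2 : ℂ)⁻¹) ^ m else 0 := rfl

theorem sum_addTraps_mul (f : BlockLabel m → ℂ) (u : Fin m → Bit) :
    ∑ v, addTraps m v u * f v = ((Real.sqrt 2 : ℂ)⁻¹) ^ m * ∑ c, f (join u 0 c) := by
  rw [← Equiv.sum_comp (blockEquiv m).symm, Fintype.sum_prod_type,
    Finset.sum_eq_single u, Fintype.sum_prod_type, Finset.sum_eq_single 0, Finset.mul_sum]
  · refine Finset.sum_congr rfl fun c _ => ?_
    change addTraps m (join u 0 c) u * f (join u 0 c) = _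
    rw [addTraps_apply, if_pos ⟨rfl, rfl⟩]
  · intro b _ hb
    refine Finset.sum_eq_zero fun c _ => ?_
    change addTraps m (join u b c) u * f (join u b c) = _
    rw [addTraps_apply, if_neg fun h => hb h.2, zero_mul]
  · simp
  · intro a _ ha
    refine Finset.sum_eq_zero fun p _ => ?_
    change addTraps m (join a p.1 p.2) u * f (join a p.1 p.2) = _
    rw [addTraps_apply, if_neg fun h => ha h.1, zero_mul]
  · simp

theorem star_addTraps (v : BlockLabel m) (u : Fin m → Bit) :
    star (addTraps m v u) = addTraps m v u := by
  rw [addTraps_apply]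
  split_ifs
  · exact star_inv_sqrt_two_pow m
  · exact star_zero _

/-- A Pauli error leaves the traps intact exactly if its `X` part vanishes on the traps `|0⟩` and
its `Z` part on the traps `|+⟩`. -/
theorem addTraps_pauli_addTraps (x z : BlockLabel m) :
    (addTraps m)ᴴ * (pauli x z * addTraps m) =
      if third 1 x = 0 ∧ third 2 z = 0 then pauli (third 0 x) (third 0 z) else 0 := by
  ext u' u
  have hR : (if third 1 x = 0 ∧ third 2 z = 0 then pauli (third 0 x) (third 0 z) else 0) u' u =
      if third 1 x = 0 ∧ third 2 z = 0 then pauli (third 0 x) (third 0 z) u' u else 0 := by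
    split_ifs <;> rfl
  rw [hR, Matrix.mul_apply]
  simp_rw [Matrix.conjTranspose_apply, star_addTraps, pauli_mul_apply]
  rw [sum_addTraps_mul]
  have h : ∀ c, sign (z ⬝ᵥ (join u' 0 c + x)) * addTraps m (join u' 0 c + x) u =
      (if u' + third 0 x = u ∧ third 1 x = 0 then ((Real.sqrt 2 : ℂ)⁻¹) ^ m *
        sign (third 0 z ⬝ᵥ u) * sign (third 2 z ⬝ᵥ third 2 x) else 0) * sign (third 2 z ⬝ᵥ c) := by
    intro c
    rw [addTraps_apply, dotProduct_thirds]
    simp only [third_add, third_zero_join, third_one_join, third_two_join, zero_add]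
    split_ifs with h
    · rw [h.1, h.2, dotProduct_zero, add_zero, dotProduct_add, sign_add, sign_add]
      ring
    · simp
  simp_rw [h]
  rw [← Finset.mul_sum, sum_sign_dotProduct, Fintype.card_fin]
  by_cases h1 : third 1 x = 0
  · by_cases h2 : third 2 z = 0
    · rw [if_pos h2, if_pos (And.intro h1 h2), pauli_apply, h2, zero_dotProduct, sign_zero]
      by_cases h3 : u' + third 0 x = u
      · have h4 : u' = u + third 0 x := by rw [← h3, add_add_self]
        rw [if_pos ⟨h3, h1⟩, if_pos h4]
        have := inv_sqrt_two_pow_mul_self m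
        have h5 : (2⁻¹ : ℂ) ^ m * 2 ^ m = 1 := by rw [← mul_pow]; norm_num
        linear_combination (sign (third 0 z ⬝ᵥ u) * 2 ^ m) * this + sign (third 0 z ⬝ᵥ u) * h5
      · have h4 : u' ≠ u + third 0 x := fun e => h3 (by rw [e, add_add_self])
        rw [if_neg fun h => h3 h.1, if_neg h4]
        simp
    · simp [h2]
  · simp [h1]

theorem addTraps_isometry : (addTraps m)ᴴ * addTraps m = 1 := by
  have := addTraps_pauli_addTraps (m := m) 0 0
  rw [pauli_zero, Matrix.one_mul] at this
  rw [this, if_pos ⟨rfl, rfl⟩]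
  exact pauli_zero

/-- The permutation of the positions that exchanges the two kinds of traps. -/
def swapTraps (m : ℕ) : Equiv.Perm (Pos m) := (Equiv.swap 1 2).prodCongr (Equiv.refl _)

theorem third_swapTraps (v : BlockLabel m) :
    third 0 (permuteWord (swapTraps m)⁻¹ v) = third 0 v ∧
      third 1 (permuteWord (swapTraps m)⁻¹ v) = third 2 v ∧
      third 2 (permuteWord (swapTraps m)⁻¹ v) = third 1 v := by
  refine ⟨rfl, rfl, rfl⟩

/-- A transversal Hadamard gate exchanges the two kinds of traps. -/
theorem hadamardAll_mul_addTraps :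
    hadamardAll (Pos m) * addTraps m =
      permuteU (swapTraps m) * addTraps m * hadamardAll (Fin m) := by
  ext w u
  rw [Matrix.mul_apply, Matrix.mul_assoc, permuteU_mul_apply, Matrix.mul_apply]
  simp_rw [mul_comm (hadamardAll (Pos m) w _)]
  rw [sum_addTraps_mul]
  have h : ∀ c, hadamardAll (Pos m) w (join u 0 c) =
      ((Real.sqrt 2 : ℂ)⁻¹) ^ (3 * m) * sign (third 0 w ⬝ᵥ u) * sign (third 2 w ⬝ᵥ c) := by
    intro c
    rw [hadamardAll_apply, dotProduct_thirds, third_zero_join, third_one_join, third_two_join,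
      dotProduct_zero, add_zero, sign_add, Fintype.card_prod, Fintype.card_fin, Fintype.card_fin]
    ring
  simp_rw [h]
  rw [← Finset.mul_sum, sum_sign_dotProduct, Finset.sum_eq_single (third 0 w)]
  · rw [addTraps_apply, hadamardAll_apply, (third_swapTraps w).1, (third_swapTraps w).2.1,
      Fintype.card_fin]
    by_cases h2 : third 2 w = 0
    · rw [if_pos h2, if_pos ⟨rfl, h2⟩, mul_comm 3 m, pow_mul]
      have h5 : (((Real.sqrt 2 : ℂ)⁻¹) ^ m * ((Real.sqrt 2 : ℂ)⁻¹) ^ m) * 2 ^ m = 1 := by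
        rw [inv_sqrt_two_pow_mul_self, ← mul_pow]; norm_num
      linear_combination ((Real.sqrt 2 : ℂ)⁻¹) ^ m * ((Real.sqrt 2 : ℂ)⁻¹) ^ m *
        sign (third 0 w ⬝ᵥ u) * h5
    · rw [if_neg h2, if_neg fun h => h2 h.2]
      simp
  · intro v _ hv
    rw [addTraps_apply, (third_swapTraps w).1, if_neg fun h => hv h.1.symm, zero_mul]
  · simp

theorem single_mul_pauli {ι : Type} [Fintype ι] [DecidableEq ι] (w x z : ι → Bit) :
    Matrix.single w w (1 : ℂ) * pauli x z = pauli x z * Matrix.single (w + x) (w + x) 1 := by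
  ext u v
  rw [mul_pauli_apply, pauli_mul_apply, Matrix.single_apply, Matrix.single_apply]
  by_cases h1 : w = u
  · subst h1
    by_cases h2 : w = v + x
    · simp [h2, add_add_self]
    · have h3 : w + x ≠ v := fun e => h2 (by rw [← e, add_add_self])
      simp [h2, h3]
  · have : ¬ (w + x = u + x ∧ w + x = v) := fun h => h1 (add_right_cancel h.1)
    simp [h1]

/-- Conjugation of a product of two Pauli operators by `CNOT`, entry by entry. -/
theorem pauli_cnot (xi zi xj zj ui uj vi vj : BlockLabel m) :
    pauli xi zi ui vi * pauli xj zj (uj + ui) vj =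
      pauli xi (zi + zj) ui vi * pauli (xi + xj) zj uj (vj + vi) := by
  simp only [pauli_apply]
  by_cases h : ui = vi + xi
  · subst h
    rw [if_pos rfl, if_pos rfl]
    have : uj + (vi + xi) = vj + xj ↔ uj = vj + vi + (xi + xj) := by
      constructor
      · intro e
        have : uj = uj + (vi + xi) + (vi + xi) := (add_add_self _ _).symm
        rw [this, e]
        abel
      · rintro rfl
        have : vj + vi + (xi + xj) + (vi + xi) = vj + xj + (vi + xi) + (vi + xi) := by abel
        rw [this, add_add_self]
    simp only [this]
    split_ifs
    · rw [add_dotProduct, dotProduct_add, sign_add, sign_add]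
      linear_combination (-(sign (zi ⬝ᵥ vi) * sign (zj ⬝ᵥ vj))) * sign_mul_self (zj ⬝ᵥ vi)
    · simp
  · simp [h]

end Block

namespace TC

variable {m t n : ℕ} (Q : SelfDualCSS m t)

open SelfDualCSS

/-- Encryption of one qubit without the one-time pad. -/
def encBlock (π : Equiv.Perm (Pos m)) : Matrix (BlockLabel m) Bit ℂ :=
  permuteU π * addTraps m * Q.encode

theorem encQubit_eq (π : Equiv.Perm (Pos m)) (x z : BlockLabel m) :
    encQubit Q π x z = pauli x z * encBlock Q π := by
  simp only [encQubit, pauli, encBlock, Matrix.mul_assoc]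

theorem encBlock_isometry (π : Equiv.Perm (Pos m)) : (encBlock Q π)ᴴ * encBlock Q π = 1 := by
  have h : (permuteU π)ᴴ * permuteU π = 1 := by
    rw [permuteU_conjTranspose, permuteU_mul, inv_mul_cancel, permuteU_one]
  rw [encBlock, Matrix.conjTranspose_mul, Matrix.conjTranspose_mul]
  calc _ = Q.encodeᴴ * ((addTraps m)ᴴ * ((permuteU π)ᴴ * permuteU π) * addTraps m) * Q.encode := by
        simp only [Matrix.mul_assoc]
    _ = 1 := by rw [h, Matrix.mul_one, addTraps_isometry, Matrix.mul_one, encode_isometry]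

/-- A transversal Hadamard gate is the logical Hadamard gate, up to an exchange of the traps. -/
theorem hadamardAll_mul_encBlock (π : Equiv.Perm (Pos m)) :
    hadamardAll (Pos m) * encBlock Q π = encBlock Q (π * swapTraps m) * bitH := by
  rw [encBlock, encBlock, ← permuteU_mul, ← Matrix.mul_assoc, ← Matrix.mul_assoc,
    hadamardAll_mul_permuteU, Matrix.mul_assoc (permuteU π), hadamardAll_mul_addTraps]
  simp only [Matrix.mul_assoc]
  rw [Q.hadamardAll_mul_encode]

theorem encBlock_apply (π : Equiv.Perm (Pos m)) (w : BlockLabel m) (b : Bit) :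
    encBlock Q π w b = if third 1 (permuteWord π⁻¹ w) = 0 then
      ((Real.sqrt 2 : ℂ)⁻¹) ^ m * Q.encode (third 0 (permuteWord π⁻¹ w)) b else 0 := by
  rw [encBlock, Matrix.mul_assoc, permuteU_mul_apply, Matrix.mul_apply,
    Finset.sum_eq_single (third 0 (permuteWord π⁻¹ w))]
  · rw [addTraps_apply]
    simp
  · intro u _ hu
    rw [addTraps_apply, if_neg fun h => hu h.1.symm, zero_mul]
  · simp

theorem encBlock_ne_zero {π : Equiv.Perm (Pos m)} {w : BlockLabel m} {b : Bit}
    (h : encBlock Q π w b ≠ 0) : third 1 (permuteWord π⁻¹ w) = 0 ∧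
      third 0 (permuteWord π⁻¹ w) + rep m b ∈ dualCode Q.C := by
  rw [encBlock_apply] at h
  split_ifs at h with h1
  · refine ⟨h1, ?_⟩
    rw [encode_apply] at h
    by_contra h2
    simp [h2] at h
  · exact absurd rfl h

theorem encBlock_cnot (π : Equiv.Perm (Pos m)) (ui uj : BlockLabel m) (bi bj : Bit) :
    encBlock Q π ui bi * encBlock Q π (uj + ui) bj =
      encBlock Q π ui bi * encBlock Q π uj (bj + bi) := by
  classical
  by_cases h : encBlock Q π ui bi = 0
  · rw [h, zero_mul, zero_mul]
  · obtain ⟨h1, h2⟩ := encBlock_ne_zero Q h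
    refine congrArg (encBlock Q π ui bi * ·) ?_
    rw [encBlock_apply, encBlock_apply, permuteWord_add, third_add, third_add, h1, add_zero,
      encode_apply, encode_apply]
    have : third 0 (permuteWord π⁻¹ uj) + third 0 (permuteWord π⁻¹ ui) + rep m bj =
        third 0 (permuteWord π⁻¹ uj) + rep m (bj + bi) +
          (third 0 (permuteWord π⁻¹ ui) + rep m bi) := by
      rw [rep_add]
      have h3 : third 0 (permuteWord π⁻¹ uj) + (rep m bj + rep m bi) +
          (third 0 (permuteWord π⁻¹ ui) + rep m bi) =
          third 0 (permuteWord π⁻¹ uj) + third 0 (permuteWord π⁻¹ ui) + rep m bj +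
            rep m bi + rep m bi := by abel
      rw [h3, add_add_self]
    rw [this]
    simp only [Q.add_mem_dual_iff h2]

/-- Paulis on the data qubits. -/
theorem pauli_mul_addTraps (x z : Fin m → Bit) :
    pauli (join x 0 0) (join z 0 0) * addTraps m = addTraps m * pauli x z := by
  ext v u
  rw [pauli_mul_apply, mul_pauli_apply, addTraps_apply, addTraps_apply, dotProduct_thirds]
  simp only [third_add, third_zero_join, third_one_join, third_two_join, zero_dotProduct, add_zero]
  by_cases h : third 0 v + x = u
  · subst h
    simp [add_add_self, mul_comm]
  · have : third 0 v ≠ u + x := fun e => h (by rw [e, add_add_self])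
    simp [h, this]

theorem dataOnes_eq : dataOnes m = join (rep m 1) 0 0 := by
  funext ⟨k, i⟩
  fin_cases k <;> rfl

theorem join_zero : join (0 : Fin m → Bit) 0 0 = 0 := by
  funext ⟨k, i⟩
  fin_cases k <;> rfl

theorem pauli_mul_encBlock (π : Equiv.Perm (Pos m)) (x z : Fin m → Bit) :
    pauli (permuteWord π (join x 0 0)) (permuteWord π (join z 0 0)) * encBlock Q π =
      permuteU π * addTraps m * (pauli x z * Q.encode) := by
  rw [encBlock, ← Matrix.mul_assoc, ← Matrix.mul_assoc, pauli_mul_permuteU,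
    permuteWord_inv_permuteWord, permuteWord_inv_permuteWord, Matrix.mul_assoc (permuteU π),
    pauli_mul_addTraps]
  simp only [Matrix.mul_assoc]

theorem logicalX (π : Equiv.Perm (Pos m)) :
    pauli (permuteWord π (dataOnes m)) 0 * encBlock Q π = encBlock Q π * bitX := by
  have h : Q.encode * bitX = pauli (rep m 1) 0 * Q.encode := by
    ext u b
    have h1 : ∀ c : Bit, c = b + 1 ↔ b = c + 1 := by
      revert b; decide
    rw [pauli_mul_apply, zero_dotProduct, sign_zero, one_mul, Matrix.mul_apply,
      Finset.sum_eq_single (b + 1)]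
    · rw [bitX, Matrix.of_apply, if_pos rfl, mul_one, encode_apply, encode_apply, add_assoc u,
        rep_add, add_comm (rep m b)]
    · intro c _ hc
      rw [bitX, Matrix.of_apply, if_neg hc, mul_zero]
    · simp
  have := pauli_mul_encBlock Q π (rep m 1) 0
  rw [join_zero, ← dataOnes_eq, ← h] at this
  rw [encBlock, Matrix.mul_assoc _ Q.encode, ← this]
  rfl

theorem logicalZ (π : Equiv.Perm (Pos m)) :
    pauli 0 (permuteWord π (dataOnes m)) * encBlock Q π = encBlock Q π * bitZ := by
  have h : Q.encode * bitZ = pauli 0 (rep m 1) * Q.encode := by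
    ext u b
    rw [pauli_mul_apply, bitZ, Matrix.mul_diagonal, add_zero, encode_apply]
    split_ifs with hu
    · have : u = (u + rep m b) + rep m b := (add_add_self _ _).symm
      rw [this, dotProduct_add, dotProduct_comm, Q.dot_eq_zero hu Q.one_mem, dotProduct_comm,
        Q.rep_dot_rep_one, zero_add, mul_comm]
    · simp
  have := pauli_mul_encBlock Q π 0 (rep m 1)
  rw [join_zero, ← dataOnes_eq, ← h] at this
  rw [encBlock, Matrix.mul_assoc _ Q.encode, ← this]
  rfl

theorem hammingNorm_third_le (π : Equiv.Perm (Pos m)) (k : Fin 3) (v : BlockLabel m) :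
    hammingNorm (third k (permuteWord π⁻¹ v)) ≤ hammingNorm v := by
  refine Finset.card_le_card_of_injOn (fun i => π (k, i)) ?_ ?_
  · intro i hi
    simp only [Finset.coe_filter, Finset.mem_univ, true_and, Set.mem_ofPred_eq] at hi ⊢
    exact hi
  · intro i _ j _ h
    simpa using h

/-- The Kraus operators of the decryption of an unmeasured qubit, without the one-time pad. -/
def decBlock (π : Equiv.Perm (Pos m)) (e f : Fin m → Bit) : Matrix Bit (BlockLabel m) ℂ :=
  Q.decode e f * (addTraps m)ᴴ * permuteU π⁻¹

theorem verDecQubit_eq (π : Equiv.Perm (Pos m)) (x z : BlockLabel m) :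
    verDecQubit Q π x z =
      ∑ e ∈ Finset.univ.image Q.recover, ∑ f ∈ Finset.univ.image Q.recover,
        conj (decBlock Q π e f * pauli x z) := by
  refine Finset.sum_congr rfl fun e _ => Finset.sum_congr rfl fun f _ => ?_
  have : (pauliX x * pauliZ z)ᴴ = sign (z ⬝ᵥ x) • pauli x z := pauli_conjTranspose x z
  rw [this, Matrix.mul_smul, conj_smul_of_norm _ (sign_mul_star _)]
  rfl

theorem conj_mul_pauli_comp {D : Type} (K : Matrix D (BlockLabel m) ℂ)
    (x z x' z' : BlockLabel m) :
    conj (K * pauli x z) ∘ₗ conj (pauli x' z') = conj (K * pauli (x + x') (z + z')) := by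
  rw [conj_comp, Matrix.mul_assoc, pauli_mul_pauli, Matrix.mul_smul,
    conj_smul_of_norm _ (sign_mul_star _)]

theorem verDecQubit_comp_pauli (π : Equiv.Perm (Pos m)) (x z x' z' : BlockLabel m) :
    verDecQubit Q π x z ∘ₗ conj (pauli x' z') = verDecQubit Q π (x + x') (z + z') := by
  rw [verDecQubit_eq, verDecQubit_eq, sum_linearMap_comp]
  refine Finset.sum_congr rfl fun e _ => ?_
  rw [sum_linearMap_comp]
  exact Finset.sum_congr rfl fun f _ => conj_mul_pauli_comp _ _ _ _ _

theorem decBlock_mul_pauli_mul_encBlock (π : Equiv.Perm (Pos m)) (e f : Fin m → Bit)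
    (x z : BlockLabel m) :
    decBlock Q π e f * pauli x z * encBlock Q π =
      if third 1 (permuteWord π⁻¹ x) = 0 ∧ third 2 (permuteWord π⁻¹ z) = 0 then
        Q.decode e f * (pauli (third 0 (permuteWord π⁻¹ x)) (third 0 (permuteWord π⁻¹ z)) *
          Q.encode) else 0 := by
  have h : permuteU π⁻¹ * (pauli x z * permuteU π) =
      pauli (permuteWord π⁻¹ x) (permuteWord π⁻¹ z) := by
    rw [pauli_mul_permuteU, ← Matrix.mul_assoc, permuteU_mul, inv_mul_cancel, permuteU_one,
      Matrix.one_mul]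
  calc _ = Q.decode e f * ((addTraps m)ᴴ * ((permuteU π⁻¹ * (pauli x z * permuteU π)) *
        addTraps m)) * Q.encode := by
        simp only [decBlock, encBlock, Matrix.mul_assoc]
    _ = _ := by
        rw [h, addTraps_pauli_addTraps]
        split_ifs
        · rw [Matrix.mul_assoc]
        · rw [Matrix.mul_zero, Matrix.zero_mul]

/-- An unmeasured qubit with a detected error is rejected. -/
theorem verDecQubit_comp_encBlock_eq_zero (π : Equiv.Perm (Pos m)) (x z : BlockLabel m)
    (h : third 1 (permuteWord π⁻¹ x) ≠ 0 ∨ third 2 (permuteWord π⁻¹ z) ≠ 0) :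
    verDecQubit Q π x z ∘ₗ conj (encBlock Q π) = 0 := by
  rw [verDecQubit_eq, sum_linearMap_comp]
  refine Finset.sum_eq_zero fun e _ => ?_
  rw [sum_linearMap_comp]
  refine Finset.sum_eq_zero fun f _ => ?_
  rw [conj_comp, decBlock_mul_pauli_mul_encBlock, if_neg (by tauto), conj_zero]

/-- An undetected error of small weight on an unmeasured qubit is corrected. -/
theorem verDecQubit_comp_encBlock (π : Equiv.Perm (Pos m)) (x z : BlockLabel m)
    (hx : third 1 (permuteWord π⁻¹ x) = 0) (hz : third 2 (permuteWord π⁻¹ z) = 0)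
    (hx' : hammingNorm x ≤ t) (hz' : hammingNorm z ≤ t) :
    verDecQubit Q π x z ∘ₗ conj (encBlock Q π) = LinearMap.id := by
  rw [← Q.sum_conj_decode ((hammingNorm_third_le π 0 x).trans hx')
    ((hammingNorm_third_le π 0 z).trans hz'), verDecQubit_eq, sum_linearMap_comp]
  refine Finset.sum_congr rfl fun e _ => ?_
  rw [sum_linearMap_comp]
  refine Finset.sum_congr rfl fun f _ => ?_
  rw [conj_comp, decBlock_mul_pauli_mul_encBlock, if_pos ⟨hx, hz⟩]

/-- Reading a block in the Hadamard basis is reading it in the computational basis with the roles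
of the two kinds of traps and of the two parts of the key exchanged. -/
theorem verDecMeasurement_hada (π : Equiv.Perm (Pos m)) (x z w : BlockLabel m) :
    verDecMeasurement Q π x z w .hada =
      verDecMeasurement Q (π * swapTraps m) z x w .comp := rfl

/-- A measured block with a detected error is rejected. -/
theorem encBlock_eq_zero_of_detected {π : Equiv.Perm (Pos m)} {x z w : BlockLabel m} {r : Bit}
    (hx : third 1 (permuteWord π⁻¹ x) ≠ 0)
    (hr : verDecMeasurement Q π x z w .comp = some r) (b : Bit) : encBlock Q π w b = 0 := by
  by_contra h
  obtain ⟨h1, -⟩ := encBlock_ne_zero Q h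
  simp only [verDecMeasurement, permuteWord_add, third_add, h1, add_zero, hx, if_false] at hr
  exact absurd hr (by simp)

/-- An undetected error of small weight on a measured block is corrected. -/
theorem verDecMeasurement_eq_some {π : Equiv.Perm (Pos m)} {x z w : BlockLabel m} {b : Bit}
    (hx : third 1 (permuteWord π⁻¹ x) = 0) (hx' : hammingNorm x ≤ t)
    (h : encBlock Q π w b ≠ 0) : verDecMeasurement Q π x z w .comp = some b := by
  obtain ⟨h1, h2⟩ := encBlock_ne_zero Q h
  simp only [verDecMeasurement, permuteWord_add, third_add, h1, hx, add_zero, if_true]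
  rw [Q.classicalDecode_eq b ((hammingNorm_third_le π 0 x).trans hx') h2]

end TC

/-! ### Verified decryption after the honest evaluation -/

namespace TC

variable {m t n : ℕ} (Q : SelfDualCSS m t)

/-- The change of basis of the block before a measurement. -/
def measH (m : ℕ) : MeasBasis → Matrix (BlockLabel m) (BlockLabel m) ℂ
  | .comp => 1
  | .hada => hadamardAll (Pos m)

/-- The change of basis of the logical qubit before a measurement. -/
def bitMeasH : MeasBasis → Matrix Bit Bit ℂ
  | .comp => 1
  | .hada => bitH

/-- The honest evaluation of a circuit without its final measurements.  This is one fixed Clifford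
operation, since no gate acts on a measured wire and the Pauli gates are left to the decryption. -/
def evalU : List (Gate n) → Matrix (Fin n → BlockLabel m) (Fin n → BlockLabel m) ℂ
  | [] => 1
  | .X _ _ :: gs => evalU gs
  | .Z _ _ :: gs => evalU gs
  | .cnot i j :: gs => evalU gs * cnotU i j
  | .meas b i :: gs => evalU gs * onWire i (measH m b)

/-- The accepting branch of the verified decryption, preceded by the honest evaluation.  The
evaluation is distributed over the gates, so that each gate is evaluated and then decrypted. -/
def evalAccept (π : Equiv.Perm (Pos m)) :
    List (Gate n) → (x z : Fin n → BlockLabel m) → Finset (Fin n) → (Fin n → Bit) →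
      SuperOp (Fin n → BlockLabel m) (Fin n → Bit)
  | [], x, z, M, a =>
      SuperOp.tensor fun i =>
        if i ∈ M then discardPrepare (Matrix.single (a i) (a i) 1)
        else verDecQubit Q π (x i) (z i)
  | .X f i :: gs, x, z, M, a =>
      evalAccept π gs
        (if f a then Function.update x i (x i + permuteWord π (dataOnes m)) else x) z M a
  | .Z f i :: gs, x, z, M, a =>
      evalAccept π gs
        x (if f a then Function.update z i (z i + permuteWord π (dataOnes m)) else z) M a
  | .cnot i j :: gs, x, z, M, a =>
      evalAccept π gs (Function.update x j (x i + x j)) (Function.update z i (z i + z j)) M a ∘ₗ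
        conj (cnotU i j)
  | .meas b i :: gs, x, z, M, a =>
      ∑ w : BlockLabel m, (verDecMeasurement Q π (x i) (z i) w b).elim 0 fun r =>
        evalAccept π gs x z (insert i M) (Function.update a i r) ∘ₗ
          conj (onWire i (Matrix.single w w 1 * measH m b))

theorem evalU_comm_onWire (gs : List (Gate n)) (M : Finset (Fin n)) (h : WellFormed M gs)
    {i : Fin n} (hi : i ∈ M) (K : Matrix (BlockLabel m) (BlockLabel m) ℂ) :
    evalU gs * onWire i K = onWire i K * evalU gs := by
  induction gs generalizing M with
  | nil => simp [evalU]
  | cons g gs ih =>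
    cases g with
    | X f k => exact ih M h.2 hi
    | Z f k => exact ih M h.2 hi
    | cnot k l =>
      obtain ⟨hkl, hk, hl, h⟩ := h
      have h1 : i ≠ k := fun e => hk (e ▸ hi)
      have h2 : i ≠ l := fun e => hl (e ▸ hi)
      rw [evalU, Matrix.mul_assoc, cnotU_comm_onWire hkl h1 h2, ← Matrix.mul_assoc, ih M h hi,
        Matrix.mul_assoc]
    | meas b k =>
      have h1 : k ≠ i := fun e => h.1 (e ▸ hi)
      rw [evalU, Matrix.mul_assoc, onWire_comm h1, ← Matrix.mul_assoc,
        ih (insert k M) h.2 (Finset.mem_insert_of_mem hi), Matrix.mul_assoc]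

theorem measH_unitary (b : MeasBasis) : (measH m b)ᴴ * measH m b = 1 := by
  cases b
  · simp [measH]
  · rw [measH, hadamardAll_conjTranspose, hadamardAll_mul_self]

theorem evalU_unitary (gs : List (Gate n)) (M : Finset (Fin n)) (h : WellFormed M gs) :
    (evalU gs)ᴴ * evalU (m := m) gs = 1 := by
  induction gs generalizing M with
  | nil => simp [evalU]
  | cons g gs ih =>
    cases g with
    | X f k => exact ih M h.2
    | Z f k => exact ih M h.2
    | cnot k l =>
      rw [evalU, Matrix.conjTranspose_mul, Matrix.mul_assoc, ← Matrix.mul_assoc _ (evalU gs),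
        ih M h.2.2.2, Matrix.one_mul, cnotU_conjTranspose h.1, cnotU_mul_self h.1]
    | meas b k =>
      rw [evalU, Matrix.conjTranspose_mul, Matrix.mul_assoc, ← Matrix.mul_assoc _ (evalU gs),
        ih (insert k M) h.2, Matrix.one_mul, onWire_conjTranspose, onWire_mul, measH_unitary,
        onWire_one]

/-- The measured blocks are not touched any more, so that each gate of the evaluation can be moved
to the step in which it is decrypted. -/
theorem accept_comp_evalU (π : Equiv.Perm (Pos m)) (gs : List (Gate n))
    (x z : Fin n → BlockLabel m) (M : Finset (Fin n)) (a : Fin n → Bit) (h : WellFormed M gs) :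
    accept Q π gs x z M a ∘ₗ conj (evalU gs) = evalAccept Q π gs x z M a := by
  induction gs generalizing x z M a with
  | nil => rw [evalU, conj_one]; rfl
  | cons g gs ih =>
    cases g with
    | X f k => exact ih _ _ M a h.2
    | Z f k => exact ih _ _ M a h.2
    | cnot k l =>
      rw [evalU, evalAccept, ← conj_comp, ← LinearMap.comp_assoc, ← ih _ _ M a h.2.2.2]
      rfl
    | meas b k =>
      rw [evalU, evalAccept, accept, sum_linearMap_comp]
      refine Finset.sum_congr rfl fun w _ => ?_
      cases verDecMeasurement Q π (x k) (z k) w b with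
      | none => rfl
      | some r =>
        simp only [Option.elim]
        rw [← ih _ _ _ _ h.2, LinearMap.comp_assoc, LinearMap.comp_assoc, conj_comp, conj_comp,
          ← Matrix.mul_assoc, ← evalU_comm_onWire gs _ h.2 (Finset.mem_insert_self k M),
          Matrix.mul_assoc, onWire_mul]

theorem conj_comp_sum_conj {A κ : Type} [Fintype A] [Fintype κ] (K : Matrix A A ℂ)
    (L : κ → Matrix A A ℂ) (h : ∀ k, K * L k = L k * K) :
    conj K ∘ₗ ∑ k, conj (L k) = (∑ k, conj (L k)) ∘ₗ conj K := by
  rw [sum_linearMap_comp, linearMap_comp_sum]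
  refine Finset.sum_congr rfl fun k _ => ?_
  rw [conj_comp, conj_comp, h]

/-- The decryption ignores what happens to a wire after its measurement. -/
theorem evalAccept_comp_sum_conj (π : Equiv.Perm (Pos m)) (gs : List (Gate n))
    (x z : Fin n → BlockLabel m) (M : Finset (Fin n)) (a : Fin n → Bit) (h : WellFormed M gs)
    {i : Fin n} (hi : i ∈ M) {κ : Type} [Fintype κ]
    (K : κ → Matrix (BlockLabel m) (BlockLabel m) ℂ) (hK : ∑ k, (K k)ᴴ * K k = 1) :
    evalAccept Q π gs x z M a ∘ₗ ∑ k, conj (onWire i (K k)) = evalAccept Q π gs x z M a := by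
  induction gs generalizing x z M a with
  | nil =>
    simp_rw [onWire_eq_tensM]
    refine tensor_comp_sum_conj _ i K ?_
    rw [if_pos hi]
    exact discardPrepare_comp_sum_conj _ K hK
  | cons g gs ih =>
    cases g with
    | X f k => exact ih _ _ M a h.2 hi
    | Z f k => exact ih _ _ M a h.2 hi
    | cnot k l =>
      obtain ⟨hkl, hk, hl, h⟩ := h
      have h1 : i ≠ k := fun e => hk (e ▸ hi)
      have h2 : i ≠ l := fun e => hl (e ▸ hi)
      rw [evalAccept, LinearMap.comp_assoc,
        conj_comp_sum_conj _ _ fun j => cnotU_comm_onWire hkl h1 h2 (K j),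
        ← LinearMap.comp_assoc, ih _ _ M a h hi]
    | meas b k =>
      have h1 : k ≠ i := fun e => h.1 (e ▸ hi)
      rw [evalAccept, sum_linearMap_comp]
      refine Finset.sum_congr rfl fun w _ => ?_
      cases verDecMeasurement Q π (x k) (z k) w b with
      | none => rfl
      | some r =>
        simp only [Option.elim]
        rw [LinearMap.comp_assoc, conj_comp_sum_conj _ _ fun j => onWire_comm h1 _ (K j),
          ← LinearMap.comp_assoc, ih _ _ _ _ h.2 (Finset.mem_insert_of_mem hi)]

/-- A unitary on a wire that is already measured does not matter. -/
theorem evalAccept_comp_unitary (π : Equiv.Perm (Pos m)) (gs : List (Gate n))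
    (x z : Fin n → BlockLabel m) (M : Finset (Fin n)) (a : Fin n → Bit) (h : WellFormed M gs)
    {i : Fin n} (hi : i ∈ M) {A : Type} [Fintype A] (K : Fin n → Matrix (BlockLabel m) A ℂ)
    (V : Matrix (BlockLabel m) (BlockLabel m) ℂ) (hV : Vᴴ * V = 1)
    (L : Matrix (BlockLabel m) A ℂ) :
    evalAccept Q π gs x z M a ∘ₗ conj (tensM (Function.update K i (V * L))) =
      evalAccept Q π gs x z M a ∘ₗ conj (tensM (Function.update K i L)) := by
  have h1 := evalAccept_comp_sum_conj Q π gs x z M a h hi (fun _ : Unit => V) (by simpa using hV)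
  rw [Fintype.sum_unique] at h1
  conv_rhs => rw [← h1, LinearMap.comp_assoc, conj_comp, onWire_mul_tensM]
  simp

/-- The state of a wire that is already measured may be replaced by any other pure state. -/
theorem evalAccept_comp_rankOne (π : Equiv.Perm (Pos m)) (gs : List (Gate n))
    (x z : Fin n → BlockLabel m) (M : Finset (Fin n)) (a : Fin n → Bit) (h : WellFormed M gs)
    {i : Fin n} (hi : i ∈ M) {A : Type} [Fintype A] (K : Fin n → Matrix (BlockLabel m) A ℂ)
    (w : BlockLabel m) (ψ : BlockLabel m → ℂ) (hψ : star ψ ⬝ᵥ ψ = 1) (ρ : A → ℂ) :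
    evalAccept Q π gs x z M a ∘ₗ
        conj (tensM (Function.update K i (vecMulVec (Pi.single w 1) ρ))) =
      evalAccept Q π gs x z M a ∘ₗ conj (tensM (Function.update K i (vecMulVec ψ ρ))) := by
  have hc : ∑ w' : BlockLabel m,
      (vecMulVec ψ (Pi.single w' (1 : ℂ)))ᴴ * vecMulVec ψ (Pi.single w' (1 : ℂ)) = 1 := by
    ext u v
    simp only [Matrix.sum_apply, conjTranspose_vecMulVec, vecMulVec_mul_vecMulVec, hψ, one_smul,
      vecMulVec_apply, Pi.star_apply]
    rw [Matrix.one_apply, Finset.sum_eq_single u]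
    · simp [Pi.single_apply, eq_comm]
    · intro b _ hb
      simp [Pi.single_apply, hb.symm]
    · simp
  have h1 := evalAccept_comp_sum_conj Q π gs x z M a h hi _ hc
  conv_lhs => rw [← h1, LinearMap.comp_assoc, sum_linearMap_comp]
  rw [Finset.sum_eq_single w]
  · rw [conj_comp, onWire_mul_tensM]
    simp [vecMulVec_mul_vecMulVec]
  · intro w' _ hw
    rw [conj_comp, onWire_mul_tensM, Function.update_self, vecMulVec_mul_vecMulVec]
    have : Pi.single w' (1 : ℂ) ⬝ᵥ Pi.single w 1 = 0 := by simp [hw]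
    rw [this, tensM_eq_zero _ i (by ext u v; simp [vecMulVec_apply]), conj_zero]
  · simp

theorem verDecMeasurement_add_comp (π : Equiv.Perm (Pos m)) (x z x' z' w : BlockLabel m) :
    verDecMeasurement Q π (x + x') (z + z') w .comp =
      verDecMeasurement Q π x z (w + x') .comp := by
  simp only [verDecMeasurement, add_assoc, add_comm x']

theorem verDecMeasurement_add_hada (π : Equiv.Perm (Pos m)) (x z x' z' w : BlockLabel m) :
    verDecMeasurement Q π (x + x') (z + z') w .hada =
      verDecMeasurement Q π x z (w + z') .hada := by
  simp only [verDecMeasurement, add_assoc, add_comm z']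

/-- A measurement commutes with a Pauli operator, up to a shift of its outcome and a Pauli operator
after the measurement. -/
theorem exists_pauli_measurement (b : MeasBasis) (x z : BlockLabel m) :
    ∃ s x' z' : BlockLabel m, ∃ c : ℂ, c * star c = 1 ∧
      (∀ (π : Equiv.Perm (Pos m)) (x₀ z₀ w : BlockLabel m),
        verDecMeasurement Q π (x₀ + x) (z₀ + z) w b = verDecMeasurement Q π x₀ z₀ (w + s) b) ∧
      ∀ w, Matrix.single (w + s) (w + s) 1 * measH m b * pauli x z =
        c • (pauli x' z' * (Matrix.single w w 1 * measH m b)) := by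
  cases b with
  | comp =>
    refine ⟨x, x, z, 1, by simp, fun _ _ _ _ => verDecMeasurement_add_comp Q _ _ _ _ _ _, ?_⟩
    intro w
    simp only [measH, Matrix.mul_one]
    rw [single_mul_pauli, add_add_self, one_smul]
  | hada =>
    refine ⟨z, z, x, sign (z ⬝ᵥ x), sign_mul_star _,
      fun _ _ _ _ => verDecMeasurement_add_hada Q _ _ _ _ _ _, ?_⟩
    intro w
    simp only [measH]
    rw [Matrix.mul_assoc, hadamardAll_mul_pauli, Matrix.mul_smul, ← Matrix.mul_assoc,
      single_mul_pauli, add_add_self, Matrix.mul_assoc]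

theorem update_add_update (x x' : Fin n → BlockLabel m) (i : Fin n) (u v : BlockLabel m) :
    Function.update x i u + Function.update x' i v = Function.update (x + x') i (u + v) := by
  funext k
  by_cases h : k = i
  · subst h; simp
  · simp [Function.update_of_ne h]

theorem tensM_update_smul {A B : Type} (K : Fin n → Matrix B A ℂ) (i : Fin n) (c : ℂ)
    (L : Matrix B A ℂ) :
    tensM (Function.update K i (c • L)) = c • tensM (Function.update K i L) := by
  ext u v
  rw [Matrix.smul_apply, tensM_apply, tensM_apply,
    ← Finset.mul_prod_erase _ _ (Finset.mem_univ i),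
    ← Finset.mul_prod_erase _ _ (Finset.mem_univ i), Function.update_self, Function.update_self,
    Matrix.smul_apply, smul_eq_mul, smul_eq_mul, mul_assoc]
  congr 2
  refine Finset.prod_congr rfl fun k hk => ?_
  rw [Function.update_of_ne (Finset.ne_of_mem_erase hk),
    Function.update_of_ne (Finset.ne_of_mem_erase hk)]

/-- Adding to the keys of the one-time pad undoes a Pauli operator on the ciphertext. -/
theorem evalAccept_add (π : Equiv.Perm (Pos m)) (gs : List (Gate n))
    (x z x' z' : Fin n → BlockLabel m) (M : Finset (Fin n)) (a : Fin n → Bit)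
    (h : WellFormed M gs) :
    evalAccept Q π gs (x + x') (z + z') M a =
      evalAccept Q π gs x z M a ∘ₗ conj (tensM fun k => pauli (x' k) (z' k)) := by
  induction gs generalizing x z x' z' M a with
  | nil =>
    rw [evalAccept, evalAccept, tensor_comp_conj]
    refine congrArg SuperOp.tensor (funext fun k => ?_)
    split_ifs
    · have := discardPrepare_comp_sum_conj (Matrix.single (a k) (a k) 1)
        (fun _ : Unit => pauli (x' k) (z' k)) (by simp [pauli_unitary])
      rw [Fintype.sum_unique] at this
      exact this.symm
    · exact (verDecQubit_comp_pauli Q π _ _ _ _).symm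
  | cons g gs ih =>
    cases g with
    | X f i =>
      have hx : (if f a then Function.update (x + x') i ((x + x') i +
          permuteWord π (dataOnes m)) else x + x') =
          (if f a then Function.update x i (x i + permuteWord π (dataOnes m)) else x) + x' := by
        split_ifs
        · nth_rewrite 3 [← Function.update_eq_self i x']
          rw [update_add_update, Pi.add_apply, add_right_comm]
        · rfl
      rw [evalAccept, evalAccept, ← ih _ _ _ _ M a h.2, hx]
    | Z f i =>
      have hz : (if f a then Function.update (z + z') i ((z + z') i +
          permuteWord π (dataOnes m)) else z + z') =
          (if f a then Function.update z i (z i + permuteWord π (dataOnes m)) else z) + z' := by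
        split_ifs
        · nth_rewrite 3 [← Function.update_eq_self i z']
          rw [update_add_update, Pi.add_apply, add_right_comm]
        · rfl
      rw [evalAccept, evalAccept, ← ih _ _ _ _ M a h.2, hz]
    | cnot i j =>
      obtain ⟨hij, -, -, h⟩ := h
      have hx : Function.update (x + x') j ((x + x') i + (x + x') j) =
          Function.update x j (x i + x j) + Function.update x' j (x' i + x' j) := by
        rw [update_add_update, Pi.add_apply, Pi.add_apply, add_add_add_comm]
      have hz : Function.update (z + z') i ((z + z') i + (z + z') j) =
          Function.update z i (z i + z j) + Function.update z' i (z' i + z' j) := by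
        rw [update_add_update, Pi.add_apply, Pi.add_apply, add_add_add_comm]
      rw [evalAccept, evalAccept, hx, hz, ih _ _ _ _ M a h, LinearMap.comp_assoc,
        LinearMap.comp_assoc, conj_comp, conj_comp]
      refine congrArg (evalAccept Q π gs _ _ M a ∘ₗ conj ·)
        (cnotU_mul_tensM hij _ _ (fun k hi hj => ?_) fun ui uj vi vj => ?_).symm
      · rw [Function.update_of_ne hi, Function.update_of_ne hj]
      · simp only [Function.update_self, Function.update_of_ne hij, Function.update_of_ne hij.symm]
        exact pauli_cnot _ _ _ _ _ _ _ _
    | meas b i =>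
      obtain ⟨s, x₁, z₁, c, hc, hs, hP⟩ := exists_pauli_measurement Q b (x' i) (z' i)
      rw [evalAccept, evalAccept, sum_linearMap_comp, ← Equiv.sum_comp (Equiv.addRight s)
        (fun w => Option.elim (verDecMeasurement Q π (x i) (z i) w b) 0 _ ∘ₗ _)]
      refine Finset.sum_congr rfl fun w _ => ?_
      rw [Pi.add_apply, Pi.add_apply, hs, Equiv.coe_addRight]
      cases verDecMeasurement Q π (x i) (z i) (w + s) b with
      | none => rfl
      | some r =>
        simp only [Option.elim]
        rw [ih _ _ _ _ _ _ h.2, LinearMap.comp_assoc, LinearMap.comp_assoc, conj_comp, conj_comp,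
          tensM_mul_onWire, onWire_mul_tensM, hP, tensM_update_smul, conj_smul_of_norm _ hc,
          evalAccept_comp_unitary Q π gs x z _ _ h.2 (Finset.mem_insert_self i M) _ _
            (pauli_unitary _ _),
          evalAccept_comp_unitary Q π gs x z _ _ h.2 (Finset.mem_insert_self i M) _ _
            (pauli_unitary _ _)]

end TC

/-! ### Correction and detection of Pauli errors -/

namespace TC

variable {m t n : ℕ} (Q : SelfDualCSS m t)

open SelfDualCSS

/-- The trap checks of the verified decryption for the Pauli error `X^x Z^z` on the input: the pair
`(k, v)` stands for the check that the error `v` vanishes on the `k`-th third of the positions.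
The logical Pauli gates of the circuit are left out, since they do not act on the traps. -/
def checks : List (Gate n) → (x z : Fin n → BlockLabel m) → Finset (Fin n) →
    Set (Fin 3 × BlockLabel m)
  | [], x, z, M => {p | ∃ i, i ∉ M ∧ (p = (1, x i) ∨ p = (2, z i))}
  | .X _ _ :: gs, x, z, M => checks gs x z M
  | .Z _ _ :: gs, x, z, M => checks gs x z M
  | .cnot i j :: gs, x, z, M =>
      checks gs (Function.update x j (x i + x j)) (Function.update z i (z i + z j)) M
  | .meas .comp i :: gs, x, z, M => insert (1, x i) (checks gs x z (insert i M))
  | .meas .hada i :: gs, x, z, M => insert (2, z i) (checks gs x z (insert i M))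

/-- The error `v` of a check passes unnoticed for the secret permutation `π`. -/
def Passes (π : Equiv.Perm (Pos m)) (p : Fin 3 × BlockLabel m) : Prop :=
  third p.1 (permuteWord π⁻¹ p.2) = 0

/-- The factors of the projector on the states whose measured wires `M` hold the outcomes `a`. -/
def projM (M : Finset (Fin n)) (a : Fin n → Bit) (k : Fin n) : Matrix Bit Bit ℂ :=
  if k ∈ M then Matrix.single (a k) (a k) 1 else 1

/-- The factors of the encryption without one-time pad, restricted to the states whose measured
wires `M` hold the outcomes `a`. -/
def encM (π : Equiv.Perm (Pos m)) (M : Finset (Fin n)) (a : Fin n → Bit) (k : Fin n) :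
    Matrix (BlockLabel m) Bit ℂ :=
  encBlock Q π * projM M a k

theorem projM_of_notMem {M : Finset (Fin n)} {k : Fin n} (h : k ∉ M) (a : Fin n → Bit) :
    projM M a k = 1 := if_neg h

theorem encM_of_notMem (π : Equiv.Perm (Pos m)) {M : Finset (Fin n)} {k : Fin n} (h : k ∉ M)
    (a : Fin n → Bit) : encM Q π M a k = encBlock Q π := by
  rw [encM, projM_of_notMem h, Matrix.mul_one]

theorem projM_empty (a : Fin n → Bit) : tensM (projM ∅ a) = 1 := by
  have : projM ∅ a = fun _ => (1 : Matrix Bit Bit ℂ) := by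
    funext k
    exact projM_of_notMem (Finset.notMem_empty k) a
  rw [this, tensM_one]

theorem one_cnot {A : Type} [AddCommGroup A] [DecidableEq A] [Module Bit A] (ui uj vi vj : A) :
    (1 : Matrix A A ℂ) ui vi * (1 : Matrix A A ℂ) (uj + ui) vj =
      (1 : Matrix A A ℂ) ui vi * (1 : Matrix A A ℂ) uj (vj + vi) := by
  by_cases e : ui = vi
  · subst e
    have : (uj + ui = vj) ↔ (uj = vj + ui) := by
      constructor <;> rintro rfl <;> rw [add_assoc, ZModModule.add_self, add_zero]
    simp [Matrix.one_apply, this]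
  · simp [e]

theorem cnotU_comm_projM {M : Finset (Fin n)} (a : Fin n → Bit) {i j : Fin n} (hij : i ≠ j)
    (hi : i ∉ M) (hj : j ∉ M) :
    cnotU i j * tensM (projM M a) = tensM (projM M a) * cnotU i j := by
  refine cnotU_mul_tensM hij _ _ (fun _ _ _ => rfl) fun ui uj vi vj => ?_
  rw [projM_of_notMem hi, projM_of_notMem hj]
  exact one_cnot _ _ _ _

theorem onWire_comm_projM {M : Finset (Fin n)} (a : Fin n → Bit) {i : Fin n} (hi : i ∉ M)
    (K : Matrix Bit Bit ℂ) :
    onWire i K * tensM (projM M a) = tensM (projM M a) * onWire i K := by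
  rw [onWire_mul_tensM, tensM_mul_onWire, projM_of_notMem hi, Matrix.one_mul, Matrix.mul_one]

theorem evalAccept_X (π : Equiv.Perm (Pos m)) (f : (Fin n → Bit) → Bool) (i : Fin n)
    (gs : List (Gate n)) (x z : Fin n → BlockLabel m) (M : Finset (Fin n)) (a : Fin n → Bit)
    (h : WellFormed M (.X f i :: gs)) :
    evalAccept Q π (.X f i :: gs) x z M a ∘ₗ conj (tensM (encM Q π M a)) =
      evalAccept Q π gs x z M a ∘ₗ conj (tensM (encM Q π M a)) ∘ₗ
        conj (if f a then onWire i bitX else 1) := by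
  rw [evalAccept]
  split_ifs
  · have h1 : Function.update x i (x i + permuteWord π (dataOnes m)) =
        x + Function.update (0 : Fin n → BlockLabel m) i (permuteWord π (dataOnes m)) := by
      nth_rewrite 3 [← Function.update_eq_self i x]
      rw [update_add_update, add_zero]
    have h2 : (fun k => pauli (Function.update (0 : Fin n → BlockLabel m) i
        (permuteWord π (dataOnes m)) k) ((0 : Fin n → BlockLabel m) k)) =
        Function.update (fun _ => 1) i (pauli (permuteWord π (dataOnes m)) 0) := by
      funext k
      by_cases hk : k = i
      · subst hk; simp
      · simp [Function.update_of_ne hk, pauli_zero]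
    have h3 := evalAccept_add Q π gs x z (Function.update 0 i (permuteWord π (dataOnes m))) 0 M a
      h.2
    rw [add_zero, ← h1, h2, ← onWire_eq_tensM] at h3
    rw [h3, LinearMap.comp_assoc, conj_comp, conj_comp, onWire_mul_tensM, tensM_mul_onWire,
      encM_of_notMem Q π h.1, logicalX]
  · rw [conj_one, LinearMap.comp_id]

theorem evalAccept_Z (π : Equiv.Perm (Pos m)) (f : (Fin n → Bit) → Bool) (i : Fin n)
    (gs : List (Gate n)) (x z : Fin n → BlockLabel m) (M : Finset (Fin n)) (a : Fin n → Bit)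
    (h : WellFormed M (.Z f i :: gs)) :
    evalAccept Q π (.Z f i :: gs) x z M a ∘ₗ conj (tensM (encM Q π M a)) =
      evalAccept Q π gs x z M a ∘ₗ conj (tensM (encM Q π M a)) ∘ₗ
        conj (if f a then onWire i bitZ else 1) := by
  rw [evalAccept]
  split_ifs
  · have h1 : Function.update z i (z i + permuteWord π (dataOnes m)) =
        z + Function.update (0 : Fin n → BlockLabel m) i (permuteWord π (dataOnes m)) := by
      nth_rewrite 3 [← Function.update_eq_self i z]
      rw [update_add_update, add_zero]
    have h2 : (fun k => pauli ((0 : Fin n → BlockLabel m) k)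
        (Function.update (0 : Fin n → BlockLabel m) i (permuteWord π (dataOnes m)) k)) =
        Function.update (fun _ => 1) i (pauli 0 (permuteWord π (dataOnes m))) := by
      funext k
      by_cases hk : k = i
      · subst hk; simp
      · simp [Function.update_of_ne hk, pauli_zero]
    have h3 := evalAccept_add Q π gs x z 0 (Function.update 0 i (permuteWord π (dataOnes m))) M a
      h.2
    rw [add_zero, ← h1, h2, ← onWire_eq_tensM] at h3
    rw [h3, LinearMap.comp_assoc, conj_comp, conj_comp, onWire_mul_tensM, tensM_mul_onWire,
      encM_of_notMem Q π h.1, logicalZ]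
  · rw [conj_one, LinearMap.comp_id]

theorem evalAccept_cnot (π : Equiv.Perm (Pos m)) (i j : Fin n)
    (gs : List (Gate n)) (x z : Fin n → BlockLabel m) (M : Finset (Fin n)) (a : Fin n → Bit)
    (h : WellFormed M (.cnot i j :: gs)) :
    evalAccept Q π (.cnot i j :: gs) x z M a ∘ₗ conj (tensM (encM Q π M a)) =
      evalAccept Q π gs (Function.update x j (x i + x j)) (Function.update z i (z i + z j)) M a ∘ₗ
        conj (tensM (encM Q π M a)) ∘ₗ conj (cnotU i j) := by
  obtain ⟨hij, hi, hj, h⟩ := h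
  rw [evalAccept, LinearMap.comp_assoc, conj_comp, conj_comp]
  rw [cnotU_mul_tensM hij _ (encM Q π M a) (fun _ _ _ => rfl) fun ui uj vi vj => ?_]
  rw [encM_of_notMem Q π hi, encM_of_notMem Q π hj]
  exact encBlock_cnot Q π _ _ _ _

theorem star_dotProduct_encBlock (π : Equiv.Perm (Pos m)) (r : Bit) :
    star (fun w => encBlock Q π w r) ⬝ᵥ (fun w => encBlock Q π w r) = 1 := by
  have := congrFun (congrFun (encBlock_isometry Q π) r) r
  rw [Matrix.one_apply_eq, Matrix.mul_apply] at this
  exact this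

/-- After the measurement of a block, the block may be replaced by a fresh encryption of the
outcome. -/
theorem evalAccept_measured (π : Equiv.Perm (Pos m)) (b : MeasBasis) (i : Fin n)
    (gs : List (Gate n)) (x z : Fin n → BlockLabel m) (M : Finset (Fin n)) (a : Fin n → Bit)
    (h : WellFormed M (.meas b i :: gs)) (w : BlockLabel m) (r : Bit) :
    evalAccept Q π gs x z (insert i M) (Function.update a i r) ∘ₗ
        conj (onWire i (Matrix.single w w 1 * measH m b)) ∘ₗ conj (tensM (encM Q π M a)) =
      evalAccept Q π gs x z (insert i M) (Function.update a i r) ∘ₗ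
        conj (tensM (encM Q π (insert i M) (Function.update a i r))) ∘ₗ
          conj (onWire i (vecMulVec (Pi.single r 1) ((measH m b * encBlock Q π) w))) := by
  rw [conj_comp, conj_comp, onWire_mul_tensM, tensM_mul_onWire, encM_of_notMem Q π h.1]
  have h1 : Matrix.single w w 1 * measH m b * encBlock Q π =
      vecMulVec (Pi.single w 1) ((measH m b * encBlock Q π) w) := by
    rw [Matrix.mul_assoc]
    ext u v
    rw [vecMulVec_apply, Pi.single_apply]
    by_cases hu : u = w
    · subst hu; simp
    · rw [Matrix.single_mul_apply_of_ne _ _ _ _ _ hu]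
      simp [hu]
  have h2 : encM Q π (insert i M) (Function.update a i r) i *
      vecMulVec (Pi.single r 1) ((measH m b * encBlock Q π) w) =
      vecMulVec (fun u => encBlock Q π u r) ((measH m b * encBlock Q π) w) := by
    rw [encM, projM, if_pos (Finset.mem_insert_self i M), Function.update_self, Matrix.mul_assoc,
      mul_vecMulVec, mul_vecMulVec]
    congr 1
    funext u
    simp [Matrix.mulVec, dotProduct, Matrix.single_apply, Pi.single_apply, eq_comm]
  have h3 : ∀ L, Function.update (encM Q π (insert i M) (Function.update a i r)) i L =
      Function.update (encM Q π M a) i L := by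
    intro L
    funext k
    by_cases hk : k = i
    · subst hk; simp
    · simp [encM, projM, hk]
  rw [h1, h2, h3]
  exact evalAccept_comp_rankOne Q π gs x z _ _ h.2 (Finset.mem_insert_self i M) _ w _
    (star_dotProduct_encBlock Q π r) _

/-- An error that fails a trap check is rejected. -/
theorem evalAccept_comp_encM_eq_zero (π : Equiv.Perm (Pos m)) (gs : List (Gate n))
    (x z : Fin n → BlockLabel m) (M : Finset (Fin n)) (a : Fin n → Bit) (h : WellFormed M gs)
    (hdet : ∃ p ∈ checks gs x z M, ¬ Passes π p) :
    evalAccept Q π gs x z M a ∘ₗ conj (tensM (encM Q π M a)) = 0 := by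
  induction gs generalizing x z M a with
  | nil =>
    obtain ⟨p, ⟨i, hi, hp⟩, hdet⟩ := hdet
    rw [evalAccept, tensor_comp_conj]
    refine tensor_eq_zero _ i ?_
    rw [if_neg hi, encM_of_notMem Q π hi]
    refine verDecQubit_comp_encBlock_eq_zero Q π _ _ ?_
    rcases hp with rfl | rfl
    · exact Or.inl hdet
    · exact Or.inr hdet
  | cons g gs ih =>
    cases g with
    | X f i =>
      rw [evalAccept_X Q π f i gs x z M a h, ← LinearMap.comp_assoc, ih x z M a h.2 hdet,
        LinearMap.zero_comp]
    | Z f i =>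
      rw [evalAccept_Z Q π f i gs x z M a h, ← LinearMap.comp_assoc, ih x z M a h.2 hdet,
        LinearMap.zero_comp]
    | cnot i j =>
      rw [evalAccept_cnot Q π i j gs x z M a h, ← LinearMap.comp_assoc, ih _ _ M a h.2.2.2 hdet,
        LinearMap.zero_comp]
    | meas b i =>
      rw [evalAccept, sum_linearMap_comp]
      refine Finset.sum_eq_zero fun w _ => ?_
      cases hr : verDecMeasurement Q π (x i) (z i) w b with
      | none => rfl
      | some r =>
        simp only [Option.elim]
        rw [LinearMap.comp_assoc, evalAccept_measured Q π b i gs x z M a h]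
        by_cases hlater : ∃ p ∈ checks gs x z (insert i M), ¬ Passes π p
        · rw [← LinearMap.comp_assoc, ih _ _ _ _ h.2 hlater, LinearMap.zero_comp]
        · -- the check of this measurement fails, so that no outcome `w` that passes it can occur
          have hrow : (measH m b * encBlock Q π) w = 0 := by
            obtain ⟨p, hp, hdet⟩ := hdet
            cases b with
            | comp =>
              rcases hp with rfl | hp
              · funext c
                rw [measH, Matrix.one_mul]
                exact encBlock_eq_zero_of_detected Q hdet hr c
              · exact absurd ⟨p, hp, hdet⟩ hlater
            | hada =>
              rcases hp with rfl | hp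
              · rw [verDecMeasurement_hada] at hr
                have h0 : ∀ c, encBlock Q (π * swapTraps m) w c = 0 :=
                  encBlock_eq_zero_of_detected Q hdet hr
                funext c
                rw [measH, hadamardAll_mul_encBlock, Matrix.mul_apply]
                exact Finset.sum_eq_zero fun c _ => by rw [h0, zero_mul]
              · exact absurd ⟨p, hp, hdet⟩ hlater
          rw [hrow]
          have : onWire i (vecMulVec (Pi.single r (1 : ℂ)) (0 : Bit → ℂ)) = 0 := by
            rw [onWire_eq_tensM]
            exact tensM_eq_zero _ i (by ext u v; simp)
          rw [this, conj_zero, LinearMap.comp_zero, LinearMap.comp_zero]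

theorem measOp_eq (b : MeasBasis) (r : Bit) :
    measOp b r = vecMulVec (Pi.single r 1) (bitMeasH b r) := by
  have h : measOp b r = Matrix.single r r 1 * bitMeasH b := by
    cases b <;> simp [measOp, bitMeasH]
  rw [h]
  ext u v
  rw [vecMulVec_apply, Pi.single_apply]
  by_cases hu : u = r
  · subst hu; simp
  · rw [Matrix.single_mul_apply_of_ne _ _ _ _ _ hu]
    simp [hu]

/-- The distribution of the outcomes of a measured block: in both bases, the amplitudes are those
of an encoded block `encBlock Q π'`, followed by the logical change of basis. -/
theorem exists_measH_mul_encBlock (π : Equiv.Perm (Pos m)) (b : MeasBasis) (x z : BlockLabel m)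
    (p : Fin 3 × BlockLabel m) (hp : (b = .comp ∧ p = (1, x)) ∨ (b = .hada ∧ p = (2, z)))
    (hpass : Passes π p) (hgood : hammingNorm p.2 ≤ t) :
    ∃ π', measH m b * encBlock Q π = encBlock Q π' * bitMeasH b ∧
      ∀ w c, encBlock Q π' w c ≠ 0 → verDecMeasurement Q π x z w b = some c := by
  rcases hp with ⟨rfl, rfl⟩ | ⟨rfl, rfl⟩
  · refine ⟨π, by simp [measH, bitMeasH], fun w c h => ?_⟩
    exact verDecMeasurement_eq_some Q hpass hgood h
  · refine ⟨π * swapTraps m, hadamardAll_mul_encBlock Q π, fun w c h => ?_⟩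
    rw [verDecMeasurement_hada]
    exact verDecMeasurement_eq_some Q hpass hgood h

/-- If every error passes its trap check and has small weight, then the decryption of the evaluated
ciphertext implements the circuit. -/
theorem evalAccept_comp_encM (π : Equiv.Perm (Pos m)) (gs : List (Gate n))
    (x z : Fin n → BlockLabel m) (M : Finset (Fin n)) (a : Fin n → Bit) (h : WellFormed M gs)
    (hpass : ∀ p ∈ checks gs x z M, Passes π p)
    (hgood : ∀ p ∈ checks gs x z M, hammingNorm p.2 ≤ t) :
    evalAccept Q π gs x z M a ∘ₗ conj (tensM (encM Q π M a)) =
      runGates gs a ∘ₗ conj (tensM (projM M a)) := by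
  induction gs generalizing x z M a with
  | nil =>
    rw [evalAccept, tensor_comp_conj, runGates, LinearMap.id_comp, ← tensor_conj]
    refine congrArg SuperOp.tensor (funext fun k => ?_)
    by_cases hk : k ∈ M
    · rw [if_pos hk, encM, projM, if_pos hk]
      ext1 ρ
      have h1 : ((encBlock Q π)ᴴ * encBlock Q π) = 1 := encBlock_isometry Q π
      simp only [discardPrepare, LinearMap.comp_apply, LinearMap.smulRight_apply,
        Matrix.traceLinearMap_apply]
      rw [trace_conj, Matrix.conjTranspose_mul, Matrix.mul_assoc _ _ (encBlock Q π * _),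
        ← Matrix.mul_assoc (encBlock Q π)ᴴ, h1, Matrix.one_mul, conj_apply,
        Matrix.conjTranspose_single, star_one, Matrix.single_mul_single_same, one_mul]
      ext u v
      rw [Matrix.trace_single_mul, Matrix.single_mul_mul_single]
      simp [Matrix.single_apply]
    · rw [if_neg hk, encM_of_notMem Q π hk, projM_of_notMem hk, conj_one]
      exact verDecQubit_comp_encBlock Q π _ _ (hpass _ ⟨k, hk, Or.inl rfl⟩)
        (hpass _ ⟨k, hk, Or.inr rfl⟩) (hgood _ ⟨k, hk, Or.inl rfl⟩) (hgood _ ⟨k, hk, Or.inr rfl⟩)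
  | cons g gs ih =>
    cases g with
    | X f i =>
      rw [evalAccept_X Q π f i gs x z M a h, ← LinearMap.comp_assoc, ih x z M a h.2 hpass hgood,
        runGates, LinearMap.comp_assoc, LinearMap.comp_assoc, conj_comp, conj_comp]
      split_ifs
      · rw [onWire_comm_projM a h.1]
      · rw [Matrix.one_mul, Matrix.mul_one]
    | Z f i =>
      rw [evalAccept_Z Q π f i gs x z M a h, ← LinearMap.comp_assoc, ih x z M a h.2 hpass hgood,
        runGates, LinearMap.comp_assoc, LinearMap.comp_assoc, conj_comp, conj_comp]
      split_ifs
      · rw [onWire_comm_projM a h.1]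
      · rw [Matrix.one_mul, Matrix.mul_one]
    | cnot i j =>
      rw [evalAccept_cnot Q π i j gs x z M a h, ← LinearMap.comp_assoc,
        ih _ _ M a h.2.2.2 hpass hgood, runGates, LinearMap.comp_assoc, LinearMap.comp_assoc,
        conj_comp, conj_comp, cnotU_comm_projM a h.1 h.2.1 h.2.2.1]
    | meas b i =>
      have hsub : ∀ p ∈ checks gs x z (insert i M), p ∈ checks (.meas b i :: gs) x z M := by
        intro p hp
        cases b <;> exact Or.inr hp
      obtain ⟨p, hp, hp'⟩ : ∃ p ∈ checks (.meas b i :: gs) x z M,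
          (b = .comp ∧ p = (1, x i)) ∨ (b = .hada ∧ p = (2, z i)) := by
        cases b
        · exact ⟨_, Or.inl rfl, Or.inl ⟨rfl, rfl⟩⟩
        · exact ⟨_, Or.inl rfl, Or.inr ⟨rfl, rfl⟩⟩
      obtain ⟨π', hπ', hdec⟩ := exists_measH_mul_encBlock Q π b (x i) (z i) p hp' (hpass p hp)
        (hgood p hp)
      -- the contribution of the physical outcome `w`
      have hterm : ∀ w, (verDecMeasurement Q π (x i) (z i) w b).elim 0 (fun r =>
          evalAccept Q π gs x z (insert i M) (Function.update a i r) ∘ₗ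
            conj (onWire i (Matrix.single w w 1 * measH m b))) ∘ₗ conj (tensM (encM Q π M a)) =
          ∑ c, (star (encBlock Q π' w c) * encBlock Q π' w c) •
            (runGates gs (Function.update a i c) ∘ₗ conj (onWire i (measOp b c)) ∘ₗ
              conj (tensM (projM M a))) := by
        intro w
        have hr : ∀ r, evalAccept Q π gs x z (insert i M) (Function.update a i r) ∘ₗ
            conj (onWire i (Matrix.single w w 1 * measH m b)) ∘ₗ conj (tensM (encM Q π M a)) =
            runGates gs (Function.update a i r) ∘ₗ
              conj (onWire i (vecMulVec (Pi.single r 1) ((measH m b * encBlock Q π) w))) ∘ₗ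
                conj (tensM (projM M a)) := by
          intro r
          rw [evalAccept_measured Q π b i gs x z M a h, ← LinearMap.comp_assoc,
            ih _ _ _ _ h.2 (fun p hp => hpass p (hsub p hp)) (fun p hp => hgood p (hsub p hp)),
            LinearMap.comp_assoc, conj_comp, conj_comp, tensM_mul_onWire, onWire_mul_tensM,
            projM_of_notMem h.1, Matrix.mul_one]
          have h2 : projM (insert i M) (Function.update a i r) i *
              vecMulVec (Pi.single r 1) ((measH m b * encBlock Q π) w) =
              vecMulVec (Pi.single r 1) ((measH m b * encBlock Q π) w) := by
            rw [projM, if_pos (Finset.mem_insert_self i M), Function.update_self, mul_vecMulVec]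
            congr 1
            funext u
            simp [Pi.single_apply, Matrix.single_apply, eq_comm]
          have h3 : ∀ L, Function.update (projM (insert i M) (Function.update a i r)) i L =
              Function.update (projM M a) i L := by
            intro L
            funext k
            by_cases hk : k = i
            · subst hk; simp
            · simp [projM, hk]
          rw [h2, h3]
        by_cases hw : ∃ c, encBlock Q π' w c ≠ 0
        · obtain ⟨c, hc⟩ := hw
          have hother : ∀ c', c' ≠ c → encBlock Q π' w c' = 0 := by
            intro c' hne
            by_contra h0
            exact hne (Option.some.inj ((hdec w c' h0).symm.trans (hdec w c hc)))
          have hrow : (measH m b * encBlock Q π) w = encBlock Q π' w c • bitMeasH b c := by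
            rw [hπ']
            funext d
            rw [Matrix.mul_apply, Finset.sum_eq_single c]
            · rfl
            · intro c' _ hne
              rw [hother c' hne, zero_mul]
            · simp
          rw [hdec w c hc]
          simp only [Option.elim]
          rw [LinearMap.comp_assoc, hr, hrow, Finset.sum_eq_single c]
          · rw [vecMulVec_smul, ← measOp_eq, onWire_smul, conj_smul, mul_comm (star _),
              LinearMap.smul_comp, LinearMap.comp_smul]
          · intro c' _ hne
            rw [hother c' hne, mul_zero, zero_smul]
          · simp
        · push Not at hw
          have hrow : (measH m b * encBlock Q π) w = 0 := by
            rw [hπ']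
            funext d
            rw [Matrix.mul_apply]
            exact Finset.sum_eq_zero fun c _ => by rw [hw, zero_mul]
          have h0 : ∀ r : Bit, onWire i (vecMulVec (Pi.single r (1 : ℂ)) (0 : Bit → ℂ)) = 0 := by
            intro r
            rw [onWire_eq_tensM]
            exact tensM_eq_zero _ i (by ext u v; simp)
          have hR : ∑ c, (star (encBlock Q π' w c) * encBlock Q π' w c) •
            (runGates gs (Function.update a i c) ∘ₗ conj (onWire i (measOp b c)) ∘ₗ
              conj (tensM (projM M a))) = 0 :=
            Finset.sum_eq_zero fun c _ => by rw [hw, mul_zero, zero_smul]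
          rw [hR]
          cases verDecMeasurement Q π (x i) (z i) w b with
          | none => rfl
          | some r =>
            simp only [Option.elim]
            rw [LinearMap.comp_assoc, hr, hrow, h0, conj_zero, LinearMap.zero_comp,
              LinearMap.comp_zero]
      rw [evalAccept, sum_linearMap_comp, Finset.sum_congr rfl fun w _ => hterm w,
        Finset.sum_comm, runGates, sum_linearMap_comp]
      refine Finset.sum_congr rfl fun c _ => ?_
      rw [← Finset.sum_smul]
      have := star_dotProduct_encBlock Q π' c
      rw [dotProduct] at this
      simp only [Pi.star_apply] at this
      rw [this, one_smul]
      rfl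

end TC

/-! ### Complete positivity and traces -/

section Positivity

variable {A B D : Type} [Fintype A] [Fintype B] [Fintype D]

theorem amp_apply {A B : Type} (Φ : SuperOp A B) (E : Type) (ρ : Matrix (A × E) (A × E) ℂ)
    (p q : B × E) :
    Φ.amp E ρ p q = Φ (Matrix.of fun a a' => ρ (a, p.2) (a', q.2)) p.1 q.1 := rfl

theorem amp_comp {A B D : Type} (Φ : SuperOp B D) (Ψ : SuperOp A B) (E : Type) :
    SuperOp.amp (Φ ∘ₗ Ψ) E = Φ.amp E ∘ₗ Ψ.amp E := rfl

theorem amp_sum {A B κ : Type} (s : Finset κ) (Φ : κ → SuperOp A B) (E : Type) :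
    SuperOp.amp (∑ k ∈ s, Φ k) E = ∑ k ∈ s, (Φ k).amp E := by
  ext ρ p q
  simp [amp_apply, LinearMap.sum_apply, Matrix.sum_apply]

/-- The Kraus operator `K ⊗ 1_E`. -/
def ampK {A B : Type} (K : Matrix B A ℂ) (E : Type) [DecidableEq E] : Matrix (B × E) (A × E) ℂ :=
  Matrix.of fun p q => if p.2 = q.2 then K p.1 q.1 else 0

theorem ampK_mul_apply (K : Matrix B A ℂ) {E : Type} [Fintype E] [DecidableEq E]
    (N : Matrix (A × E) D ℂ) (p : B × E) (d : D) :
    (ampK K E * N) p d = ∑ a, K p.1 a * N (a, p.2) d := by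
  rw [Matrix.mul_apply, Fintype.sum_prod_type]
  refine Finset.sum_congr rfl fun a _ => ?_
  rw [Finset.sum_eq_single p.2]
  · simp [ampK]
  · intro e _ he
    simp [ampK, he.symm]
  · simp

theorem mul_ampK_conjTranspose_apply (K : Matrix B A ℂ) {E : Type} [Fintype E] [DecidableEq E]
    (N : Matrix D (A × E) ℂ) (d : D) (p : B × E) :
    (N * (ampK K E)ᴴ) d p = ∑ a, N d (a, p.2) * star (K p.1 a) := by
  rw [Matrix.mul_apply, Fintype.sum_prod_type]
  refine Finset.sum_congr rfl fun a _ => ?_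
  rw [Finset.sum_eq_single p.2]
  · simp [ampK]
  · intro e _ he
    simp [ampK, he.symm]
  · simp

theorem amp_conj (K : Matrix B A ℂ) (E : Type) [Fintype E] [DecidableEq E] :
    (conj K).amp E = conj (ampK K E) := by
  ext1 ρ
  ext p q
  rw [amp_apply, conj_apply, conj_apply, mul_ampK_conjTranspose_apply, Matrix.mul_apply]
  simp_rw [ampK_mul_apply, Matrix.mul_apply]
  rfl

/-- Complete positivity. -/
def IsCP (Φ : SuperOp A B) : Prop :=
  ∀ (E : Type) [Fintype E] (ρ : Matrix (A × E) (A × E) ℂ),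
    ρ.PosSemidef → (Φ.amp E ρ).PosSemidef

theorem isCP_conj (K : Matrix B A ℂ) : IsCP (conj K) := by
  classical
  intro E _ ρ hρ
  rw [amp_conj]
  exact hρ.mul_mul_conjTranspose_same _

theorem IsCP.comp {Φ : SuperOp B D} {Ψ : SuperOp A B} (hΦ : IsCP Φ) (hΨ : IsCP Ψ) :
    IsCP (Φ ∘ₗ Ψ) := fun E _ ρ hρ => hΦ E _ (hΨ E ρ hρ)

theorem isCP_sum {κ : Type} (s : Finset κ) (Φ : κ → SuperOp A B) (h : ∀ k ∈ s, IsCP (Φ k)) :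
    IsCP (∑ k ∈ s, Φ k) := by
  intro E _ ρ hρ
  rw [amp_sum, LinearMap.sum_apply]
  exact posSemidef_sum _ fun k hk => h k hk E ρ hρ

theorem isCP_zero : IsCP (0 : SuperOp A B) := fun E _ ρ _ => by
  have : (0 : SuperOp A B).amp E ρ = 0 := rfl
  rw [this]
  exact PosSemidef.zero

theorem isCP_id : IsCP (LinearMap.id : SuperOp A A) := fun _ _ _ hρ => hρ

theorem IsCP.posSemidef {Φ : SuperOp A B} (h : IsCP Φ) {ρ : Matrix A A ℂ} (hρ : ρ.PosSemidef) :
    (Φ ρ).PosSemidef := by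
  have h1 := h Unit (ρ.submatrix Prod.fst Prod.fst) (hρ.submatrix _)
  exact h1.submatrix fun b => (b, ())

/-- Trace preserving superoperators. -/
def IsTP (Φ : SuperOp A B) : Prop := ∀ ρ, (Φ ρ).trace = ρ.trace

/-- Superoperators that do not increase the trace of states. -/
def IsTNI (Φ : SuperOp A B) : Prop := ∀ ρ, ρ.PosSemidef → (Φ ρ).trace ≤ ρ.trace

theorem IsTP.comp {Φ : SuperOp B D} {Ψ : SuperOp A B} (hΦ : IsTP Φ) (hΨ : IsTP Ψ) :
    IsTP (Φ ∘ₗ Ψ) := fun ρ => (hΦ _).trans (hΨ ρ)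

theorem IsTP.isTNI {Φ : SuperOp A B} (h : IsTP Φ) : IsTNI Φ := fun ρ _ => (h ρ).le

theorem IsTNI.comp {Φ : SuperOp B D} {Ψ : SuperOp A B} (hΦ : IsTNI Φ) (hΨ : IsTNI Ψ)
    (hP : IsCP Ψ) : IsTNI (Φ ∘ₗ Ψ) :=
  fun ρ hρ => (hΦ _ (hP.posSemidef hρ)).trans (hΨ ρ hρ)

theorem isTP_sum_conj [DecidableEq A] {κ : Type} [Fintype κ] (K : κ → Matrix B A ℂ)
    (hK : ∑ k, (K k)ᴴ * K k = 1) : IsTP (∑ k, conj (K k)) := trace_sum_conj K hK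

theorem isTP_conj [DecidableEq A] (K : Matrix B A ℂ) (hK : Kᴴ * K = 1) : IsTP (conj K) := by
  intro ρ
  rw [trace_conj, hK, Matrix.one_mul]

/-- The partial trace over the second register. -/
def traceRight {A E : Type} [Fintype E] (ρ : Matrix (A × E) (A × E) ℂ) : Matrix A A ℂ :=
  ∑ e, Matrix.of fun a a' => ρ (a, e) (a', e)

theorem trace_traceRight {E : Type} [Fintype E] (ρ : Matrix (A × E) (A × E) ℂ) :
    (traceRight ρ).trace = ρ.trace := by
  simp only [Matrix.trace, Matrix.diag, traceRight, Matrix.sum_apply, Matrix.of_apply]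
  rw [Fintype.sum_prod_type]

theorem trace_amp (Φ : SuperOp A B) {E : Type} [Fintype E] (ρ : Matrix (A × E) (A × E) ℂ) :
    (Φ.amp E ρ).trace = (Φ (traceRight ρ)).trace := by
  rw [traceRight, map_sum]
  simp only [Matrix.trace, Matrix.diag, Matrix.sum_apply]
  rw [Fintype.sum_prod_type]
  rfl

/-- The partial trace over the first register. -/
def traceLeft {A E : Type} [Fintype A] (ρ : Matrix (A × E) (A × E) ℂ) : Matrix E E ℂ :=
  Matrix.of fun e e' => (Matrix.of fun a a' => ρ (a, e) (a', e')).trace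

theorem posSemidef_traceLeft {E : Type} [Fintype E] {ρ : Matrix (A × E) (A × E) ℂ}
    (hρ : ρ.PosSemidef) : (traceLeft ρ).PosSemidef := by
  have : traceLeft ρ = ∑ a, ρ.submatrix (fun e => (a, e)) (fun e => (a, e)) := by
    ext e e'
    simp [traceLeft, Matrix.trace, Matrix.sum_apply]
  rw [this]
  exact posSemidef_sum _ fun a _ => hρ.submatrix _

/-- If `Φ` is completely positive and does not increase traces, then the reduced state of the second
register in the event that `Φ` fails is positive. -/
theorem posSemidef_traceLeft_sub {Φ : SuperOp A B} (hΦ : IsCP Φ) (hΦ' : IsTNI Φ)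
    {E : Type} [Fintype E] {ρ : Matrix (A × E) (A × E) ℂ} (hρ : ρ.PosSemidef) :
    (traceLeft ρ - traceLeft (Φ.amp E ρ)).PosSemidef := by
  classical
  refine PosSemidef.of_dotProduct_mulVec_nonneg ((posSemidef_traceLeft hρ).isHermitian.sub
    (posSemidef_traceLeft (hΦ E ρ hρ)).isHermitian) fun y => ?_
  -- contracting `E` with the vector `y` gives a state of `A`
  let Y : Matrix (A × E) A ℂ := Matrix.of fun p a => if p.1 = a then y p.2 else 0
  have h1 := hΦ' _ (hρ.conjTranspose_mul_mul_same Y)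
  have h2 : Yᴴ * ρ * Y = ∑ e, ∑ e', (star (y e) * y e') •
      (Matrix.of fun a a' => ρ (a, e) (a', e')) := by
    ext a a'
    simp only [Matrix.mul_apply, Matrix.conjTranspose_apply, Matrix.sum_apply,
      Matrix.smul_apply, Matrix.of_apply, Fintype.sum_prod_type_right, Y]
    simp only [apply_ite star, star_zero, ite_mul, zero_mul, mul_ite, mul_zero,
      Finset.sum_ite_eq', Finset.mem_univ, if_true, Finset.sum_mul, smul_eq_mul]
    rw [Finset.sum_comm]
    refine Finset.sum_congr rfl fun e _ => Finset.sum_congr rfl fun e' _ => ?_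
    ring
  have h3 : ∀ l : Matrix A A ℂ →ₗ[ℂ] ℂ, l (Yᴴ * ρ * Y) =
      star y ⬝ᵥ ((Matrix.of fun e e' => l (Matrix.of fun a a' => ρ (a, e) (a', e'))) *ᵥ y) := by
    intro l
    rw [h2]
    simp only [map_sum, map_smul, smul_eq_mul, dotProduct, Matrix.mulVec, Finset.mul_sum,
      Matrix.of_apply, Pi.star_apply]
    refine Finset.sum_congr rfl fun e _ => Finset.sum_congr rfl fun e' _ => ?_
    ring
  have h4 := h3 (Matrix.traceLinearMap A ℂ ℂ)
  have h5 := h3 (Matrix.traceLinearMap B ℂ ℂ ∘ₗ Φ)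
  rw [Matrix.traceLinearMap_apply] at h4
  rw [LinearMap.comp_apply, Matrix.traceLinearMap_apply] at h5
  rw [h4, h5, ← sub_nonneg, ← dotProduct_sub, ← Matrix.sub_mulVec] at h1
  exact h1

open scoped MatrixOrder in
/-- The trace of a product of two positive semidefinite matrices is nonnegative. -/
theorem trace_mul_nonneg [DecidableEq A] {P ρ : Matrix A A ℂ} (hP : P.PosSemidef)
    (hρ : ρ.PosSemidef) : 0 ≤ (P * ρ).trace := by
  obtain ⟨C, rfl⟩ := CStarAlgebra.nonneg_iff_eq_star_mul_self.mp hP.nonneg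
  rw [Matrix.mul_assoc, Matrix.trace_mul_comm, Matrix.mul_assoc]
  have := (hρ.mul_mul_conjTranspose_same C).trace_nonneg
  rwa [Matrix.mul_assoc] at this

end Positivity

/-- A superoperator with a Kraus decomposition whose operators satisfy `∑ₖ Kₖᴴ Kₖ = S`. -/
def HasKraus {A B : Type} [Fintype A] [Fintype B] (Φ : SuperOp A B) (S : Matrix A A ℂ) : Prop :=
  ∃ (κ : Type) (_ : Fintype κ) (K : κ → Matrix B A ℂ),
    Φ = ∑ k, conj (K k) ∧ ∑ k, (K k)ᴴ * K k = S

section Kraus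

variable {A B : Type} [Fintype A] [Fintype B]

theorem HasKraus.isCP {Φ : SuperOp A B} {S : Matrix A A ℂ} (h : HasKraus Φ S) : IsCP Φ := by
  obtain ⟨κ, _, K, rfl, -⟩ := h
  exact isCP_sum _ _ fun k _ => isCP_conj _

theorem HasKraus.trace_apply {Φ : SuperOp A B} {S : Matrix A A ℂ} (h : HasKraus Φ S)
    (ρ : Matrix A A ℂ) : (Φ ρ).trace = (S * ρ).trace := by
  obtain ⟨κ, _, K, rfl, rfl⟩ := h
  rw [LinearMap.sum_apply, Matrix.trace_sum, Finset.sum_mul, Matrix.trace_sum]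
  exact Finset.sum_congr rfl fun k _ => trace_conj _ _

/-- If the Kraus operators sum up to a projector, the trace does not increase. -/
theorem HasKraus.isTNI [DecidableEq A] {Φ : SuperOp A B} {S : Matrix A A ℂ} (h : HasKraus Φ S)
    (hS : Sᴴ = S) (hS' : S * S = S) : IsTNI Φ := by
  intro ρ hρ
  have h1 := (hρ.mul_mul_conjTranspose_same (1 - S)).trace_nonneg
  have h2 : (1 - S)ᴴ * (1 - S) = 1 - S := by
    rw [Matrix.conjTranspose_sub, Matrix.conjTranspose_one, hS, Matrix.sub_mul, Matrix.one_mul,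
      Matrix.mul_sub, Matrix.mul_one, hS', sub_self, sub_zero]
  rw [Matrix.trace_mul_comm, ← Matrix.mul_assoc, h2, Matrix.sub_mul, Matrix.trace_sub,
    Matrix.one_mul, ← h.trace_apply ρ] at h1
  exact sub_nonneg.1 h1

theorem hasKraus_tensor {ι : Type} [Fintype ι] [DecidableEq ι] [DecidableEq A]
    (Φ : ι → SuperOp A B) (S : ι → Matrix A A ℂ) (h : ∀ i, HasKraus (Φ i) (S i)) :
    HasKraus (SuperOp.tensor Φ) (tensM S) := by
  choose κ hκ K hK hS using h
  refine ⟨∀ i, κ i, inferInstance, fun k => tensM fun i => K i (k i), ?_, ?_⟩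
  · rw [← tensor_sum_conj]
    exact congrArg SuperOp.tensor (funext hK)
  · simp_rw [tensM_conjTranspose, tensM_mul]
    ext u v
    rw [Matrix.sum_apply, tensM_apply]
    simp_rw [← hS, tensM_apply, Matrix.sum_apply]
    rw [Finset.prod_univ_sum, Fintype.piFinset_univ]

theorem hasKraus_discardPrepare [DecidableEq A] [DecidableEq B] (b : B) :
    HasKraus (discardPrepare (Matrix.single b b 1) : SuperOp A B) 1 := by
  refine ⟨A, inferInstance, fun a => Matrix.single b a 1, ?_, ?_⟩
  · ext1 ρ
    rw [LinearMap.sum_apply]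
    simp_rw [conj_apply, Matrix.conjTranspose_single, star_one, Matrix.single_mul_mul_single]
    ext u v
    simp [discardPrepare, Matrix.trace, Matrix.sum_apply, Matrix.single_apply, ite_and]
  · simp_rw [Matrix.conjTranspose_single, star_one, Matrix.single_mul_single_same, one_mul]
    ext u v
    simp [Matrix.sum_apply, Matrix.single_apply, Matrix.one_apply, ite_and]

end Kraus

namespace TC

variable {m t n : ℕ} (Q : SelfDualCSS m t)

open SelfDualCSS

theorem permuteU_mul_conjTranspose (π : Equiv.Perm (Pos m)) :
    permuteU π * (permuteU π)ᴴ = 1 := by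
  rw [permuteU_conjTranspose, permuteU_mul, mul_inv_cancel, permuteU_one]

/-- The verified decryption of an unmeasured qubit succeeds on a subspace. -/
theorem exists_hasKraus_verDecQubit (π : Equiv.Perm (Pos m)) (x z : BlockLabel m) :
    ∃ S, HasKraus (verDecQubit Q π x z) S ∧ Sᴴ = S ∧ S * S = S := by
  let R := Finset.univ.image Q.recover
  let K : R × R → Matrix Bit (BlockLabel m) ℂ := fun p => decBlock Q π p.1 p.2 * pauli x z
  have hK : ∀ p q, K p * (K q)ᴴ = if p = q then 1 else 0 := by
    intro p q
    have h1 : pauli x z * (pauli x z)ᴴ = 1 := mul_eq_one_comm.1 (pauli_unitary x z)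
    have h2 : permuteU π⁻¹ * (permuteU π⁻¹)ᴴ = 1 := permuteU_mul_conjTranspose π⁻¹
    have h3 : K p * (K q)ᴴ = Q.decode p.1 p.2 * ((addTraps m)ᴴ * ((permuteU π⁻¹ *
        ((pauli x z * (pauli x z)ᴴ) * (permuteU π⁻¹)ᴴ)) * addTraps m)) *
          (Q.decode q.1 q.2)ᴴ := by
      simp only [K, decBlock, Matrix.conjTranspose_mul, Matrix.conjTranspose_conjTranspose,
        Matrix.mul_assoc]
    rw [h3, h1, Matrix.one_mul, h2, Matrix.one_mul, addTraps_isometry, Matrix.mul_one,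
      Q.decode_mul_decode p.1.2 p.2.2 q.1.2 q.2.2]
    simp only [Prod.ext_iff, Subtype.ext_iff]
  refine ⟨∑ p, (K p)ᴴ * K p, ⟨R × R, inferInstance, K, ?_, rfl⟩, ?_, ?_⟩
  · rw [verDecQubit_eq, Fintype.sum_prod_type, ← Finset.sum_coe_sort]
    refine Finset.sum_congr rfl fun e _ => ?_
    rw [← Finset.sum_coe_sort]
  · rw [Matrix.conjTranspose_sum]
    simp
  · rw [Finset.sum_mul]
    refine Finset.sum_congr rfl fun p _ => ?_
    rw [Finset.mul_sum, Finset.sum_eq_single p]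
    · rw [Matrix.mul_assoc, ← Matrix.mul_assoc (K p), hK, if_pos rfl, Matrix.one_mul]
    · intro q _ hq
      rw [Matrix.mul_assoc, ← Matrix.mul_assoc (K p), hK, if_neg hq.symm, Matrix.zero_mul,
        Matrix.mul_zero]
    · simp

theorem sum_single_mul_unitary {A : Type} [Fintype A] [DecidableEq A] (H : Matrix A A ℂ)
    (hH : Hᴴ * H = 1) :
    ∑ w : A, (Matrix.single w w 1 * H)ᴴ * (Matrix.single w w 1 * H) = 1 := by
  have h : ∑ w : A, Matrix.single w w (1 : ℂ) = 1 := by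
    ext u v
    simp [Matrix.sum_apply, Matrix.single_apply, Matrix.one_apply, ite_and]
  have h' : ∀ w : A, (Matrix.single w w 1 * H)ᴴ * (Matrix.single w w 1 * H) =
      Hᴴ * Matrix.single w w 1 * H := by
    intro w
    rw [Matrix.conjTranspose_mul, Matrix.conjTranspose_single, star_one, Matrix.mul_assoc,
      ← Matrix.mul_assoc _ _ H, Matrix.single_mul_single_same, one_mul, Matrix.mul_assoc]
  simp_rw [h']
  rw [← Finset.sum_mul, ← Finset.mul_sum, h, Matrix.mul_one, hH]

/-- The accepting branch of the verified decryption is a branch of a quantum operation. -/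
theorem evalAccept_isCP_isTNI (π : Equiv.Perm (Pos m)) (gs : List (Gate n))
    (x z : Fin n → BlockLabel m) (M : Finset (Fin n)) (a : Fin n → Bit) (h : WellFormed M gs) :
    IsCP (evalAccept Q π gs x z M a) ∧ IsTNI (evalAccept Q π gs x z M a) := by
  induction gs generalizing x z M a with
  | nil =>
    have hS : ∀ i, ∃ S, HasKraus (if i ∈ M then discardPrepare (Matrix.single (a i) (a i) 1)
        else verDecQubit Q π (x i) (z i)) S ∧ Sᴴ = S ∧ S * S = S := by
      intro i
      split_ifs
      · exact ⟨1, hasKraus_discardPrepare _, by simp, by simp⟩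
      · exact exists_hasKraus_verDecQubit Q π _ _
    choose S hK hS hS' using hS
    have := hasKraus_tensor _ S hK
    refine ⟨this.isCP, this.isTNI ?_ ?_⟩
    · rw [tensM_conjTranspose]
      exact congrArg tensM (funext hS)
    · rw [tensM_mul]
      exact congrArg tensM (funext hS')
  | cons g gs ih =>
    cases g with
    | X f i => exact ih _ _ M a h.2
    | Z f i => exact ih _ _ M a h.2
    | cnot i j =>
      have h1 := ih (Function.update x j (x i + x j)) (Function.update z i (z i + z j)) M a
        h.2.2.2
      refine ⟨h1.1.comp (isCP_conj _), h1.2.comp (isTP_conj _ ?_).isTNI (isCP_conj _)⟩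
      rw [cnotU_conjTranspose h.1, cnotU_mul_self h.1]
    | meas b i =>
      have hterm : ∀ w, IsCP ((verDecMeasurement Q π (x i) (z i) w b).elim 0 fun r =>
          evalAccept Q π gs x z (insert i M) (Function.update a i r) ∘ₗ
            conj (onWire i (Matrix.single w w 1 * measH m b))) := by
        intro w
        cases verDecMeasurement Q π (x i) (z i) w b with
        | none => exact isCP_zero
        | some r => exact (ih x z _ _ h.2).1.comp (isCP_conj _)
      refine ⟨isCP_sum _ _ fun w _ => hterm w, fun ρ hρ => ?_⟩
      rw [evalAccept, LinearMap.sum_apply, Matrix.trace_sum]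
      have hcomplete := onWire_complete i (fun w => Matrix.single w w 1 * measH m b)
        (sum_single_mul_unitary _ (measH_unitary b))
      rw [← isTP_sum_conj _ hcomplete ρ, LinearMap.sum_apply, Matrix.trace_sum]
      refine Finset.sum_le_sum fun w _ => ?_
      have hpos := (isCP_conj (onWire i (Matrix.single w w 1 * measH m b))).posSemidef hρ
      cases verDecMeasurement Q π (x i) (z i) w b with
      | none =>
        simp only [Option.elim, LinearMap.zero_apply, Matrix.trace_zero]
        exact hpos.trace_nonneg
      | some r => exact (ih x z _ _ h.2).2 _ hpos

end TC

theorem sum_bit (f : Bit → ℂ) : ∑ b, f b = f 0 + f 1 := Fin.sum_univ_two f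

theorem bitX_unitary : bitXᴴ * bitX = 1 := by
  have h : (1 + 1 : Bit) = 0 := by decide
  ext u v
  rw [Matrix.mul_apply, sum_bit]
  rcases bit_cases u with rfl | rfl <;> rcases bit_cases v with rfl | rfl <;>
    simp [bitX, h]

theorem bitZ_unitary : bitZᴴ * bitZ = 1 := by
  rw [bitZ, Matrix.diagonal_conjTranspose, Matrix.diagonal_mul_diagonal, ← Matrix.diagonal_one]
  congr 1
  funext v
  rw [Pi.star_apply, star_sign, sign_mul_self]

theorem bitH_unitary : bitHᴴ * bitH = 1 := by
  have h := inv_sqrt_two_mul_self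
  have h' : star ((Real.sqrt 2 : ℂ)⁻¹) = (Real.sqrt 2 : ℂ)⁻¹ := by
    have := star_inv_sqrt_two_pow 1
    rwa [pow_one] at this
  have h2 : ∀ u v, (bitHᴴ * bitH) u v = 2⁻¹ * (1 + sign u * sign v) := by
    intro u v
    rw [Matrix.mul_apply, sum_bit]
    simp only [bitH, Matrix.conjTranspose_apply, Matrix.of_apply, star_mul', h', star_sign, star_one,
      zero_mul, one_mul, sign_zero]
    linear_combination (1 + sign u * sign v) * h
  ext u v
  rw [h2]
  rcases bit_cases u with rfl | rfl <;> rcases bit_cases v with rfl | rfl <;>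
    simp [sign_zero, sign_one] <;> norm_num

theorem measOp_complete (b : MeasBasis) : ∑ r, (measOp b r)ᴴ * measOp b r = 1 := by
  cases b with
  | comp => simpa [measOp] using TC.sum_single_mul_unitary (1 : Matrix Bit Bit ℂ) (by simp)
  | hada => exact TC.sum_single_mul_unitary bitH bitH_unitary

theorem onWire_unitary {n : ℕ} {A : Type} [Fintype A] [DecidableEq A] (i : Fin n)
    (K : Matrix A A ℂ) (h : Kᴴ * K = 1) : (onWire i K)ᴴ * onWire i K = 1 := by
  rw [onWire_conjTranspose, onWire_mul, h, onWire_one]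

theorem runGates_isCP_isTP {n : ℕ} (gs : List (Gate n)) (M : Finset (Fin n)) (a : Fin n → Bit)
    (h : WellFormed M gs) : IsCP (runGates gs a) ∧ IsTP (runGates gs a) := by
  induction gs generalizing M a with
  | nil => exact ⟨isCP_id, fun _ => rfl⟩
  | cons g gs ih =>
    cases g with
    | X f i =>
      have h1 := ih M a h.2
      refine ⟨h1.1.comp (isCP_conj _), h1.2.comp (isTP_conj _ ?_)⟩
      split_ifs
      · exact onWire_unitary i _ bitX_unitary
      · simp
    | Z f i =>
      have h1 := ih M a h.2
      refine ⟨h1.1.comp (isCP_conj _), h1.2.comp (isTP_conj _ ?_)⟩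
      split_ifs
      · exact onWire_unitary i _ bitZ_unitary
      · simp
    | cnot i j =>
      have h1 := ih M a h.2.2.2
      refine ⟨h1.1.comp (isCP_conj _), h1.2.comp (isTP_conj _ ?_)⟩
      rw [cnotU_conjTranspose h.1, cnotU_mul_self h.1]
    | meas b i =>
      have h1 := fun r => ih (insert i M) (Function.update a i r) h.2
      refine ⟨isCP_sum _ _ fun r _ => (h1 r).1.comp (isCP_conj _), fun ρ => ?_⟩
      rw [← isTP_sum_conj _ (onWire_complete i _ (measOp_complete b)) ρ, runGates,
        LinearMap.sum_apply, LinearMap.sum_apply, Matrix.trace_sum, Matrix.trace_sum]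
      exact Finset.sum_congr rfl fun r _ => (h1 r).2 _

theorem keepWires_isCP {n : ℕ} (S : Finset (Fin n)) : IsCP (keepWires S) :=
  isCP_sum _ _ fun _ _ => isCP_conj _

theorem keepWires_isTP {n : ℕ} (S : Finset (Fin n)) : IsTP (keepWires S) := by
  refine isTP_sum_conj _ ?_
  ext v v'
  simp only [Matrix.sum_apply, Matrix.mul_apply, Matrix.conjTranspose_apply, Matrix.of_apply]
  rw [Finset.sum_eq_single fun i => v i.1]
  · rw [Finset.sum_eq_single fun i => v i.1]
    · have : ((∀ i : {i // i ∈ S}, v' i.1 = v i.1) ∧ ∀ i : {i // i ∉ S}, v' i.1 = v i.1) ↔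
          v = v' := by
        constructor
        · rintro ⟨h1, h2⟩
          funext i
          by_cases hi : i ∈ S
          · exact (h1 ⟨i, hi⟩).symm
          · exact (h2 ⟨i, hi⟩).symm
        · rintro rfl
          exact ⟨fun _ => rfl, fun _ => rfl⟩
      simp [Matrix.one_apply, ← this]
    · intro u _ hu
      rw [if_neg fun h => hu (funext fun i => (h.1 i).symm), star_zero, zero_mul]
    · simp
  · intro t _ ht
    refine Finset.sum_eq_zero fun u _ => ?_
    rw [if_neg fun h => ht (funext fun i => (h.2 i).symm), star_zero, zero_mul]
  · simp

theorem Circuit.channel_isCP {n : ℕ} (c : Circuit n) : IsCP c.channel :=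
  (keepWires_isCP _).comp (runGates_isCP_isTP _ _ _ c.wellFormed).1

theorem Circuit.channel_isTP {n : ℕ} (c : Circuit n) : IsTP c.channel :=
  (keepWires_isTP _).comp (runGates_isCP_isTP _ _ _ c.wellFormed).2

/-! ### The probability that an error of large weight misses the traps -/

section Permutations

variable {α : Type} [Fintype α] [DecidableEq α]

/-- The permutations that map `S` into the complement of `T`. -/
def avoiding (S T : Finset α) : Finset (Equiv.Perm α) :=
  Finset.univ.filter fun σ => ∀ p ∈ S, σ p ∉ T

/-- If `T` makes up at least a third of all positions, each further element of `S` is mapped outside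
`T` with probability at most `2/3`.  Exchanging the image of `p` with an element of `T` injects the
pairs of a permutation with `σ p ∉ T` and an element of `T` into the pairs of a permutation with
`σ p ∈ T` and an element of the complement of `T`. -/
theorem three_mul_card_avoiding_insert {S T : Finset α} {p : α} (hp : p ∉ S)
    (hT : Tᶜ.card ≤ 2 * T.card) (hT0 : 0 < T.card) :
    3 * (avoiding (insert p S) T).card ≤ 2 * (avoiding S T).card := by
  let G := (avoiding S T).filter fun σ => σ p ∉ T
  let H := (avoiding S T).filter fun σ => ¬ σ p ∉ T
  have hG : avoiding (insert p S) T = G := by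
    ext σ
    simp only [avoiding, G, Finset.mem_filter, Finset.mem_univ, true_and, Finset.forall_mem_insert]
    tauto
  have hsplit : G.card + H.card = (avoiding S T).card :=
    Finset.card_filter_add_card_filter_not _
  have hinj : (G ×ˢ T).card ≤ (H ×ˢ Tᶜ).card := by
    refine Finset.card_le_card_of_injOn
      (fun q => (Equiv.swap (q.1 p) q.2 * q.1, q.1 p)) ?_ ?_
    · rintro ⟨σ, u⟩ hq
      simp only [Finset.coe_product, Set.mem_prod, Finset.mem_coe, G, H, avoiding,
        Finset.mem_filter, Finset.mem_univ, true_and, Finset.mem_compl, not_not] at hq ⊢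
      obtain ⟨⟨h1, h2⟩, h3⟩ := hq
      refine ⟨⟨fun s hs => ?_, ?_⟩, h2⟩
      · have hne : σ s ≠ σ p := fun e => hp (σ.injective e ▸ hs)
        have hne' : σ s ≠ u := fun e => h1 s hs (e ▸ h3)
        rw [Equiv.Perm.mul_apply, Equiv.swap_apply_of_ne_of_ne hne hne']
        exact h1 s hs
      · rw [Equiv.Perm.mul_apply, Equiv.swap_apply_left]
        exact h3
    · rintro ⟨σ, u⟩ - ⟨σ', u'⟩ - h
      simp only [Prod.mk.injEq] at h
      obtain ⟨h1, h2⟩ := h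
      have h3 : u = u' := by
        have := congrArg (fun τ : Equiv.Perm α => τ p) h1
        simpa [Equiv.Perm.mul_apply] using this
      subst h3
      rw [h2] at h1
      rw [mul_left_cancel h1]
  rw [Finset.card_product, Finset.card_product] at hinj
  have h4 : G.card * T.card ≤ (2 * H.card) * T.card := by
    calc G.card * T.card ≤ H.card * Tᶜ.card := hinj
      _ ≤ H.card * (2 * T.card) := Nat.mul_le_mul_left _ hT
      _ = (2 * H.card) * T.card := by ring
  have h5 := Nat.le_of_mul_le_mul_right h4 hT0
  rw [hG]
  omega

theorem three_pow_mul_card_avoiding (S T : Finset α) (hT : Tᶜ.card ≤ 2 * T.card)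
    (hT0 : 0 < T.card) :
    3 ^ S.card * (avoiding S T).card ≤ 2 ^ S.card * (Fintype.card α).factorial := by
  induction S using Finset.induction_on with
  | empty =>
    simp only [Finset.card_empty, pow_zero, one_mul]
    rw [← Fintype.card_perm]
    exact Finset.card_le_univ _
  | insert p S hp ih =>
    have h1 := three_mul_card_avoiding_insert hp hT hT0
    rw [Finset.card_insert_of_notMem hp, pow_succ, pow_succ, mul_assoc]
    calc 3 ^ S.card * (3 * (avoiding (insert p S) T).card)
        ≤ 3 ^ S.card * (2 * (avoiding S T).card) := Nat.mul_le_mul_left _ h1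
      _ = 2 * (3 ^ S.card * (avoiding S T).card) := by ring
      _ ≤ 2 * (2 ^ S.card * (Fintype.card α).factorial) := Nat.mul_le_mul_left _ ih
      _ = _ := by ring

end Permutations

namespace TC

variable {m t : ℕ}

open Classical in
/-- An error of weight greater than `t` passes a trap check with probability at most
`(2/3)^(t+1)` over the secret permutation. -/
theorem card_passes_le (hm : 0 < m) (k : Fin 3) (v : BlockLabel m) (hv : t < hammingNorm v) :
    ((Finset.univ.filter fun π : Equiv.Perm (Pos m) => Passes π (k, v)).card : ℝ) ≤
      (2 / 3) ^ (t + 1) * Fintype.card (Equiv.Perm (Pos m)) := by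
  let T : Finset (Pos m) := Finset.univ.image fun i => (k, i)
  have hTc : T.card = m := by
    rw [Finset.card_image_of_injective _ (Prod.mk_right_injective k), Finset.card_univ,
      Fintype.card_fin]
  obtain ⟨S, hS, hSc⟩ : ∃ S ⊆ Finset.univ.filter fun p => v p ≠ 0, S.card = t + 1 :=
    Finset.exists_subset_card_eq hv
  -- if the check passes, no position of the error comes from a trap
  have hle : (Finset.univ.filter fun π : Equiv.Perm (Pos m) => Passes π (k, v)).card ≤
      (avoiding S T).card := by
    refine Finset.card_le_card_of_injOn (fun π => π⁻¹) ?_ fun _ _ _ _ h => inv_injective h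
    intro π hπ
    simp only [Finset.coe_filter, Finset.mem_univ, true_and, Set.mem_ofPred_eq, avoiding] at hπ ⊢
    intro p hp hpT
    obtain ⟨i, -, hi⟩ := Finset.mem_image.1 hpT
    have h1 : v (π (k, i)) = 0 := congrFun hπ i
    have h2 : π (k, i) = p := by rw [hi]; simp
    rw [h2] at h1
    exact (Finset.mem_filter.1 (hS hp)).2 h1
  have h1 := three_pow_mul_card_avoiding S T (by
    rw [Finset.card_compl, hTc, Fintype.card_prod, Fintype.card_fin, Fintype.card_fin]
    omega) (by rw [hTc]; exact hm)
  rw [hSc] at h1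
  have h2 : (3 : ℝ) ^ (t + 1) * (avoiding S T).card ≤
      2 ^ (t + 1) * Fintype.card (Equiv.Perm (Pos m)) := by
    rw [Fintype.card_perm]
    exact_mod_cast h1
  rw [div_pow, div_mul_eq_mul_div, le_div_iff₀ (by positivity)]
  calc _ ≤ ((avoiding S T).card : ℝ) * 3 ^ (t + 1) := by gcongr
    _ ≤ _ := by rw [mul_comm]; exact h2

end TC

/-! ### The Pauli twirl -/

section Twirl

variable {m n : ℕ}

/-- The Pauli operator `X^x Z^z` on the blocks of all wires. -/
def pauliN (x z : Fin n → BlockLabel m) : Matrix (Fin n → BlockLabel m) (Fin n → BlockLabel m) ℂ :=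
  tensM fun k => pauli (x k) (z k)

/-- The character `(-1)^(z ⬝ v)` of the labels of all blocks. -/
def signN (z v : Fin n → BlockLabel m) : ℂ := sign (∑ k, z k ⬝ᵥ v k)

theorem signN_comm (z v : Fin n → BlockLabel m) : signN z v = signN v z := by
  simp only [signN, dotProduct_comm]

theorem signN_add (z v w : Fin n → BlockLabel m) : signN z (v + w) = signN z v * signN z w := by
  simp only [signN, Pi.add_apply, dotProduct_add, Finset.sum_add_distrib, sign_add]

theorem star_signN (z v : Fin n → BlockLabel m) : star (signN z v) = signN z v := star_sign _

theorem sum_signN (v : Fin n → BlockLabel m) :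
    ∑ z, signN z v = if v = 0 then (Fintype.card (Fin n → BlockLabel m) : ℂ) else 0 := by
  split_ifs with h
  · subst h
    simp [signN, sign_zero]
  · obtain ⟨k, hk⟩ : ∃ k, v k ≠ 0 := by
      by_contra! hc
      exact h (funext hc)
    obtain ⟨p, hp⟩ : ∃ p, v k p ≠ 0 := by
      by_contra! hc
      exact hk (funext hc)
    refine sum_eq_zero_of_shift _ (Pi.single k (Pi.single p 1)) fun z => ?_
    rw [signN_comm, signN_add, signN_comm v z]
    have : signN v (Pi.single k (Pi.single p 1)) = -1 := by
      rw [signN, Finset.sum_eq_single k]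
      · rw [Pi.single_eq_same, dotProduct_single, mul_one, (bit_cases (v k p)).resolve_left hp,
          sign_one]
      · intro l _ hl
        rw [Pi.single_eq_of_ne hl, dotProduct_zero]
      · simp
    rw [this]
    ring

theorem pauliN_apply (x z u v : Fin n → BlockLabel m) :
    pauliN x z u v = if u = v + x then signN z v else 0 := by
  simp only [pauliN, tensM_apply, pauli_apply]
  rw [Finset.prod_ite_zero, signN, sign_sum]
  simp [funext_iff]

theorem addN_add_self (v x : Fin n → BlockLabel m) : v + x + x = v := by
  rw [add_assoc, ZModModule.add_self, add_zero]

theorem pauliN_unitary (x z : Fin n → BlockLabel m) : (pauliN x z)ᴴ * pauliN x z = 1 := by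
  rw [pauliN, tensM_conjTranspose, tensM_mul, ← tensM_one]
  exact congrArg tensM (funext fun k => pauli_unitary _ _)

theorem conj_pauliN_conjTranspose (x z : Fin n → BlockLabel m) :
    conj (pauliN x z)ᴴ = conj (pauliN x z) := by
  rw [pauliN, tensM_conjTranspose]
  simp_rw [pauli_conjTranspose]
  rw [tensM_smul, conj_smul_of_norm]
  rw [← sign_sum, sign_mul_star]

/-- Conjugation of an operator by the Pauli operator `X^x Z^z`. -/
def pauliConj (x z : Fin n → BlockLabel m) (G : Matrix (Fin n → BlockLabel m) (Fin n → BlockLabel m) ℂ) :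
    Matrix (Fin n → BlockLabel m) (Fin n → BlockLabel m) ℂ :=
  (pauliN x z)ᴴ * (G * pauliN x z)

theorem pauliConj_apply (x z : Fin n → BlockLabel m)
    (G : Matrix (Fin n → BlockLabel m) (Fin n → BlockLabel m) ℂ) (v u : Fin n → BlockLabel m) :
    pauliConj x z G v u = signN z v * G (v + x) (u + x) * signN z u := by
  rw [pauliConj]
  rw [Matrix.mul_apply, Finset.sum_eq_single (v + x)]
  · rw [Matrix.conjTranspose_apply, pauliN_apply, if_pos rfl, star_signN, Matrix.mul_apply,
      Finset.sum_eq_single (u + x)]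
    · rw [pauliN_apply, if_pos rfl, mul_assoc]
    · intro w _ hw
      rw [pauliN_apply, if_neg hw, mul_zero]
    · simp
  · intro w _ hw
    rw [Matrix.conjTranspose_apply, pauliN_apply, if_neg hw, star_zero, zero_mul]
  · simp

/-- The coefficient of `X^a Z^b` in the expansion of an operator into Pauli operators. -/
def pauliCoeff (G : Matrix (Fin n → BlockLabel m) (Fin n → BlockLabel m) ℂ)
    (a b : Fin n → BlockLabel m) : ℂ :=
  (Fintype.card (Fin n → BlockLabel m) : ℂ)⁻¹ * ∑ y, G (y + a) y * signN b y

theorem card_labels_ne_zero : (Fintype.card (Fin n → BlockLabel m) : ℂ) ≠ 0 := by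
  exact_mod_cast Fintype.card_ne_zero

theorem labels_add_eq_zero_iff (v w : Fin n → BlockLabel m) : v + w = 0 ↔ v = w := by
  rw [add_eq_zero_iff_eq_neg, ZModModule.neg_eq_self]

/-- Orthogonality of characters, for the products of two Pauli coefficients. -/
theorem sum_signN_mul_pauliCoeff
    (G G' : Matrix (Fin n → BlockLabel m) (Fin n → BlockLabel m) ℂ)
    (a w : Fin n → BlockLabel m) :
    ∑ b, signN b w * (pauliCoeff G a b * star (pauliCoeff G' a b)) =
      (Fintype.card (Fin n → BlockLabel m) : ℂ)⁻¹ *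
        ∑ y, G (y + a) y * star (G' (y + w + a) (y + w)) := by
  have h1 : ∀ b, signN b w * (pauliCoeff G a b * star (pauliCoeff G' a b)) =
      ∑ y, ∑ y', ((Fintype.card (Fin n → BlockLabel m) : ℂ)⁻¹ *
        (Fintype.card (Fin n → BlockLabel m) : ℂ)⁻¹ * (G (y + a) y * star (G' (y' + a) y'))) *
          signN b (w + y + y') := by
    intro b
    have hstar : star ((Fintype.card (Fin n → BlockLabel m) : ℂ)⁻¹) =
        (Fintype.card (Fin n → BlockLabel m) : ℂ)⁻¹ := by simp
    rw [pauliCoeff, pauliCoeff, star_mul', hstar, star_sum, mul_mul_mul_comm, Finset.sum_mul_sum,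
      Finset.mul_sum, Finset.mul_sum]
    refine Finset.sum_congr rfl fun y _ => ?_
    rw [Finset.mul_sum, Finset.mul_sum]
    refine Finset.sum_congr rfl fun y' _ => ?_
    rw [star_mul', star_signN, signN_add, signN_add]
    ring
  simp_rw [h1]
  rw [Finset.sum_comm, Finset.mul_sum]
  refine Finset.sum_congr rfl fun y _ => ?_
  rw [Finset.sum_comm, Finset.sum_eq_single (y + w)]
  · rw [← Finset.mul_sum, sum_signN, if_pos]
    · field_simp [card_labels_ne_zero (m := m) (n := n)]
    · rw [labels_add_eq_zero_iff, add_comm]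
  · intro y' _ hy
    rw [← Finset.mul_sum, sum_signN, if_neg, mul_zero]
    rw [labels_add_eq_zero_iff, add_comm w]
    exact fun e => hy e.symm
  · simp

/-- Twirling with random Pauli operators turns an operator into a mixture of Pauli operators:
the cross terms of its Pauli expansion cancel. -/
theorem pauli_twirl (G G' : Matrix (Fin n → BlockLabel m) (Fin n → BlockLabel m) ℂ)
    (v u v' u' : Fin n → BlockLabel m) :
    ∑ x : Fin n → BlockLabel m, ∑ z : Fin n → BlockLabel m, pauliConj x z G v u *
        star (pauliConj x z G' v' u') =
      (Fintype.card (Fin n → BlockLabel m) : ℂ) ^ 2 * ∑ a, ∑ b,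
        pauliCoeff G a b * star (pauliCoeff G' a b) * (pauliN a b v u * star (pauliN a b v' u')) := by
  -- the sum over `z` of the signs vanishes unless `v + u = v' + u'`
  have hL : ∀ x, ∑ z : Fin n → BlockLabel m, pauliConj x z G v u *
        star (pauliConj x z G' v' u') =
      G (v + x) (u + x) * star (G' (v' + x) (u' + x)) *
        if v + u + v' + u' = 0 then (Fintype.card (Fin n → BlockLabel m) : ℂ) else 0 := by
    intro x
    rw [← sum_signN, Finset.mul_sum]
    refine Finset.sum_congr rfl fun z _ => ?_
    rw [pauliConj_apply, pauliConj_apply, star_mul', star_mul', star_signN, star_signN,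
      signN_add, signN_add, signN_add]
    ring
  simp_rw [hL]
  -- only `X^(u+v)` has a nonzero entry at `(v, u)`
  rw [Finset.sum_eq_single (u + v) (f := fun a => ∑ b, _)]
  · have hP : ∀ b, pauliN (u + v) b v u = signN b u := by
      intro b
      rw [pauliN_apply, if_pos]
      rw [← add_assoc, ZModModule.add_self, zero_add]
    have hP' : ∀ b, pauliN (u + v) b v' u' = if v + u + v' + u' = 0 then signN b u' else 0 := by
      intro b
      rw [pauliN_apply]
      refine if_congr ?_ rfl rfl
      have : v + u + v' + u' = v' + (u' + (u + v)) := by abel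
      rw [this, labels_add_eq_zero_iff]
    simp_rw [hP, hP']
    split_ifs with h
    · have hv' : v' = u' + (u + v) := by
        have : v + u + v' + u' = v' + (u' + (u + v)) := by abel
        rwa [this, labels_add_eq_zero_iff] at h
      have hterm : ∀ b, pauliCoeff G (u + v) b * star (pauliCoeff G' (u + v) b) *
          (signN b u * star (signN b u')) =
          signN b (u + u') * (pauliCoeff G (u + v) b * star (pauliCoeff G' (u + v) b)) := by
        intro b
        rw [star_signN, signN_add]
        ring
      simp_rw [hterm]
      rw [sum_signN_mul_pauliCoeff, ← Finset.sum_mul, ← Equiv.sum_comp (Equiv.addRight u)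
        (fun y => G (y + (u + v)) y * star (G' (y + (u + u') + (u + v)) (y + (u + u')))), sq]
      have hc := card_labels_ne_zero (m := m) (n := n)
      field_simp
      refine Finset.sum_congr rfl fun x _ => ?_
      rw [Equiv.coe_addRight]
      have e1 : x + u + (u + v) = v + x := by
        rw [← add_assoc, addN_add_self, add_comm]
      have e2 : x + u + (u + u') = u' + x := by
        rw [← add_assoc, addN_add_self, add_comm]
      have e3 : x + u + (u + u') + (u + v) = v' + x := by
        rw [e2, hv']; abel
      rw [e1, e3, e2, add_comm u x]
    · simp
  · intro a _ ha
    refine Finset.sum_eq_zero fun b _ => ?_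
    have : ¬ v = u + a := by
      rintro rfl
      exact ha (by rw [← add_assoc, ZModModule.add_self, zero_add])
    rw [pauliN_apply, if_neg this, zero_mul, mul_zero]
  · simp

/-- Parseval's identity for the Pauli expansion. -/
theorem sum_pauliCoeff (G : Matrix (Fin n → BlockLabel m) (Fin n → BlockLabel m) ℂ) :
    ∑ a, ∑ b, pauliCoeff G a b * star (pauliCoeff G a b) =
      (Fintype.card (Fin n → BlockLabel m) : ℂ)⁻¹ * ∑ u, ∑ v, G v u * star (G v u) := by
  have h : ∀ a, ∑ b, pauliCoeff G a b * star (pauliCoeff G a b) =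
      (Fintype.card (Fin n → BlockLabel m) : ℂ)⁻¹ * ∑ y, G (y + a) y * star (G (y + a) y) := by
    intro a
    have := sum_signN_mul_pauliCoeff G G a 0
    simpa [signN, sign_zero] using this
  simp_rw [h]
  rw [← Finset.mul_sum, Finset.sum_comm]
  congr 1
  refine Finset.sum_congr rfl fun y _ => ?_
  exact Equiv.sum_comp (Equiv.addLeft y) fun v => G v y * star (G v y)

/-- An identity between double sums of coefficients passes to linear combinations. -/
theorem sum_sum_eq_of_expansion {V U : Type} [Fintype V] [Fintype U] (f g : V → V → ℂ)
    (e : U → U → ℂ) (T S : V → V → U → U → ℂ) (d : ℂ) (hf : ∀ x z, f x z = ∑ u, ∑ u', e u u' * T x z u u')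
    (hg : ∀ a b, g a b = ∑ u, ∑ u', e u u' * S a b u u')
    (h : ∀ u u', ∑ x, ∑ z, T x z u u' = d * ∑ a, ∑ b, S a b u u') :
    ∑ x, ∑ z, f x z = d * ∑ a, ∑ b, g a b := by
  have hswap : ∀ T : V → V → U → U → ℂ,
      ∑ x, ∑ z, ∑ u, ∑ u', e u u' * T x z u u' = ∑ u, ∑ u', e u u' * ∑ x, ∑ z, T x z u u' := by
    intro T
    simp_rw [Finset.mul_sum]
    simp_rw [Finset.sum_comm (s := Finset.univ) (t := Finset.univ)
      (f := fun z u => ∑ u', e u u' * T _ z u u')]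
    rw [Finset.sum_comm]
    refine Finset.sum_congr rfl fun u _ => ?_
    simp_rw [Finset.sum_comm (s := Finset.univ) (t := Finset.univ)
      (f := fun z u' => e u u' * T _ z u u')]
    rw [Finset.sum_comm]
  simp_rw [hf, hg]
  rw [hswap, hswap, Finset.mul_sum]
  refine Finset.sum_congr rfl fun u _ => ?_
  rw [Finset.mul_sum]
  refine Finset.sum_congr rfl fun u' _ => ?_
  rw [h, mul_left_comm]

theorem mul_apply_mul_star_mul_apply {V D : Type} [Fintype V] (E : Matrix V D ℂ)
    (N N' : Matrix V V ℂ) (v v' : V) (c c' : D) :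
    (N * E) v c * star ((N' * E) v' c') =
      ∑ u, ∑ u', (E u c * star (E u' c')) * (N v u * star (N' v' u')) := by
  rw [Matrix.mul_apply, Matrix.mul_apply, star_sum, Finset.sum_mul_sum]
  refine Finset.sum_congr rfl fun u _ => Finset.sum_congr rfl fun u' _ => ?_
  rw [star_mul']
  ring

/-- The twirl of an operator that is applied to encoded states. -/
theorem pauli_twirl_mul {D : Type}
    (G G' : Matrix (Fin n → BlockLabel m) (Fin n → BlockLabel m) ℂ)
    (E : Matrix (Fin n → BlockLabel m) D ℂ) (v v' : Fin n → BlockLabel m) (c c' : D) :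
    ∑ x : Fin n → BlockLabel m, ∑ z : Fin n → BlockLabel m,
        (pauliConj x z G * E : Matrix (Fin n → BlockLabel m) D ℂ) v c *
        star ((pauliConj x z G' * E : Matrix (Fin n → BlockLabel m) D ℂ) v' c') =
      (Fintype.card (Fin n → BlockLabel m) : ℂ) ^ 2 *
        ∑ a : Fin n → BlockLabel m, ∑ b : Fin n → BlockLabel m,
        pauliCoeff G a b * star (pauliCoeff G' a b) *
          ((pauliN a b * E : Matrix (Fin n → BlockLabel m) D ℂ) v c *
            star ((pauliN a b * E : Matrix (Fin n → BlockLabel m) D ℂ) v' c')) := by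
  refine sum_sum_eq_of_expansion _ _ (fun u u' => E u c * star (E u' c'))
    (fun x z u u' => pauliConj x z G v u * star (pauliConj x z G' v' u'))
    (fun a b u u' => pauliCoeff G a b * star (pauliCoeff G' a b) *
      (pauliN a b v u * star (pauliN a b v' u'))) _ (fun x z => ?_) (fun a b => ?_)
    (fun u u' => pauli_twirl G G' v u v' u')
  · exact mul_apply_mul_star_mul_apply E _ _ v v' c c'
  · rw [mul_apply_mul_star_mul_apply E _ _ v v' c c', Finset.mul_sum]
    refine Finset.sum_congr rfl fun u _ => ?_
    rw [Finset.mul_sum]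
    exact Finset.sum_congr rfl fun u' _ => mul_left_comm _ _ _

end Twirl

/-! ### Pure states and the attack operators -/

/-- The rank-one operator `|ψ⟩⟨ψ|`. -/
def ketbra {A : Type} (ψ : A → ℂ) : Matrix A A ℂ := Matrix.vecMulVec ψ (star ψ)

section Ketbra

variable {A B D : Type}

theorem ketbra_apply (ψ : A → ℂ) (p q : A) : ketbra ψ p q = ψ p * star (ψ q) := rfl

theorem posSemidef_ketbra [Finite A] (ψ : A → ℂ) : (ketbra ψ).PosSemidef :=
  posSemidef_vecMulVec_self_star ψ

theorem conj_ketbra [Fintype A] (K : Matrix B A ℂ) (ψ : A → ℂ) :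
    conj K (ketbra ψ) = ketbra (K *ᵥ ψ) := by
  rw [conj_apply, ketbra, Matrix.mul_vecMulVec, Matrix.vecMulVec_mul, ketbra, Matrix.star_mulVec]

theorem single_eq_ketbra [DecidableEq A] (a : A) :
    Matrix.single a a (1 : ℂ) = ketbra (Pi.single a 1) := by
  ext p q
  rw [ketbra_apply, Matrix.single_apply, Pi.single_apply, Pi.single_apply]
  by_cases hp : p = a <;> by_cases hq : q = a <;> simp [hp, hq, eq_comm (a := a)]

theorem conj_single [Fintype A] [DecidableEq A] (K : Matrix B A ℂ) (a : A) :
    conj K (Matrix.single a a 1) = ketbra fun b => K b a := by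
  rw [single_eq_ketbra, conj_ketbra]
  congr 1
  funext b
  simp

theorem ampK_mulVec_apply [Fintype A] [Fintype B] {E : Type} [Fintype E] [DecidableEq E] (K : Matrix B A ℂ)
    (ψ : A × E → ℂ) (p : B × E) : (ampK K E *ᵥ ψ) p = ∑ a, K p.1 a * ψ (a, p.2) := by
  have := ampK_mul_apply K (Matrix.of fun q (_ : Unit) => ψ q) p ()
  exact this

theorem amp_conj_ketbra [Fintype A] [Fintype B] {E : Type} [Fintype E] (K : Matrix B A ℂ)
    (ψ : A × E → ℂ) :
    (conj K).amp E (ketbra ψ) = ketbra fun p : B × E => ∑ a, K p.1 a * ψ (a, p.2) := by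
  classical
  rw [amp_conj, conj_ketbra]
  congr 1
  funext p
  exact ampK_mulVec_apply K ψ p

theorem trace_ketbra [Fintype A] (ψ : A → ℂ) : (ketbra ψ).trace = ∑ a, ψ a * star (ψ a) := rfl

end Ketbra

/-- A sum over the labels of all qubits is a sum over the labels of the two rounds. -/
theorem sum_append {n₁ n₂ : ℕ} {X : Type} [Fintype X] {M : Type} [AddCommMonoid M]
    (f : (Fin n₁ → X) → (Fin n₂ → X) → M) :
    ∑ w : Fin (n₁ + n₂) → X, f (w ∘ Fin.castAdd n₂) (w ∘ Fin.natAdd n₁) = ∑ w₁, ∑ w₂, f w₁ w₂ := by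
  rw [← Fintype.sum_prod_type' f]
  refine Fintype.sum_equiv (Fin.appendEquiv n₁ n₂).symm _ _ fun w => ?_
  rfl

section Attack

variable {n₁ n₂ : ℕ} {X R₀ R₁ R₂ : Type} [Fintype X] [Fintype R₀] [Fintype R₁]

/-- The operator by which the first three algorithms of an adversary, for fixed Kraus branches,
act on the ciphertexts of all blocks, when the plaintexts are `b` and the side register ends in
`r`. -/
def attack (K₂ : Matrix ((Fin (n₁ + n₂) → X) × R₂) ((Fin n₂ → X) × R₁) ℂ)
    (K₁ : Matrix ((Fin n₂ → Bit) × R₁) ((Fin n₁ → X) × R₀) ℂ) (φ : (Fin n₁ → Bit) × R₀ → ℂ)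
    (b : Fin (n₁ + n₂) → Bit) (r : R₂) : Matrix (Fin (n₁ + n₂) → X) (Fin (n₁ + n₂) → X) ℂ :=
  Matrix.of fun v w => ∑ r₁, ∑ r₀, K₂ (v, r) (w ∘ Fin.natAdd n₁, r₁) *
    (K₁ (b ∘ Fin.natAdd n₁, r₁) (w ∘ Fin.castAdd n₂, r₀) * φ (b ∘ Fin.castAdd n₂, r₀))

/-- The operator on the qubits of both rounds that acts as `E₁` on those of the first round and as
`E₂` on those of the second. -/
def glue {Y : Type} (E₁ : Matrix (Fin n₁ → X) (Fin n₁ → Y) ℂ)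
    (E₂ : Matrix (Fin n₂ → X) (Fin n₂ → Y) ℂ) :
    Matrix (Fin (n₁ + n₂) → X) (Fin (n₁ + n₂) → Y) ℂ :=
  Matrix.of fun w b => E₁ (w ∘ Fin.castAdd n₂) (b ∘ Fin.castAdd n₂) *
    E₂ (w ∘ Fin.natAdd n₁) (b ∘ Fin.natAdd n₁)

variable (K₂ : Matrix ((Fin (n₁ + n₂) → X) × R₂) ((Fin n₂ → X) × R₁) ℂ)
    (K₁ : Matrix ((Fin n₂ → Bit) × R₁) ((Fin n₁ → X) × R₀) ℂ) (φ : (Fin n₁ → Bit) × R₀ → ℂ)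
    (E₁ : Matrix (Fin n₁ → X) (Fin n₁ → Bit) ℂ) (E₂ : Matrix (Fin n₂ → X) (Fin n₂ → Bit) ℂ)

/-- The attack on the encrypted plaintexts. -/
theorem sum_attack_mul_glue (p : (Fin (n₁ + n₂) → X) × R₂) :
    (K₂ *ᵥ fun p₃ => ∑ b₂, E₂ p₃.1 b₂ *
      (K₁ *ᵥ fun p₁ => ∑ b₁, E₁ p₁.1 b₁ * φ (b₁, p₁.2)) (b₂, p₃.2)) p =
    ∑ b, (attack K₂ K₁ φ b p.2 * glue E₁ E₂) p.1 b := by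
  have hR : ∀ b : Fin (n₁ + n₂) → Bit, (attack K₂ K₁ φ b p.2 * glue E₁ E₂) p.1 b =
      ∑ w₁, ∑ w₂, ∑ r₁, ∑ r₀, K₂ p (w₂, r₁) * (E₂ w₂ (b ∘ Fin.natAdd n₁) *
        (K₁ (b ∘ Fin.natAdd n₁, r₁) (w₁, r₀) * (E₁ w₁ (b ∘ Fin.castAdd n₂) *
          φ (b ∘ Fin.castAdd n₂, r₀)))) := by
    intro b
    rw [Matrix.mul_apply, ← sum_append]
    refine Finset.sum_congr rfl fun w _ => ?_
    rw [attack, glue, Matrix.of_apply, Matrix.of_apply, Finset.sum_mul]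
    refine Finset.sum_congr rfl fun r₁ _ => ?_
    rw [Finset.sum_mul]
    refine Finset.sum_congr rfl fun r₀ _ => ?_
    ring
  simp_rw [hR]
  rw [sum_append (fun b₁ b₂ => ∑ w₁, ∑ w₂, ∑ r₁, ∑ r₀, K₂ p (w₂, r₁) * (E₂ w₂ b₂ *
        (K₁ (b₂, r₁) (w₁, r₀) * (E₁ w₁ b₁ * φ (b₁, r₀)))))]
  simp only [Matrix.mulVec, dotProduct, Finset.mul_sum, Fintype.sum_prod_type]
  simp only [← Fintype.sum_prod_type']
  exact Finset.sum_nbij'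
    (fun ⟨w₂, r₁, b₂, w₁, r₀, b₁⟩ => (b₁, b₂, w₁, w₂, r₁, r₀))
    (fun ⟨b₁, b₂, w₁, w₂, r₁, r₀⟩ => (w₂, r₁, b₂, w₁, r₀, b₁))
    (fun _ _ => mem_univ _) (fun _ _ => mem_univ _) (fun _ _ => rfl) (fun _ _ => rfl) (fun _ _ => rfl)

/-- The attack when zeros are encrypted and the plaintexts are kept aside. -/
theorem attack_mul_glue_zero (p : (Fin (n₁ + n₂) → X) × R₂) (b : Fin (n₁ + n₂) → Bit) :
    (K₂ *ᵥ fun p₃ => E₂ p₃.1 0 *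
      (K₁ *ᵥ fun p₁ => E₁ p₁.1 0 * φ (b ∘ Fin.castAdd n₂, p₁.2)) (b ∘ Fin.natAdd n₁, p₃.2)) p =
    (attack K₂ K₁ φ b p.2 * glue E₁ E₂) p.1 0 := by
  have hR : (attack K₂ K₁ φ b p.2 * glue E₁ E₂) p.1 0 =
      ∑ w₁, ∑ w₂, ∑ r₁, ∑ r₀, K₂ p (w₂, r₁) * (E₂ w₂ 0 *
        (K₁ (b ∘ Fin.natAdd n₁, r₁) (w₁, r₀) * (E₁ w₁ 0 *
          φ (b ∘ Fin.castAdd n₂, r₀)))) := by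
    rw [Matrix.mul_apply, ← sum_append]
    refine Finset.sum_congr rfl fun w _ => ?_
    rw [attack, glue, Matrix.of_apply, Matrix.of_apply, Finset.sum_mul]
    refine Finset.sum_congr rfl fun r₁ _ => ?_
    rw [Finset.sum_mul]
    refine Finset.sum_congr rfl fun r₀ _ => ?_
    rw [Pi.zero_comp, Pi.zero_comp]
    ring
  rw [hR]
  simp only [Matrix.mulVec, dotProduct, Finset.mul_sum, Fintype.sum_prod_type]
  simp only [← Fintype.sum_prod_type']
  exact Finset.sum_nbij'
    (fun ⟨w₂, r₁, w₁, r₀⟩ => (w₁, w₂, r₁, r₀))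
    (fun ⟨w₁, w₂, r₁, r₀⟩ => (w₂, r₁, w₁, r₀))
    (fun _ _ => mem_univ _) (fun _ _ => mem_univ _) (fun _ _ => rfl) (fun _ _ => rfl) (fun _ _ => rfl)

end Attack

section Complete

variable {A B κ : Type} [Fintype A] [Fintype B] [Fintype κ]

/-- A complete family of Kraus operators preserves the norm of vectors. -/
theorem sum_mulVec_mul_star [DecidableEq A] (K : κ → Matrix B A ℂ) (hK : ∑ k, (K k)ᴴ * K k = 1)
    (ψ : A → ℂ) :
    ∑ k, ∑ b, (K k *ᵥ ψ) b * star ((K k *ᵥ ψ) b) = ∑ a, ψ a * star (ψ a) := by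
  have h := isTP_sum_conj K hK (ketbra ψ)
  rw [LinearMap.sum_apply, Matrix.trace_sum] at h
  simp_rw [conj_ketbra, trace_ketbra] at h
  exact h

variable {n₁ n₂ : ℕ} {X R₀ R₁ R₂ κ₂ κ₁ κ₀ : Type} [Fintype X] [Fintype R₀] [Fintype R₁]
  [Fintype R₂] [Fintype κ₂] [Fintype κ₁] [Fintype κ₀] [DecidableEq X] [DecidableEq R₀]
  [DecidableEq R₁]

/-- The total Hilbert-Schmidt norm of the attack operators. -/
theorem sum_attack (K₂ : κ₂ → Matrix ((Fin (n₁ + n₂) → X) × R₂) ((Fin n₂ → X) × R₁) ℂ)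
    (K₁ : κ₁ → Matrix ((Fin n₂ → Bit) × R₁) ((Fin n₁ → X) × R₀) ℂ)
    (φ : κ₀ → (Fin n₁ → Bit) × R₀ → ℂ) (h₂ : ∑ k, (K₂ k)ᴴ * K₂ k = 1)
    (h₁ : ∑ k, (K₁ k)ᴴ * K₁ k = 1) (h₀ : ∑ k, ∑ p, φ k p * star (φ k p) = 1) :
    ∑ j, ∑ l, ∑ k, ∑ b, ∑ r, ∑ w, ∑ v, attack (K₂ j) (K₁ l) (φ k) b r v w *
      star (attack (K₂ j) (K₁ l) (φ k) b r v w) = Fintype.card (Fin (n₁ + n₂) → X) := by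
  -- `ξ` and `η` are the states of the adversary after its second and before its third algorithm,
  -- when the plaintexts `b` and the ciphertexts `w` are given
  let ξ (l : κ₁) (k : κ₀) (b₁ : Fin n₁ → Bit) (w₁ : Fin n₁ → X) : (Fin n₂ → Bit) × R₁ → ℂ :=
    K₁ l *ᵥ fun p => if p.1 = w₁ then φ k (b₁, p.2) else 0
  let η (l : κ₁) (k : κ₀) (b₁ : Fin n₁ → Bit) (b₂ : Fin n₂ → Bit) (w₁ : Fin n₁ → X)
    (w₂ : Fin n₂ → X) : (Fin n₂ → X) × R₁ → ℂ :=
      fun p => if p.1 = w₂ then ξ l k b₁ w₁ (b₂, p.2) else 0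
  have hatt : ∀ j l k b r v w, attack (K₂ j) (K₁ l) (φ k) b r v w =
      (K₂ j *ᵥ η l k (b ∘ Fin.castAdd n₂) (b ∘ Fin.natAdd n₁) (w ∘ Fin.castAdd n₂)
        (w ∘ Fin.natAdd n₁)) (v, r) := by
    intro j l k b r v w
    simp only [attack, Matrix.of_apply, η, ξ, Matrix.mulVec, dotProduct, Fintype.sum_prod_type,
      mul_ite, mul_zero, Finset.mul_sum]
    rw [Finset.sum_eq_single (w ∘ Fin.natAdd n₁)]
    · refine Finset.sum_congr rfl fun r₁ _ => ?_
      rw [if_pos rfl, Finset.sum_eq_single (w ∘ Fin.castAdd n₂)]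
      · refine Finset.sum_congr rfl fun r₀ _ => ?_
        rw [if_pos rfl]
      · intro w₁ _ hw
        simp [hw]
      · simp
    · intro w₂ _ hw
      simp [hw]
    · simp
  have hη : ∀ l k b₁ b₂ w₁ w₂, ∑ p, η l k b₁ b₂ w₁ w₂ p * star (η l k b₁ b₂ w₁ w₂ p) =
      ∑ r₁, ξ l k b₁ w₁ (b₂, r₁) * star (ξ l k b₁ w₁ (b₂, r₁)) := by
    intro l k b₁ b₂ w₁ w₂
    rw [Fintype.sum_prod_type, Finset.sum_eq_single w₂]
    · simp [η]
    · intro w _ hw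
      simp [η, hw]
    · simp
  have hξ : ∀ k b₁ w₁, ∑ l, ∑ p, ξ l k b₁ w₁ p * star (ξ l k b₁ w₁ p) =
      ∑ r₀, φ k (b₁, r₀) * star (φ k (b₁, r₀)) := by
    intro k b₁ w₁
    rw [sum_mulVec_mul_star K₁ h₁, Fintype.sum_prod_type, Finset.sum_eq_single w₁]
    · simp
    · intro w _ hw
      simp [hw]
    · simp
  calc ∑ j, ∑ l, ∑ k, ∑ b, ∑ r, ∑ w, ∑ v, attack (K₂ j) (K₁ l) (φ k) b r v w *
        star (attack (K₂ j) (K₁ l) (φ k) b r v w)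
      = ∑ l, ∑ k, ∑ b : Fin (n₁ + n₂) → Bit, ∑ w : Fin (n₁ + n₂) → X, ∑ j, ∑ p,
          (K₂ j *ᵥ η l k (b ∘ Fin.castAdd n₂) (b ∘ Fin.natAdd n₁) (w ∘ Fin.castAdd n₂)
            (w ∘ Fin.natAdd n₁)) p *
          star ((K₂ j *ᵥ η l k (b ∘ Fin.castAdd n₂) (b ∘ Fin.natAdd n₁) (w ∘ Fin.castAdd n₂)
            (w ∘ Fin.natAdd n₁)) p) := by
        simp only [hatt]
        simp only [← Fintype.sum_prod_type']
        exact Finset.sum_nbij'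
          (fun ⟨j, l, k, b, r, w, v⟩ => (l, k, b, w, j, v, r))
          (fun ⟨l, k, b, w, j, v, r⟩ => (j, l, k, b, r, w, v))
          (fun _ _ => mem_univ _) (fun _ _ => mem_univ _) (fun _ _ => rfl) (fun _ _ => rfl) (fun _ _ => rfl)
    _ = ∑ l, ∑ k, ∑ b : Fin (n₁ + n₂) → Bit, ∑ w : Fin (n₁ + n₂) → X, ∑ r₁,
          ξ l k (b ∘ Fin.castAdd n₂) (w ∘ Fin.castAdd n₂) (b ∘ Fin.natAdd n₁, r₁) *
          star (ξ l k (b ∘ Fin.castAdd n₂) (w ∘ Fin.castAdd n₂) (b ∘ Fin.natAdd n₁, r₁)) := by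
        simp_rw [sum_mulVec_mul_star K₂ h₂, hη]
    _ = ∑ w : Fin (n₁ + n₂) → X, ∑ k, ∑ b₁, ∑ l, ∑ p,
          ξ l k b₁ (w ∘ Fin.castAdd n₂) p * star (ξ l k b₁ (w ∘ Fin.castAdd n₂) p) := by
        have : ∀ l k, ∑ b : Fin (n₁ + n₂) → Bit, ∑ w : Fin (n₁ + n₂) → X, ∑ r₁,
          ξ l k (b ∘ Fin.castAdd n₂) (w ∘ Fin.castAdd n₂) (b ∘ Fin.natAdd n₁, r₁) *
          star (ξ l k (b ∘ Fin.castAdd n₂) (w ∘ Fin.castAdd n₂) (b ∘ Fin.natAdd n₁, r₁)) =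
          ∑ b₁, ∑ b₂, ∑ w : Fin (n₁ + n₂) → X, ∑ r₁,
          ξ l k b₁ (w ∘ Fin.castAdd n₂) (b₂, r₁) *
          star (ξ l k b₁ (w ∘ Fin.castAdd n₂) (b₂, r₁)) := fun l k =>
            sum_append (fun b₁ b₂ => ∑ w : Fin (n₁ + n₂) → X, ∑ r₁,
              ξ l k b₁ (w ∘ Fin.castAdd n₂) (b₂, r₁) *
              star (ξ l k b₁ (w ∘ Fin.castAdd n₂) (b₂, r₁)))
        simp_rw [this]
        simp only [← Fintype.sum_prod_type']
        exact Finset.sum_nbij'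
          (fun ⟨l, k, b₁, b₂, w, r₁⟩ => (w, k, b₁, l, b₂, r₁))
          (fun ⟨w, k, b₁, l, b₂, r₁⟩ => (l, k, b₁, b₂, w, r₁))
          (fun _ _ => mem_univ _) (fun _ _ => mem_univ _) (fun _ _ => rfl) (fun _ _ => rfl) (fun _ _ => rfl)
    _ = ∑ w : Fin (n₁ + n₂) → X, (1 : ℂ) := by
        refine Finset.sum_congr rfl fun w _ => ?_
        simp_rw [hξ]
        rw [← h₀]
        exact Finset.sum_congr rfl fun k _ => (Fintype.sum_prod_type (f := fun p => φ k p * star (φ k p))).symm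
    _ = _ := by simp

end Complete

/-! ### The final states of the game -/

/-- The state that the verified decryption reads when the ciphertexts of the plaintexts `b` have
been changed by the operators `F b r`. -/
def realKet {V B R : Type} [Fintype V] [Fintype B] (F : B → R → Matrix V V ℂ) (E : Matrix V B ℂ)
    (p : V × R) : ℂ :=
  ∑ b, (F b p.2 * E) p.1 b

/-- The state that the verified decryption reads when zeros are encrypted; the plaintexts are the
content of the private register. -/
def idealKet {V B R : Type} [Fintype V] [Zero B] (F : B → R → Matrix V V ℂ) (E : Matrix V B ℂ)
    (p : B × R) (v : V) : ℂ :=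
  (F p.1 p.2 * E) v 0

namespace Adversary

variable {S : Scheme} {κ : ℕ} (A : Adversary S κ) (sk : S.Key κ A.n)
  (ε : S.Evk κ (A.n₁ + A.n₂) → ℂ)

/-- The attack operators in a Kraus branch of the adversary, for the evaluation key `ε`. -/
def attackOp (j : Fin A.A₂.size) (l : Fin A.A₁.size) (k : Fin A.A₀.size) :
    (Fin A.n → Bit) → Fin A.d₂ → Matrix (Fin A.n → S.Block κ) (Fin A.n → S.Block κ) ℂ :=
  attack (A.A₂.op j) (A.A₁.op l) (A.A₀.op k *ᵥ ε)

variable (E₁ : Matrix (Fin A.n₁ → S.Block κ) (Fin A.n₁ → Bit) ℂ)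
  (E₂ : Matrix (Fin A.n₂ → S.Block κ) (Fin A.n₂ → Bit) ℂ)

theorem start_eq (hε : S.evk sk = ketbra ε) :
    A.start sk = ∑ k, ketbra (A.A₀.op k *ᵥ ε) := by
  rw [start, hε, Instrument.map, LinearMap.sum_apply]
  exact Finset.sum_congr rfl fun k _ => conj_ketbra _ _

/-- The final state of the real game. -/
theorem real_eq (hε : S.evk sk = ketbra ε) (h₁ : A.enc₁ sk = conj E₁) (h₂ : A.enc₂ sk = conj E₂)
    (j : Fin A.A₂.size) (flag : Bool) :
    A.real sk j flag = ∑ l, ∑ k, (S.verDec sk (A.circ j) (A.log j) flag).amp (Fin A.d₂)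
      (ketbra (realKet (A.attackOp ε j l k) (glue E₁ E₂))) := by
  simp only [real]
  rw [h₁, h₂, A.start_eq sk ε hε, map_sum]
  simp_rw [amp_conj_ketbra]
  rw [Instrument.map, LinearMap.sum_apply]
  simp_rw [map_sum, conj_ketbra, amp_conj_ketbra, conj_ketbra]
  refine Finset.sum_congr rfl fun l _ => Finset.sum_congr rfl fun k _ => ?_
  congr 2
  funext p
  exact sum_attack_mul_glue _ _ _ _ _ p

/-- The final state of the ideal game. -/
theorem ideal_eq (hε : S.evk sk = ketbra ε) (h₁ : A.enc₁ sk = conj E₁) (h₂ : A.enc₂ sk = conj E₂)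
    (j : Fin A.A₂.size) (flag : Bool) :
    A.ideal sk j flag = ∑ l, ∑ k,
      (if flag then (A.circ j).channel else discardPrepare (A.circ j).Omega).amp (Fin A.d₂)
        (Matrix.of fun p q => (S.verDec sk (A.circ j) (A.log j) flag
          (Matrix.vecMulVec (idealKet (A.attackOp ε j l k) (glue E₁ E₂) p)
            (star (idealKet (A.attackOp ε j l k) (glue E₁ E₂) q)))).trace) := by
  have hi₁ : A.ideal₁ sk = ∑ k, ketbra fun p : ((Fin A.n₁ → S.Block κ) × Fin A.d₀) ×
      (Fin A.n₁ → Bit) => E₁ p.1.1 0 * (A.A₀.op k *ᵥ ε) (p.2, p.1.2) := by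
    rw [ideal₁, h₁, A.start_eq sk ε hε, zeroState, conj_single]
    ext p q
    rw [Matrix.of_apply, Matrix.sum_apply, Matrix.sum_apply, Finset.mul_sum]
    refine Finset.sum_congr rfl fun k _ => ?_
    rw [ketbra_apply, ketbra_apply, ketbra_apply, star_mul']
    ring
  have hi₂ : A.ideal₂ sk = ∑ l, ∑ k, ketbra fun p : ((Fin A.n₂ → S.Block κ) × Fin A.d₁) ×
      (Fin A.n → Bit) => E₂ p.1.1 0 * (A.A₁.op l *ᵥ fun p₁ => E₁ p₁.1 0 *
        (A.A₀.op k *ᵥ ε) (p.2 ∘ Fin.castAdd A.n₂, p₁.2)) (p.2 ∘ Fin.natAdd A.n₁, p.1.2) := by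
    simp only [ideal₂]
    rw [h₂, zeroState, conj_single, hi₁, Instrument.map, amp_sum, LinearMap.sum_apply]
    simp_rw [map_sum, amp_conj_ketbra]
    ext p q
    rw [Matrix.of_apply, Matrix.sum_apply, Matrix.sum_apply, Finset.mul_sum]
    refine Finset.sum_congr rfl fun l _ => ?_
    rw [Matrix.sum_apply, Matrix.sum_apply, Finset.mul_sum]
    refine Finset.sum_congr rfl fun k _ => ?_
    rw [ketbra_apply, ketbra_apply, ketbra_apply, star_mul']
    exact mul_mul_mul_comm _ _ _ _
  simp only [ideal]
  rw [hi₂, map_sum]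
  simp_rw [map_sum, amp_conj_ketbra]
  simp_rw [← map_sum]
  congr 1
  ext p q
  rw [Matrix.of_apply, Matrix.sum_apply]
  simp_rw [Matrix.sum_apply, Matrix.of_apply, ← Matrix.trace_sum, ← map_sum]
  congr 2
  ext v v'
  rw [Matrix.of_apply, Matrix.sum_apply]
  refine Finset.sum_congr rfl fun l _ => ?_
  rw [Matrix.sum_apply]
  refine Finset.sum_congr rfl fun k _ => ?_
  rw [ketbra_apply, Matrix.vecMulVec_apply, Pi.star_apply]
  have h := attack_mul_glue_zero (A.A₂.op j) (A.A₁.op l) (A.A₀.op k *ᵥ ε) E₁ E₂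
  exact congrArg₂ (fun a b => a * star b) (h (v, p.2) p.1) (h (v', q.2) q.1)

/-- The total weight of the attack operators over all Kraus branches. -/
theorem sum_attackOp (hε : ∑ e, ε e * star (ε e) = 1) :
    ∑ j, ∑ l, ∑ k, ∑ b, ∑ r, ∑ w, ∑ v, A.attackOp ε j l k b r v w *
      star (A.attackOp ε j l k b r v w) = Fintype.card (Fin A.n → S.Block κ) := by
  refine sum_attack A.A₂.op A.A₁.op _ A.A₂.complete A.A₁.complete ?_
  rw [sum_mulVec_mul_star A.A₀.op A.A₀.complete, hε]

end Adversary

/-! ### Averaging over the keys of the one-time pad -/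

/-- The two branches of the verified decryption whose accepting branch, before the wires that are no
outputs are traced out, is `T`. -/
def withFlag {n : ℕ} {A : Type} [Fintype A] (c : Circuit n) (T : SuperOp A (Fin n → Bit)) :
    Bool → SuperOp A c.Out
  | true => keepWires c.out ∘ₗ T
  | false => (Matrix.traceLinearMap A ℂ ℂ -
      Matrix.traceLinearMap (Fin n → Bit) ℂ ℂ ∘ₗ T).smulRight c.Omega

theorem withFlag_comp_conj {n : ℕ} {A B : Type} [Fintype A] [Fintype B] [DecidableEq B]
    (c : Circuit n) (T : SuperOp A (Fin n → Bit)) (K : Matrix A B ℂ) (hK : Kᴴ * K = 1)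
    (flag : Bool) : withFlag c (T ∘ₗ conj K) flag = withFlag c T flag ∘ₗ conj K := by
  cases flag with
  | true => rfl
  | false =>
    ext1 ρ
    have : (conj K ρ).trace = ρ.trace := isTP_conj K hK ρ
    simp [withFlag, this]

namespace TC

variable {m t n : ℕ} (Q : SelfDualCSS m t) (π : Equiv.Perm (Pos m)) (c : Circuit n)

/-- The isometry that encodes all qubits, without the one-time pad. -/
def encN (n : ℕ) : Matrix (Fin n → BlockLabel m) (Fin n → Bit) ℂ := tensM fun _ => encBlock Q π

theorem encN_isometry : (encN Q π n)ᴴ * encN Q π n = 1 := by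
  rw [encN, tensM_conjTranspose, tensM_mul, ← tensM_one]
  exact congrArg tensM (funext fun _ => encBlock_isometry Q π)

/-- The isometry that encrypts all qubits. -/
def encAll (x z : Fin n → BlockLabel m) : Matrix (Fin n → BlockLabel m) (Fin n → Bit) ℂ :=
  pauliN x z * encN Q π n

/-- Encoding, the Pauli error `X^x Z^z`, and verified decryption. -/
def pauliRun (x z : Fin n → BlockLabel m) : SuperOp (Fin n → Bit) (Fin n → Bit) :=
  evalAccept Q π c.gates x z ∅ 0 ∘ₗ conj (encN Q π n)

/-- The gates of the evaluation can be pulled out of the verified decryption, and the one-time pad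
acts as a Pauli operator in front of them. -/
theorem verDec_eq (x z : Fin n → BlockLabel m) (flag : Bool) :
    verDec Q (π, x, z) c flag = withFlag c (evalAccept Q π c.gates 0 0 ∅ 0) flag ∘ₗ
      conj ((pauliN x z)ᴴ * (evalU c.gates)ᴴ) := by
  have hU := evalU_unitary (m := m) c.gates ∅ c.wellFormed
  have hU' : evalU c.gates * (evalU c.gates)ᴴ =
      (1 : Matrix (Fin n → BlockLabel m) (Fin n → BlockLabel m) ℂ) := mul_eq_one_comm.mp hU
  have hP : pauliN x z * (pauliN x z)ᴴ = 1 := mul_eq_one_comm.mp (pauliN_unitary x z)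
  have hacc : accept Q π c.gates x z ∅ 0 = evalAccept Q π c.gates 0 0 ∅ 0 ∘ₗ
      conj ((pauliN x z)ᴴ * (evalU c.gates)ᴴ) := by
    rw [← conj_comp, conj_pauliN_conjTranspose, ← LinearMap.comp_assoc, pauliN,
      ← evalAccept_add Q π c.gates 0 0 x z ∅ 0 c.wellFormed, zero_add, zero_add,
      ← accept_comp_evalU Q π c.gates x z ∅ 0 c.wellFormed, LinearMap.comp_assoc, conj_comp, hU',
      conj_one, LinearMap.comp_id]
  have hiso : ((pauliN x z)ᴴ * (evalU c.gates)ᴴ)ᴴ * ((pauliN x z)ᴴ * (evalU c.gates)ᴴ) = 1 := by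
    rw [Matrix.conjTranspose_mul, Matrix.conjTranspose_conjTranspose,
      Matrix.conjTranspose_conjTranspose, Matrix.mul_assoc, ← Matrix.mul_assoc (pauliN x z), hP,
      Matrix.one_mul, hU']
  rw [← withFlag_comp_conj c _ _ hiso, ← hacc]
  cases flag <;> rfl

/-- The verified decryption of an encryption with the Pauli error `X^x Z^z`. -/
theorem withFlag_pauliRun (x z : Fin n → BlockLabel m) (flag : Bool) :
    withFlag c (pauliRun Q π c x z) flag =
      withFlag c (evalAccept Q π c.gates 0 0 ∅ 0) flag ∘ₗ conj (encAll Q π x z) := by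
  have hadd := evalAccept_add Q π c.gates 0 0 x z ∅ 0 c.wellFormed
  rw [zero_add, zero_add] at hadd
  rw [← withFlag_comp_conj, pauliRun, hadd, LinearMap.comp_assoc, ← pauliN, conj_comp,
    encAll]
  rw [encAll, Matrix.conjTranspose_mul, Matrix.mul_assoc, ← Matrix.mul_assoc (pauliN x z)ᴴ,
    pauliN_unitary, Matrix.one_mul, encN_isometry]

variable {R : Type} (F : (Fin n → Bit) → R → Matrix (Fin n → BlockLabel m) (Fin n → BlockLabel m) ℂ)

/-- The unnormalised state of the plaintexts and the side register in the branch in which the attack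
is the Pauli error `X^x Z^z` followed by the honest evaluation: the coefficients of `X^x Z^z` in the
attack operators with the evaluation undone. -/
def pauliKet (x z : Fin n → BlockLabel m) (p : (Fin n → Bit) × R) : ℂ :=
  pauliCoeff ((evalU c.gates)ᴴ * F p.1 p.2) x z

/-- In the real game, the random one-time pad leaves a mixture of Pauli errors on the encrypted
plaintexts. -/
theorem sum_verDec_realKet [Fintype R] (flag : Bool) :
    ∑ x, ∑ z, (verDec Q (π, x, z) c flag).amp R (ketbra (realKet F (encAll Q π x z))) =
      (Fintype.card (Fin n → BlockLabel m) : ℂ) ^ 2 • ∑ x, ∑ z,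
        (withFlag c (pauliRun Q π c x z) flag).amp R (ketbra (pauliKet c F x z)) := by
  simp_rw [verDec_eq, withFlag_pauliRun, amp_comp, LinearMap.comp_apply, amp_conj_ketbra]
  simp_rw [← map_sum]
  rw [← map_smul]
  congr 1
  have hket : ∀ x z (p : (Fin n → BlockLabel m) × R),
      ∑ v, ((pauliN x z)ᴴ * (evalU c.gates)ᴴ : Matrix (Fin n → BlockLabel m) _ ℂ) p.1 v *
        realKet F (encAll Q π x z) (v, p.2) =
      ∑ b, (pauliConj x z ((evalU c.gates)ᴴ * F b p.2) * encN Q π n :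
        Matrix (Fin n → BlockLabel m) (Fin n → Bit) ℂ) p.1 b := by
    intro x z p
    simp only [realKet, Finset.mul_sum]
    rw [Finset.sum_comm]
    refine Finset.sum_congr rfl fun b _ => ?_
    have : (pauliConj x z ((evalU c.gates)ᴴ * F b p.2) * encN Q π n :
        Matrix (Fin n → BlockLabel m) (Fin n → Bit) ℂ) =
        ((pauliN x z)ᴴ * (evalU c.gates)ᴴ) * (F b p.2 * encAll Q π x z) := by
      simp only [encAll, pauliConj, Matrix.mul_assoc]
    rw [this, Matrix.mul_apply]
  simp_rw [hket]
  ext p q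
  simp only [Matrix.sum_apply, Matrix.smul_apply, smul_eq_mul, ketbra_apply]
  refine sum_sum_eq_of_expansion (U := Fin n → Bit) _ _ (fun _ _ => 1)
    (fun x z b b' => (pauliConj x z ((evalU c.gates)ᴴ * F b p.2) * encN Q π n :
        Matrix (Fin n → BlockLabel m) (Fin n → Bit) ℂ) p.1 b *
      star ((pauliConj x z ((evalU c.gates)ᴴ * F b' q.2) * encN Q π n :
        Matrix (Fin n → BlockLabel m) (Fin n → Bit) ℂ) q.1 b'))
    (fun x z b b' => pauliCoeff ((evalU c.gates)ᴴ * F b p.2) x z *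
      star (pauliCoeff ((evalU c.gates)ᴴ * F b' q.2) x z) *
      (encAll Q π x z p.1 b *
        star (encAll Q π x z q.1 b')))
    _ (fun x z => ?_) (fun x z => ?_) (fun b b' => ?_)
  · simp only [one_mul, star_sum, Finset.sum_mul_sum]
  · simp only [one_mul, star_sum, Finset.sum_mul_sum]
    refine Finset.sum_congr rfl fun b _ => Finset.sum_congr rfl fun b' _ => ?_
    rw [pauliKet, pauliKet, star_mul']
    ring
  · exact pauli_twirl_mul _ _ _ _ _ _ _

/-- In the ideal game, the random one-time pad leaves a mixture of the same Pauli errors on encrypted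
zeros. -/
theorem sum_verDec_idealKet (flag : Bool) (p q : (Fin n → Bit) × R) :
    ∑ x, ∑ z, (verDec Q (π, x, z) c flag (Matrix.vecMulVec
        (idealKet F (encAll Q π x z) p)
        (star (idealKet F (encAll Q π x z) q)))).trace =
      (Fintype.card (Fin n → BlockLabel m) : ℂ) ^ 2 * ∑ x, ∑ z,
        (withFlag c (pauliRun Q π c x z) flag (zeroState (Fin n))).trace *
          ketbra (pauliKet c F x z) p q := by
  have hconj : ∀ (N : Matrix (Fin n → BlockLabel m) (Fin n → BlockLabel m) ℂ) f g,
      conj N (Matrix.vecMulVec f (star g)) = Matrix.vecMulVec (N *ᵥ f) (star (N *ᵥ g)) := by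
    intro N f g
    rw [conj_apply, Matrix.mul_vecMulVec, Matrix.vecMulVec_mul, Matrix.star_mulVec]
  have hket : ∀ x z (p : (Fin n → Bit) × R),
      ((pauliN x z)ᴴ * (evalU c.gates)ᴴ : Matrix (Fin n → BlockLabel m) _ ℂ) *ᵥ
        idealKet F (encAll Q π x z) p =
      fun v => (pauliConj x z ((evalU c.gates)ᴴ * F p.1 p.2) * encN Q π n :
        Matrix (Fin n → BlockLabel m) (Fin n → Bit) ℂ) v 0 := by
    intro x z p
    funext v
    have : (pauliConj x z ((evalU c.gates)ᴴ * F p.1 p.2) * encN Q π n :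
        Matrix (Fin n → BlockLabel m) (Fin n → Bit) ℂ) =
        ((pauliN x z)ᴴ * (evalU c.gates)ᴴ) * (F p.1 p.2 * encAll Q π x z) := by
      simp only [encAll, pauliConj, Matrix.mul_assoc]
    rw [this, Matrix.mul_apply]
    rfl
  simp_rw [verDec_eq, withFlag_pauliRun, LinearMap.comp_apply, hconj, hket, zeroState, conj_single]
  have htr : ∀ (a : ℂ) (ρ : Matrix (Fin n → BlockLabel m) (Fin n → BlockLabel m) ℂ),
      (withFlag c (evalAccept Q π c.gates 0 0 ∅ 0) flag ρ).trace * a =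
        (withFlag c (evalAccept Q π c.gates 0 0 ∅ 0) flag (a • ρ)).trace := by
    intro a ρ
    rw [map_smul, Matrix.trace_smul, smul_eq_mul, mul_comm]
  simp_rw [htr]
  rw [mul_comm]
  simp_rw [← Matrix.trace_sum, ← map_sum]
  rw [htr]
  congr 2
  ext v v'
  simp only [Matrix.sum_apply, Matrix.smul_apply, smul_eq_mul, ketbra_apply,
    Matrix.vecMulVec_apply, Pi.star_apply]
  exact pauli_twirl_mul _ _ _ _ _ _ _

/-- Parseval's identity for the states of all branches. -/
theorem sum_trace_ketbra_pauliKet [Fintype R] :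
    ∑ x, ∑ z, (ketbra (pauliKet c F x z)).trace =
      (Fintype.card (Fin n → BlockLabel m) : ℂ)⁻¹ *
        ∑ b, ∑ r, ∑ w, ∑ v, F b r v w * star (F b r v w) := by
  have hU := mul_eq_one_comm.mp (evalU_unitary (m := m) c.gates ∅ c.wellFormed)
  have hcol : ∀ b r w, ∑ v, ((evalU c.gates)ᴴ * F b r : Matrix (Fin n → BlockLabel m) (Fin n → BlockLabel m) ℂ) v w *
      star (((evalU c.gates)ᴴ * F b r : Matrix (Fin n → BlockLabel m) (Fin n → BlockLabel m) ℂ) v w) =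
      ∑ v, F b r v w * star (F b r v w) := by
    intro b r w
    have := sum_mulVec_mul_star (κ := Unit) (fun _ => (evalU (m := m) c.gates)ᴴ)
      (by simpa using hU) (fun v => F b r v w)
    rwa [Fintype.sum_unique] at this
  simp_rw [trace_ketbra, pauliKet]
  have hswap : ∀ f : (Fin n → BlockLabel m) → (Fin n → BlockLabel m) → (Fin n → Bit) × R → ℂ,
      ∑ x, ∑ z, ∑ p, f x z p = ∑ b, ∑ r, ∑ x, ∑ z, f x z (b, r) := by
    intro f
    simp only [← Fintype.sum_prod_type']
    exact Finset.sum_nbij' (fun ⟨x, z, b, r⟩ => (b, r, x, z)) (fun ⟨b, r, x, z⟩ => (x, z, b, r))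
      (fun _ _ => mem_univ _) (fun _ _ => mem_univ _) (fun _ _ => rfl) (fun _ _ => rfl)
      (fun _ _ => rfl)
  rw [hswap, Finset.mul_sum]
  refine Finset.sum_congr rfl fun b _ => ?_
  rw [Finset.mul_sum]
  refine Finset.sum_congr rfl fun r _ => ?_
  rw [sum_pauliCoeff]
  simp_rw [hcol]

end TC

/-! ### The winning probability in a single branch -/

theorem posSemidef_zeroState (ι : Type) [Fintype ι] [DecidableEq (ι → Bit)] :
    (zeroState ι).PosSemidef := by
  rw [zeroState, single_eq_ketbra]
  exact posSemidef_ketbra _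

theorem trace_zeroState (ι : Type) [Fintype ι] [DecidableEq ι] : (zeroState ι).trace = 1 := by
  rw [zeroState, Matrix.trace_single_eq_same]

section Branch

variable {n : ℕ} (c : Circuit n) {A R : Type} [Fintype A] [Fintype R]

theorem trace_withFlag (T : SuperOp A (Fin n → Bit)) (ρ : Matrix A A ℂ) :
    ∑ flag, (withFlag c T flag ρ).trace = ρ.trace := by
  have h : (c.Omega).trace = 1 := trace_zeroState _
  rw [Fintype.sum_bool, withFlag, withFlag, LinearMap.comp_apply, keepWires_isTP]
  simp [h]

theorem withFlag_isCP [DecidableEq A] {T : SuperOp A (Fin n → Bit)} (hT : IsCP T) (hT' : IsTNI T)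
    (flag : Bool) : IsCP (withFlag c T flag) := by
  cases flag with
  | true => exact (keepWires_isCP _).comp hT
  | false =>
    intro E _ ρ hρ
    -- the rejecting branch prepares `Ω` and leaves the reduced state of the side register
    have hK := (posSemidef_zeroState {i // i ∈ c.out}).kronecker
      (posSemidef_traceLeft_sub hT hT' hρ)
    have e : (withFlag c T false).amp E ρ = Matrix.kroneckerMap (· * ·) c.Omega
        (traceLeft ρ - traceLeft (T.amp E ρ)) := by
      ext p q
      rw [amp_apply, Matrix.kroneckerMap_apply, mul_comm]
      rfl
    rw [e]
    exact hK

/-- The state given to the last algorithm in the ideal game, when `T` is the accepting branch of the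
verified decryption of the encrypted zeros and `ρ` is the state of the plaintexts. -/
def idealBranch (T : SuperOp (Fin n → Bit) (Fin n → Bit))
    (ρ : Matrix ((Fin n → Bit) × R) ((Fin n → Bit) × R) ℂ) (flag : Bool) :
    Matrix (c.Out × R) (c.Out × R) ℂ :=
  (withFlag c T flag (zeroState (Fin n))).trace •
    (if flag then c.channel else discardPrepare c.Omega).amp R ρ

theorem discardPrepare_zeroState_isCP {ι : Type} [Fintype ι] [DecidableEq ι] [DecidableEq A] :
    IsCP (discardPrepare (zeroState ι) : SuperOp A (ι → Bit)) :=
  (hasKraus_discardPrepare (0 : ι → Bit)).isCP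

theorem discardPrepare_zeroState_isTP {ι : Type} [Fintype ι] [DecidableEq ι] :
    IsTP (discardPrepare (zeroState ι) : SuperOp A (ι → Bit)) := by
  intro ρ
  simp [discardPrepare, trace_zeroState]

theorem trace_smul_posSemidef {ι κ : Type} [Fintype ι] [Fintype κ] {σ : Matrix ι ι ℂ}
    {ρ : Matrix κ κ ℂ} (hσ : σ.PosSemidef) (hρ : ρ.PosSemidef) : (σ.trace • ρ).PosSemidef :=
  hρ.smul hσ.trace_nonneg

variable [DecidableEq R] {T : SuperOp (Fin n → Bit) (Fin n → Bit)}
  {ρ : Matrix ((Fin n → Bit) × R) ((Fin n → Bit) × R) ℂ}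

theorem posSemidef_idealBranch (hT : IsCP T) (hT' : IsTNI T) (hρ : ρ.PosSemidef) (flag : Bool) :
    (idealBranch c T ρ flag).PosSemidef := by
  refine trace_smul_posSemidef ((withFlag_isCP c hT hT' flag).posSemidef
    (posSemidef_zeroState _)) ?_
  cases flag with
  | true => exact c.channel_isCP R ρ hρ
  | false => exact discardPrepare_zeroState_isCP R ρ hρ

theorem sum_trace_idealBranch : ∑ flag, (idealBranch c T ρ flag).trace = ρ.trace := by
  have h : ∀ flag, (idealBranch c T ρ flag).trace =
      (withFlag c T flag (zeroState (Fin n))).trace * ρ.trace := by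
    intro flag
    rw [idealBranch, Matrix.trace_smul, smul_eq_mul, trace_amp]
    cases flag with
    | true =>
      rw [if_pos rfl, c.channel_isTP, trace_traceRight]
    | false =>
      have := discardPrepare_zeroState_isTP (ι := {i // i ∈ c.out}) (traceRight ρ)
      rw [if_neg Bool.false_ne_true, Circuit.Omega, this, trace_traceRight]
  simp_rw [h]
  rw [← Finset.sum_mul, trace_withFlag, trace_zeroState, one_mul]

theorem sum_trace_withFlag_amp : ∑ flag, ((withFlag c T flag).amp R ρ).trace = ρ.trace := by
  simp_rw [trace_amp]
  rw [trace_withFlag, trace_traceRight]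

/-- The probability of a correct guess in a branch. -/
def guessProb {D : Type} [Fintype D] [DecidableEq D] (P σ₀ σ₁ : Matrix D D ℂ) : ℝ :=
  (1 / 2) * (((1 - P) * σ₀).trace).re + (1 / 2) * ((P * σ₁).trace).re

theorem guessProb_le {D : Type} [Fintype D] [DecidableEq D] {P σ₀ σ₁ : Matrix D D ℂ}
    (hP : P.PosSemidef) (hP' : (1 - P).PosSemidef) (h₀ : σ₀.PosSemidef) (h₁ : σ₁.PosSemidef) :
    guessProb P σ₀ σ₁ ≤ (1 / 2) * σ₀.trace.re + (1 / 2) * σ₁.trace.re := by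
  have e₀ := (Complex.le_def.mp (trace_mul_nonneg hP h₀)).1
  have e₁ := (Complex.le_def.mp (trace_mul_nonneg hP' h₁)).1
  rw [Matrix.sub_mul, Matrix.one_mul, Matrix.trace_sub, Complex.sub_re, Complex.zero_re] at e₁
  rw [guessProb, Matrix.sub_mul, Matrix.one_mul, Matrix.trace_sub, Complex.sub_re]
  rw [Complex.zero_re] at e₀
  linarith

/-- Equal states cannot be distinguished. -/
theorem guessProb_self {D : Type} [Fintype D] [DecidableEq D] (P σ : Matrix D D ℂ) :
    guessProb P σ σ = (1 / 2) * σ.trace.re := by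
  rw [guessProb, Matrix.sub_mul, Matrix.one_mul, Matrix.trace_sub, Complex.sub_re]
  ring

variable {P : Bool → Matrix (c.Out × R) (c.Out × R) ℂ}

theorem sum_guessProb_le (hT : IsCP T) (hT' : IsTNI T) (hρ : ρ.PosSemidef)
    (hP : ∀ flag, (P flag).PosSemidef) (hP' : ∀ flag, (1 - P flag).PosSemidef) :
    ∑ flag, guessProb (P flag) ((withFlag c T flag).amp R ρ) (idealBranch c T ρ flag) ≤
      ρ.trace.re := by
  refine (Finset.sum_le_sum fun flag _ => guessProb_le (hP flag) (hP' flag)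
    (withFlag_isCP c hT hT' flag R ρ hρ) (posSemidef_idealBranch c hT hT' hρ flag)).trans ?_
  rw [Finset.sum_add_distrib, ← Finset.mul_sum, ← Finset.mul_sum, ← Complex.re_sum,
    ← Complex.re_sum, sum_trace_withFlag_amp, sum_trace_idealBranch]
  linarith

/-- If the verified decryption always rejects, or performs the circuit, the real and the ideal game
coincide. -/
theorem withFlag_amp_eq_idealBranch (h : T = 0 ∨ T = runGates c.gates 0) (flag : Bool) :
    (withFlag c T flag).amp R ρ = idealBranch c T ρ flag := by
  rcases h with rfl | rfl
  · cases flag with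
    | true =>
      have h0 : withFlag c (0 : SuperOp (Fin n → Bit) (Fin n → Bit)) true = 0 :=
        LinearMap.comp_zero _
      rw [idealBranch, h0, LinearMap.zero_apply, Matrix.trace_zero, zero_smul]
      rfl
    | false =>
      have h0 : withFlag c (0 : SuperOp (Fin n → Bit) (Fin n → Bit)) false =
          discardPrepare c.Omega := by
        rw [withFlag, LinearMap.comp_zero, sub_zero, discardPrepare]
      have h1 := discardPrepare_zeroState_isTP (ι := {i // i ∈ c.out}) (zeroState (Fin n))
      rw [idealBranch, h0, if_neg Bool.false_ne_true, Circuit.Omega, h1, trace_zeroState, one_smul]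
  · cases flag with
    | true =>
      have h0 : withFlag c (runGates c.gates 0) true = c.channel := rfl
      rw [idealBranch, h0, if_pos rfl, c.channel_isTP, trace_zeroState, one_smul]
    | false =>
      have h0 : withFlag c (runGates c.gates 0) false = 0 := by
        have : Matrix.traceLinearMap (Fin n → Bit) ℂ ℂ ∘ₗ runGates c.gates 0 =
            Matrix.traceLinearMap (Fin n → Bit) ℂ ℂ :=
          LinearMap.ext (runGates_isCP_isTP c.gates ∅ 0 c.wellFormed).2
        rw [withFlag, this, sub_self, LinearMap.zero_smulRight]
      rw [idealBranch, h0, LinearMap.zero_apply, Matrix.trace_zero, zero_smul]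
      rfl

theorem sum_guessProb_eq (h : T = 0 ∨ T = runGates c.gates 0) :
    ∑ flag, guessProb (P flag) ((withFlag c T flag).amp R ρ) (idealBranch c T ρ flag) =
      (1 / 2) * ρ.trace.re := by
  simp_rw [← withFlag_amp_eq_idealBranch c h, guessProb_self]
  rw [← Finset.mul_sum, ← Complex.re_sum, sum_trace_withFlag_amp]

end Branch

/-! ### The average over all keys -/

section GuessLinear

variable {D : Type} [Fintype D] [DecidableEq D] (P : Matrix D D ℂ)

theorem guessProb_sum {ι : Type} (s : Finset ι) (σ₀ σ₁ : ι → Matrix D D ℂ) :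
    guessProb P (∑ i ∈ s, σ₀ i) (∑ i ∈ s, σ₁ i) = ∑ i ∈ s, guessProb P (σ₀ i) (σ₁ i) := by
  simp only [guessProb, Matrix.trace_sum, Complex.re_sum, Finset.mul_sum, Finset.sum_add_distrib]

theorem guessProb_smul (d : ℝ) (σ₀ σ₁ : Matrix D D ℂ) :
    guessProb P ((d : ℂ) • σ₀) ((d : ℂ) • σ₁) = d * guessProb P σ₀ σ₁ := by
  simp only [guessProb, Matrix.mul_smul, Matrix.trace_smul, smul_eq_mul, Complex.re_ofReal_mul]
  ring

end GuessLinear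

namespace TC

variable {m t n : ℕ} (Q : SelfDualCSS m t) (c : Circuit n) {R : Type} [Fintype R] [DecidableEq R]
  (F : (Fin n → Bit) → R → Matrix (Fin n → BlockLabel m) (Fin n → BlockLabel m) ℂ)
  (P : Bool → Matrix (c.Out × R) (c.Out × R) ℂ)

/-- The winning probability for the key `(π, x, z)` in a Kraus branch of the adversary with attack
operators `F`. -/
def keyGuess (π : Equiv.Perm (Pos m)) (x z : Fin n → BlockLabel m) : ℝ :=
  ∑ flag, guessProb (P flag)
    ((verDec Q (π, x, z) c flag).amp R (ketbra (realKet F (encAll Q π x z))))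
    ((if flag then c.channel else discardPrepare c.Omega).amp R (Matrix.of fun p q =>
      (verDec Q (π, x, z) c flag (Matrix.vecMulVec (idealKet F (encAll Q π x z) p)
        (star (idealKet F (encAll Q π x z) q)))).trace))

/-- The winning probability in the branch of the Pauli error `X^x Z^z`. -/
def pauliGuess (π : Equiv.Perm (Pos m)) (x z : Fin n → BlockLabel m) : ℝ :=
  ∑ flag, guessProb (P flag)
    ((withFlag c (pauliRun Q π c x z) flag).amp R (ketbra (pauliKet c F x z)))
    (idealBranch c (pauliRun Q π c x z) (ketbra (pauliKet c F x z)) flag)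

/-- The one-time pad turns every attack into a mixture of Pauli errors. -/
theorem sum_keyGuess (π : Equiv.Perm (Pos m)) :
    ∑ x, ∑ z, keyGuess Q c F P π x z =
      (Fintype.card (Fin n → BlockLabel m) : ℝ) ^ 2 * ∑ x, ∑ z, pauliGuess Q c F P π x z := by
  have hswap : ∀ f : (Fin n → BlockLabel m) → (Fin n → BlockLabel m) → Bool → ℝ,
      ∑ x, ∑ z, ∑ flag, f x z flag = ∑ flag, ∑ x, ∑ z, f x z flag := by
    intro f
    simp_rw [Finset.sum_comm (s := Finset.univ (α := Fin n → BlockLabel m))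
      (t := Finset.univ (α := Bool))]
  simp only [keyGuess, pauliGuess]
  rw [hswap, hswap, Finset.mul_sum]
  refine Finset.sum_congr rfl fun flag _ => ?_
  simp_rw [← guessProb_sum]
  rw [← guessProb_smul, sum_verDec_realKet]
  congr 1
  · push_cast
    rfl
  · simp_rw [← map_sum, idealBranch]
    have hsum : ∑ x, ∑ z, Matrix.of (fun p q =>
        (verDec Q (π, x, z) c flag (Matrix.vecMulVec (idealKet F (encAll Q π x z) p)
          (star (idealKet F (encAll Q π x z) q)))).trace) =
        (((Fintype.card (Fin n → BlockLabel m) : ℝ) ^ 2 : ℝ) : ℂ) • ∑ x, ∑ z,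
          (withFlag c (pauliRun Q π c x z) flag (zeroState (Fin n))).trace •
            ketbra (pauliKet c F x z) := by
      ext p q
      simp only [Matrix.sum_apply, Matrix.smul_apply, smul_eq_mul, Matrix.of_apply]
      rw [sum_verDec_idealKet]
      push_cast
      rfl
    rw [hsum, map_smul]
    simp_rw [map_sum, map_smul]

/-- Some trap check of the Pauli error `X^x Z^z` sees more errors than the code corrects. -/
def IsHeavy (t : ℕ) (x z : Fin n → BlockLabel m) : Prop :=
  ∃ p ∈ checks c.gates x z ∅, t < hammingNorm p.2

/-- All trap checks accept the Pauli error `X^x Z^z`. -/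
def Undetected (π : Equiv.Perm (Pos m)) (x z : Fin n → BlockLabel m) : Prop :=
  ∀ p ∈ checks c.gates x z ∅, Passes π p

open Classical in
/-- In the branch of a Pauli error, the adversary gains an advantage only if the error is heavy and
not detected by the traps. -/
theorem pauliGuess_le (hP : ∀ flag, (P flag).PosSemidef) (hP' : ∀ flag, (1 - P flag).PosSemidef)
    (π : Equiv.Perm (Pos m)) (x z : Fin n → BlockLabel m) :
    pauliGuess Q c F P π x z ≤ (1 / 2 + (1 / 2) *
      if IsHeavy c t x z ∧ Undetected c π x z then 1 else 0) *
        (ketbra (pauliKet c F x z)).trace.re := by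
  have henc : encN Q π n = tensM (encM Q π ∅ 0) := by
    rw [encN]
    congr 1
    funext k
    rw [encM_of_notMem Q π (Finset.notMem_empty k)]
  by_cases hu : Undetected c π x z
  · by_cases hh : IsHeavy c t x z
    · rw [if_pos ⟨hh, hu⟩]
      obtain ⟨hCP, hTNI⟩ := evalAccept_isCP_isTNI Q π c.gates x z ∅ 0 c.wellFormed
      have := sum_guessProb_le c (hCP.comp (isCP_conj (encN Q π n)))
        (hTNI.comp (isTP_conj _ (encN_isometry Q π)).isTNI (isCP_conj _))
        (posSemidef_ketbra (pauliKet c F x z)) hP hP'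
      refine this.trans (le_of_eq ?_)
      ring
    · rw [if_neg fun h => hh h.1]
      refine le_of_eq ?_
      rw [pauliGuess, sum_guessProb_eq c (Or.inr ?_)]
      · ring
      · rw [pauliRun, henc, evalAccept_comp_encM Q π c.gates x z ∅ 0 c.wellFormed hu, projM_empty,
          conj_one, LinearMap.comp_id]
        intro p hp
        by_contra! hlt
        exact hh ⟨p, hp, hlt⟩
  · rw [if_neg fun h => hu h.2]
    refine le_of_eq ?_
    rw [pauliGuess, sum_guessProb_eq c (Or.inl ?_)]
    · ring
    · rw [pauliRun, henc]
      refine evalAccept_comp_encM_eq_zero Q π c.gates x z ∅ 0 c.wellFormed ?_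
      simpa [Undetected] using hu

open Classical in
/-- A heavy error escapes detection with exponentially small probability over the secret
permutation. -/
theorem sum_isHeavy_undetected_le (Q : SelfDualCSS m t) (x z : Fin n → BlockLabel m) :
    ∑ π : Equiv.Perm (Pos m), (if IsHeavy c t x z ∧ Undetected c π x z then (1 : ℝ) else 0) ≤
      (2 / 3) ^ (t + 1) * Fintype.card (Equiv.Perm (Pos m)) := by
  by_cases hh : IsHeavy c t x z
  · obtain ⟨⟨k, v⟩, hp, hlt⟩ := hh
    rw [Finset.sum_boole]
    refine le_trans ?_ (card_passes_le Q.length_pos k v hlt)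
    exact_mod_cast Finset.card_le_card fun π hπ => by
      rw [Finset.mem_filter] at hπ ⊢
      exact ⟨hπ.1, hπ.2.2 _ hp⟩
  · simp only [hh, false_and, if_false, Finset.sum_const_zero]
    positivity

/-- The average over all keys of the winning probability in a Kraus branch of the adversary. -/
theorem sum_sum_keyGuess_le (hP : ∀ flag, (P flag).PosSemidef)
    (hP' : ∀ flag, (1 - P flag).PosSemidef) :
    ∑ π, ∑ x, ∑ z, keyGuess Q c F P π x z ≤
      (Fintype.card (TCKey m n) : ℝ) * ((1 / 2 + (1 / 2) * (2 / 3) ^ (t + 1)) *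
        ((Fintype.card (Fin n → BlockLabel m) : ℂ)⁻¹ *
          ∑ b, ∑ r, ∑ w, ∑ v, F b r v w * star (F b r v w)).re) := by
  classical
  have hw : ∀ x z, 0 ≤ (ketbra (pauliKet c F x z)).trace.re := fun x z =>
    (Complex.le_def.mp (posSemidef_ketbra (pauliKet c F x z)).trace_nonneg).1
  have hxz : ∀ x z, ∑ π, pauliGuess Q c F P π x z ≤ (Fintype.card (Equiv.Perm (Pos m)) : ℝ) *
      ((1 / 2 + (1 / 2) * (2 / 3) ^ (t + 1)) * (ketbra (pauliKet c F x z)).trace.re) := by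
    intro x z
    refine (Finset.sum_le_sum fun π _ => pauliGuess_le Q c F P hP hP' π x z).trans ?_
    rw [← Finset.sum_mul, ← mul_assoc]
    refine mul_le_mul_of_nonneg_right ?_ (hw x z)
    rw [Finset.sum_add_distrib, ← Finset.mul_sum, Finset.sum_const, Finset.card_univ, nsmul_eq_mul]
    have := sum_isHeavy_undetected_le c Q x z
    linarith
  simp_rw [sum_keyGuess]
  rw [← Finset.mul_sum, ← sum_trace_ketbra_pauliKet]
  have hcomm : ∑ π, ∑ x, ∑ z, pauliGuess Q c F P π x z =
      ∑ x, ∑ z, ∑ π, pauliGuess Q c F P π x z := by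
    rw [Finset.sum_comm]
    exact Finset.sum_congr rfl fun x _ => Finset.sum_comm
  have hcard : (Fintype.card (TCKey m n) : ℝ) = (Fintype.card (Fin n → BlockLabel m) : ℝ) ^ 2 *
      Fintype.card (Equiv.Perm (Pos m)) := by
    rw [Fintype.card_prod, Fintype.card_prod]
    push_cast
    ring
  rw [hcomm, hcard, mul_assoc]
  refine mul_le_mul_of_nonneg_left ?_ (by positivity)
  simp_rw [Complex.re_sum, Finset.mul_sum]
  exact Finset.sum_le_sum fun x _ => Finset.sum_le_sum fun z _ => hxz x z

theorem glue_encQubit {n₁ n₂ : ℕ} (π : Equiv.Perm (Pos m)) (x z : Fin (n₁ + n₂) → BlockLabel m) :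
    glue (Matrix.of fun c b => ∏ i, encQubit Q π (x (Fin.castAdd n₂ i)) (z (Fin.castAdd n₂ i))
        (c i) (b i))
      (Matrix.of fun c b => ∏ i, encQubit Q π (x (Fin.natAdd n₁ i)) (z (Fin.natAdd n₁ i))
        (c i) (b i)) = encAll Q π x z := by
  ext w b
  rw [encAll, pauliN, encN, tensM_mul, tensM_apply, Fin.prod_univ_add]
  simp_rw [← encQubit_eq]
  rfl

end TC

/-- The trap code scheme is secure up to an exponentially small advantage. -/
theorem winProb_le (F : CSSFamily) {κ : ℕ} (A : Adversary (TC F) κ) :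
    A.winProb ≤ 1 / 2 + (1 / 2) * (2 / 3) ^ (κ + 1) := by
  let G (j : Fin A.A₂.size) (l : Fin A.A₁.size) (k : Fin A.A₀.size) :
      (Fin A.n → Bit) → Fin A.d₂ →
        Matrix (Fin A.n → BlockLabel (F.m κ)) (Fin A.n → BlockLabel (F.m κ)) ℂ :=
    A.attackOp (fun _ => 1) j l k
  have hε : (1 : Matrix Unit Unit ℂ) = ketbra fun _ => 1 := by
    ext p q
    rw [ketbra_apply, Matrix.one_apply, if_pos (Subsingleton.elim p q), star_one, one_mul]
  have hbranch : ∀ π x z j, ∑ flag, guessProb (A.A₃ (A.circ j) flag)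
      (A.real (π, x, z) j flag) (A.ideal (π, x, z) j flag) =
      ∑ l, ∑ k, TC.keyGuess (F.code κ) (A.circ j) (G j l k) (A.A₃ (A.circ j)) π x z := by
    intro π x z j
    have hr := fun flag => A.real_eq (π, x, z) (fun _ => 1) _ _ hε rfl rfl j flag
    have hi := fun flag => A.ideal_eq (π, x, z) (fun _ => 1) _ _ hε rfl rfl j flag
    simp_rw [hr, hi, guessProb_sum]
    rw [Finset.sum_comm]
    refine Finset.sum_congr rfl fun l _ => ?_
    rw [Finset.sum_comm]
    refine Finset.sum_congr rfl fun k _ => ?_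
    rw [TC.keyGuess, ← TC.glue_encQubit]
    rfl
  have hwin : A.winProb = (Fintype.card (TCKey (F.m κ) A.n) : ℝ)⁻¹ * ∑ j, ∑ l, ∑ k, ∑ π, ∑ x, ∑ z,
      TC.keyGuess (F.code κ) (A.circ j) (G j l k) (A.A₃ (A.circ j)) π x z := by
    have h1 : A.winProb = ∑ sk : TCKey (F.m κ) A.n,
        (PMF.uniformOfFintype (TCKey (F.m κ) A.n) sk).toReal * ∑ j, ∑ flag,
          guessProb (A.A₃ (A.circ j) flag) (A.real sk j flag) (A.ideal sk j flag) := rfl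
    rw [h1]
    simp_rw [PMF.uniformOfFintype_apply, ENNReal.toReal_inv, ENNReal.toReal_natCast]
    rw [← Finset.mul_sum]
    congr 1
    rw [Fintype.sum_prod_type]
    simp_rw [Fintype.sum_prod_type, hbranch]
    simp only [← Fintype.sum_prod_type']
    exact Finset.sum_nbij' (fun ⟨π, x, z, j, l, k⟩ => (j, l, k, π, x, z))
      (fun ⟨j, l, k, π, x, z⟩ => (π, x, z, j, l, k))
      (fun _ _ => mem_univ _) (fun _ _ => mem_univ _) (fun _ _ => rfl) (fun _ _ => rfl)
      (fun _ _ => rfl)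
  have hG : ∑ j, ∑ l, ∑ k, ((Fintype.card (Fin A.n → BlockLabel (F.m κ)) : ℂ)⁻¹ *
      ∑ b, ∑ r, ∑ w, ∑ v, G j l k b r v w * star (G j l k b r v w)).re = 1 := by
    simp_rw [← Complex.re_sum, ← Finset.mul_sum]
    have h := A.sum_attackOp (fun _ => 1) (by
      change ∑ e : Unit, (1 : ℂ) * star 1 = 1
      simp)
    have h' : ∑ j, ∑ l, ∑ k, ∑ b, ∑ r, ∑ w, ∑ v, G j l k b r v w * star (G j l k b r v w) =
      (Fintype.card (Fin A.n → BlockLabel (F.m κ)) : ℂ) := h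
    rw [h', inv_mul_cancel₀ card_labels_ne_zero, Complex.one_re]
  have hcard : (0 : ℝ) < Fintype.card (TCKey (F.m κ) A.n) := by
    exact_mod_cast Fintype.card_pos
  rw [hwin, inv_mul_le_iff₀ hcard]
  calc _ ≤ ∑ j, ∑ l, ∑ k, (Fintype.card (TCKey (F.m κ) A.n) : ℝ) *
        ((1 / 2 + (1 / 2) * (2 / 3) ^ (κ + 1)) *
        ((Fintype.card (Fin A.n → BlockLabel (F.m κ)) : ℂ)⁻¹ *
          ∑ b, ∑ r, ∑ w, ∑ v, G j l k b r v w * star (G j l k b r v w)).re) :=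
        Finset.sum_le_sum fun j _ => Finset.sum_le_sum fun l _ => Finset.sum_le_sum fun k _ =>
          TC.sum_sum_keyGuess_le _ _ _ _ (A.A₃_nonneg _) (A.A₃_le_one _)
    _ = _ := by
        simp_rw [← Finset.mul_sum]
        rw [hG, mul_one]

end TrapCode

end

/-- The trap code scheme `TC` satisfies `κ`-IND-VER-2. -/
theorem mainTheorem4 (F : TrapCode.CSSFamily) : (TrapCode.TC F).IndVer2 := by
  intro A
  refine ⟨fun κ => (1 / 2) * (2 / 3) ^ (κ + 1), fun d => ?_, fun κ => TrapCode.winProb_le F (A κ)⟩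
  have h := tendsto_pow_const_mul_const_pow_of_abs_lt_one d
    (show |(2 / 3 : ℝ)| < 1 by rw [abs_of_pos] <;> norm_num)
  have h' := h.const_mul (1 / 3 : ℝ)
  rw [mul_zero] at h'
  refine h'.congr fun κ => ?_
  ring
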